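/- \textbf{Setting.} Let $N$ be a lattice (free abelian group of finite rank) with dual lattice $M$, and let $\rho\subset N_{\mathbf R}$ be a strictly convex rational polyhedral cone such that $\rho^\vee\subset M_{\mathbf R}$ is also strictly convex. For a rational cone $\sigma$ put $Z_{\sigma,N}=Z_\sigma=\operatorname{Spec}\mathbf C[\sigma^\vee\cap M]$; for a (finite) fan $\Sigma$ let $Z_\Sigma$ be the toric variety glued from the $Z_\sigma$, $\sigma\in\Sigma$. Denote by $N_\sigma$ the sublattice of $N$ spanned by $\sigma\cap N$. Let $\Lambda$ be a finitely generated submonoid of a lattice which it generates as a group $-\Lambda+\Lambda$, and let $Z^\Lambda=\operatorname{Spec}\mathbf C[\Lambda]\subset Z_\rho$ be an equivariant embedding, given by a surjective homomorphism of semigroups $\rho^\vee\cap M\to\Lambda$ which extends to a homomorphism of lattices $\varphi:M\to-\Lambda+\Lambda$. Put $\ell=(\operatorname{Ker}\varphi_{\mathbf R})^\perp\subset N_{\mathbf R}$ and $\sigma_0=\rho\cap\ell$. Let $\Sigma$ be a subdivision of $\rho$ (a fan with support $\rho$) with $\sigma_0\in\Sigma$, let $\pi_\Sigma:Z_\Sigma\to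 Z_\rho$ be the toric modification, and let $Z^\Lambda_\Sigma\subset Z_\Sigma$ be the strict transform of $Z^\Lambda$, i.e. the closure, with its reduced structure, of $\pi_\Sigma^{-1}(Z^\Lambda\cap U)$, where $U\subset Z_\rho$ is the largest open subset over which $\pi_\Sigma$ is an isomorphism (the complement of the discriminant locus). \textbf{Definitions.} A modification is a proper birational morphism. A resolution of the fan $\Sigma$ is a subdivision $\Sigma'$ of $\Sigma$, all of whose cones are regular (generated by part of a basis of $N$), which contains every regular cone of $\Sigma$. The morphism $\pi_\Sigma$ is a partial embedded resolution of a subvariety $V\subset Z_\rho$ if for every resolution $\Sigma'$ of $\Sigma$ the composite $\pi:Z_{\Sigma'}\to Z_\Sigma\to Z_\rho$ is an embedded resolution of $V$, that is: $\pi$ is a modification; it restricts to a modification $V'\to V$ of the strict transform $V'$ of $V$; $V'$ is nonsingular and transversal to the torus orbits of $Z_{\Sigma'}$ contained in the exceptional locus of $\pi$ (the preimage of its discriminant locus); and $V'\to V$ is an isomorphism outside the singular locus of $V$. \textbf{Proposition.} \begin{enumerate} \item The restriction $Z^\Lambda_\Sigma\to Z^\Lambda$ of $\pi_\Sigma$ is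 the normalization map (it is finite and birational, and $Z^\Lambda_\Sigma$ is normal). If $\dim\sigma_0=\operatorname{rk}(-\Lambda+\Lambda)$ (equivalently, if the cone $\mathbf R_{\ge0}\Lambda$ is strictly convex), then $Z^\Lambda_\Sigma$ is isomorphic to $Z_{\sigma_0,N_{\sigma_0}}$ over $\mathbf C$. \item The morphism $\pi_\Sigma$ is a partial embedded resolution of $Z^\Lambda\subset Z_\rho$. \end{enumerate} -/

import Mathlib

open AlgebraicGeometry CategoryTheory CategoryTheory.Limits
open scoped TensorProduct

noncomputable section

namespace Toric

section Cones

variable (N : Type) [AddCommGroup N]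

/-- The dual lattice `M` of the lattice `N`. -/
abbrev DualLattice : Type := Module.Dual ℤ N

/-- The real vector space `N_ℝ = N ⊗ ℝ` spanned by a lattice. -/
abbrev RealSpan : Type := ℝ ⊗[ℤ] N

/-- The pairing `M_ℝ × N_ℝ → ℝ`, i.e. the real bilinear extension of `M × N → ℤ`. -/
def pairing : RealSpan (DualLattice N) →ₗ[ℝ] RealSpan N →ₗ[ℝ] ℝ :=
  LinearMap.liftBaseChange ℝ
    (((LinearMap.liftBaseChangeEquiv (R := ℤ) (M := N) (N := ℝ) ℝ).toLinearMap.restrictScalars ℤ) ∘ₗ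
      (Algebra.linearMap ℤ ℝ).compRight ℤ)

theorem pairing_tmul (a b : ℝ) (m : DualLattice N) (n : N) :
    pairing N (a ⊗ₜ m) (b ⊗ₜ n) = a * b * (m n : ℤ) := by
  simp [pairing, mul_assoc]

variable {N}

/-- The dual cone `σ^∨ ⊆ M_ℝ`. -/
def dualCone (σ : PointedCone ℝ (RealSpan N)) : PointedCone ℝ (RealSpan (DualLattice N)) :=
  PointedCone.dual (pairing N).flip σ

/-- The semigroup `σ^∨ ∩ M`. -/
def dualMonoid (σ : PointedCone ℝ (RealSpan N)) : AddSubmonoid (DualLattice N) where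
  carrier := {m | (1 : ℝ) ⊗ₜ[ℤ] m ∈ dualCone σ}
  add_mem' {a b} ha hb := by
    simpa only [Set.mem_ofPred_eq, TensorProduct.tmul_add] using add_mem ha hb
  zero_mem' := by
    simp only [Set.mem_ofPred_eq, TensorProduct.tmul_zero]
    exact zero_mem _

theorem mem_dualMonoid {σ : PointedCone ℝ (RealSpan N)} {m : DualLattice N} :
    m ∈ dualMonoid σ ↔ ∀ x ∈ σ, 0 ≤ pairing N (1 ⊗ₜ m) x := Iff.rfl

theorem dualMonoid_anti {σ τ : PointedCone ℝ (RealSpan N)} (h : σ ≤ τ) :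
    dualMonoid τ ≤ dualMonoid σ := fun _ hm _ hx => hm (h hx)

/-- A cone is rational (polyhedral) if it is generated by finitely many lattice vectors. -/
def IsRational (σ : PointedCone ℝ (RealSpan N)) : Prop :=
  ∃ s : Finset N, σ = PointedCone.hull ℝ ((fun n : N => (1 : ℝ) ⊗ₜ[ℤ] n) '' (s : Set N))

/-- A cone is strictly convex if it contains no linear subspace of positive dimension, i.e. if its
largest linear subspace is zero. -/
def IsStrictlyConvex {E : Type} [AddCommGroup E] [Module ℝ E] (σ : PointedCone ℝ E) : Prop :=
  σ.lineal = ⊥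

/-- `τ` is a face of the rational cone `σ`: it is cut out on `σ` by an integral linear form which
is nonnegative on `σ`. -/
def IsFace (τ σ : PointedCone ℝ (RealSpan N)) : Prop :=
  ∃ m ∈ dualMonoid σ, ∀ x, x ∈ τ ↔ x ∈ σ ∧ pairing N (1 ⊗ₜ m) x = 0

/-- A cone is regular if it is generated by a part of a basis of the lattice. -/
def IsRegularCone (σ : PointedCone ℝ (RealSpan N)) : Prop :=
  ∃ (k : ℕ) (b : Module.Basis (Fin k) ℤ N) (s : Set (Fin k)),
    σ = PointedCone.hull ℝ ((fun i => (1 : ℝ) ⊗ₜ[ℤ] b i) '' s)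

/-- The lattice `N_σ` spanned by `σ ∩ N`. -/
def coneLattice (σ : PointedCone ℝ (RealSpan N)) : Submodule ℤ N :=
  Submodule.span ℤ {n : N | (1 : ℝ) ⊗ₜ[ℤ] n ∈ σ}

/-- The cone `σ`, viewed in the real vector space spanned by `N_σ`. -/
def coneInLattice (σ : PointedCone ℝ (RealSpan N)) : PointedCone ℝ (RealSpan (coneLattice σ)) :=
  σ.comap ((coneLattice σ).subtype.baseChange ℝ)

theorem exists_add_nsmul_mem {σ τ : PointedCone ℝ (RealSpan N)} (hσ : IsRational σ)
    {m : DualLattice N} (hm : m ∈ dualMonoid σ)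
    (hτ : ∀ x, x ∈ τ ↔ x ∈ σ ∧ pairing N (1 ⊗ₜ m) x = 0)
    {w : DualLattice N} (hw : w ∈ dualMonoid τ) :
    ∃ k : ℕ, ∀ j, k ≤ j → w + j • m ∈ dualMonoid σ := by
  classical
  obtain ⟨s, rfl⟩ := hσ
  have key : ∀ n ∈ s, ∃ k : ℕ, ∀ j, k ≤ j → (0 : ℤ) ≤ w n + j * m n := by
    intro n hn
    have hmem : (1 : ℝ) ⊗ₜ[ℤ] n ∈
        PointedCone.hull ℝ ((fun n : N => (1 : ℝ) ⊗ₜ[ℤ] n) '' (s : Set N)) :=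
      PointedCone.subset_hull ⟨n, hn, rfl⟩
    have h1 := mem_dualMonoid.1 hm _ hmem
    rw [pairing_tmul] at h1
    have h1' : (0 : ℤ) ≤ m n := by
      have : (0 : ℝ) ≤ (m n : ℤ) := by simpa using h1
      exact_mod_cast this
    rcases h1'.eq_or_lt with h0 | h0
    · refine ⟨0, fun j _ => ?_⟩
      have h2 := mem_dualMonoid.1 hw _ ((hτ _).2 ⟨hmem, by rw [pairing_tmul, ← h0]; simp⟩)
      rw [pairing_tmul] at h2
      have h2' : (0 : ℝ) ≤ (w n : ℤ) := by simpa using h2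
      have h3 : (0 : ℤ) ≤ w n := by exact_mod_cast h2'
      rw [← h0]; simpa using h3
    · refine ⟨(w n).natAbs, fun j hj => ?_⟩
      have : ((w n).natAbs : ℤ) ≤ j := by exact_mod_cast hj
      have h4 : -(w n) ≤ (w n).natAbs := by omega
      nlinarith
  choose! k hk using key
  refine ⟨s.sup k, fun j hj => ?_⟩
  rw [mem_dualMonoid]
  change w + j • m ∈ dualMonoid _
  have : (1 : ℝ) ⊗ₜ[ℤ] (w + j • m) ∈ dualCone
      (PointedCone.hull ℝ ((fun n : N => (1 : ℝ) ⊗ₜ[ℤ] n) '' (s : Set N))) := by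
    rw [dualCone, PointedCone.dual_hull]
    rintro _ ⟨n, hn, rfl⟩
    have h5 := hk n hn j ((Finset.le_sup hn).trans hj)
    rw [LinearMap.flip_apply, pairing_tmul]
    have h6 : (0 : ℝ) ≤ ((w n + j * m n : ℤ) : ℝ) := by exact_mod_cast h5
    simpa using h6
  exact this

end Cones

section Affine

/-- The complex affine scheme `Z^P = Spec ℂ[P]` of a commutative monoid `P`. -/
def monoidScheme (P : Type) [AddCommMonoid P] : Scheme.{0} :=
  Spec (CommRingCat.of (AddMonoidAlgebra ℂ P))

/-- The structure morphism `Z^P → Spec ℂ`. -/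
def monoidScheme.structure (P : Type) [AddCommMonoid P] :
    monoidScheme P ⟶ Spec (CommRingCat.of ℂ) :=
  Spec.map (CommRingCat.ofHom (algebraMap ℂ (AddMonoidAlgebra ℂ P)))

/-- The morphism `Z^Q → Z^P` defined by a homomorphism `P → Q`. -/
def monoidScheme.map {P Q : Type} [AddCommMonoid P] [AddCommMonoid Q] (f : P →+ Q) :
    monoidScheme Q ⟶ monoidScheme P :=
  Spec.map (CommRingCat.ofHom (AddMonoidAlgebra.mapDomainRingHom ℂ f))

theorem monoidScheme.map_id (P : Type) [AddCommMonoid P] :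
    monoidScheme.map (AddMonoidHom.id P) = 𝟙 _ := by
  rw [monoidScheme.map, AddMonoidAlgebra.mapDomainRingHom_id]
  exact Spec.map_id _

theorem monoidScheme.map_comp {P Q R : Type} [AddCommMonoid P] [AddCommMonoid Q] [AddCommMonoid R]
    (f : P →+ Q) (g : Q →+ R) :
    monoidScheme.map g ≫ monoidScheme.map f = monoidScheme.map (g.comp f) := by
  rw [monoidScheme.map, monoidScheme.map, monoidScheme.map, AddMonoidAlgebra.mapDomainRingHom_comp,
    CommRingCat.ofHom_comp, Spec.map_comp]
  rfl

variable {N : Type} [AddCommGroup N]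

/-- The affine toric variety `Z_{σ,N} = Spec ℂ[σ^∨ ∩ M]`. -/
abbrev affineToric (σ : PointedCone ℝ (RealSpan N)) : Scheme.{0} :=
  monoidScheme (dualMonoid σ)

/-- The morphism `Z_σ → Z_τ` for `σ ⊆ τ`. -/
def affineToric.map {σ τ : PointedCone ℝ (RealSpan N)} (h : σ ≤ τ) :
    affineToric σ ⟶ affineToric τ :=
  monoidScheme.map (AddSubmonoid.inclusion (dualMonoid_anti h))

theorem affineToric.map_refl (σ : PointedCone ℝ (RealSpan N)) :
    affineToric.map (le_refl σ) = 𝟙 _ :=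
  monoidScheme.map_id _

theorem affineToric.map_comp {σ τ κ : PointedCone ℝ (RealSpan N)} (h : σ ≤ τ) (h' : τ ≤ κ) :
    affineToric.map h ≫ affineToric.map h' = affineToric.map (h.trans h') :=
  monoidScheme.map_comp _ _

theorem isLocalization_face {σ τ : PointedCone ℝ (RealSpan N)} (hσ : IsRational σ) (h : τ ≤ σ)
    {m : DualLattice N} (hm : m ∈ dualMonoid σ)
    (hτ : ∀ x, x ∈ τ ↔ x ∈ σ ∧ pairing N (1 ⊗ₜ m) x = 0) :
    letI := (AddMonoidAlgebra.mapDomainRingHom ℂ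
      (AddSubmonoid.inclusion (dualMonoid_anti h))).toAlgebra
    IsLocalization.Away
      (AddMonoidAlgebra.single (⟨m, hm⟩ : dualMonoid σ) (1 : ℂ))
      (AddMonoidAlgebra ℂ (dualMonoid τ)) := by
  classical
  let _ := (AddMonoidAlgebra.mapDomainRingHom ℂ
      (AddSubmonoid.inclusion (dualMonoid_anti h))).toAlgebra
  have hmap : ∀ x : AddMonoidAlgebra ℂ (dualMonoid σ),
      algebraMap (AddMonoidAlgebra ℂ (dualMonoid σ)) (AddMonoidAlgebra ℂ (dualMonoid τ)) x =
        AddMonoidAlgebra.mapDomain (AddSubmonoid.inclusion (dualMonoid_anti h)) x := fun _ => rfl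
  have hneg : -m ∈ dualMonoid τ := by
    intro x hx
    have := ((hτ x).1 hx).2
    simp [TensorProduct.tmul_neg, this]
  have hinj : Function.Injective
      (algebraMap (AddMonoidAlgebra ℂ (dualMonoid σ)) (AddMonoidAlgebra ℂ (dualMonoid τ))) := by
    intro x y hxy
    exact AddMonoidAlgebra.mapDomain_injective
      (AddSubmonoid.inclusion_injective (dualMonoid_anti h)) hxy
  have hpow : ∀ j : ℕ, (AddMonoidAlgebra.single (⟨m, hm⟩ : dualMonoid σ) (1 : ℂ)) ^ j =
      AddMonoidAlgebra.single (j • (⟨m, hm⟩ : dualMonoid σ)) 1 := by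
    intro j; simp [AddMonoidAlgebra.single_pow]
  refine IsLocalization.Away.mk _ ?_ ?_ ?_
  · rw [hmap, AddMonoidAlgebra.mapDomain_single]
    refine IsUnit.of_mul_eq_one (AddMonoidAlgebra.single ⟨-m, hneg⟩ 1) ?_
    rw [AddMonoidAlgebra.single_mul_single, AddMonoidAlgebra.one_def]
    congr 1
    · ext1; simp
    · simp
  · have : ∀ z : AddMonoidAlgebra ℂ (dualMonoid τ), ∃ k : ℕ, ∀ j, k ≤ j →
        ∃ a : AddMonoidAlgebra ℂ (dualMonoid σ), z * algebraMap _ _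
          ((AddMonoidAlgebra.single (⟨m, hm⟩ : dualMonoid σ) (1 : ℂ)) ^ j) = algebraMap _ _ a := by
      intro z
      induction z using AddMonoidAlgebra.induction_linear with
      | zero => exact ⟨0, fun j _ => ⟨0, by simp⟩⟩
      | add x y hx hy =>
        obtain ⟨k, hk⟩ := hx
        obtain ⟨l, hl⟩ := hy
        refine ⟨max k l, fun j hj => ?_⟩
        obtain ⟨a, ha⟩ := hk j (le_of_max_le_left hj)
        obtain ⟨b, hb⟩ := hl j (le_of_max_le_right hj)
        exact ⟨a + b, by rw [add_mul, ha, hb, map_add]⟩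
      | single w c =>
        obtain ⟨k, hk⟩ := exists_add_nsmul_mem hσ hm hτ w.2
        refine ⟨k, fun j hj => ⟨AddMonoidAlgebra.single ⟨_, hk j hj⟩ c, ?_⟩⟩
        rw [hpow, hmap, hmap, AddMonoidAlgebra.mapDomain_single, AddMonoidAlgebra.mapDomain_single,
          AddMonoidAlgebra.single_mul_single, mul_one]
        congr 1
    intro z
    obtain ⟨k, hk⟩ := this z
    obtain ⟨a, ha⟩ := hk k le_rfl
    exact ⟨k, a, by rw [← map_pow]; exact ha⟩
  · intro a b hab
    exact ⟨0, by rw [hinj hab]⟩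

theorem affineToric.isOpenImmersion_map {σ τ : PointedCone ℝ (RealSpan N)} (hσ : IsRational σ)
    (h : τ ≤ σ) (hf : IsFace τ σ) : IsOpenImmersion (affineToric.map h) := by
  obtain ⟨m, hm, hτ⟩ := hf
  let _ := (AddMonoidAlgebra.mapDomainRingHom ℂ
      (AddSubmonoid.inclusion (dualMonoid_anti h))).toAlgebra
  have := isLocalization_face hσ h hm hτ
  exact IsOpenImmersion.of_isLocalization (S := AddMonoidAlgebra ℂ (dualMonoid τ))
    (AddMonoidAlgebra.single (⟨m, hm⟩ : dualMonoid σ) (1 : ℂ))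

theorem affineToric.range_map {σ τ : PointedCone ℝ (RealSpan N)} (hσ : IsRational σ)
    (h : τ ≤ σ) {m : DualLattice N} (hm : m ∈ dualMonoid σ)
    (hτ : ∀ x, x ∈ τ ↔ x ∈ σ ∧ pairing N (1 ⊗ₜ m) x = 0) :
    Set.range (affineToric.map h) = (PrimeSpectrum.basicOpen
      (AddMonoidAlgebra.single (⟨m, hm⟩ : dualMonoid σ) (1 : ℂ)) : Set (PrimeSpectrum _)) := by
  let _ := (AddMonoidAlgebra.mapDomainRingHom ℂ
      (AddSubmonoid.inclusion (dualMonoid_anti h))).toAlgebra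
  have := isLocalization_face hσ h hm hτ
  exact PrimeSpectrum.localization_away_comap_range (AddMonoidAlgebra ℂ (dualMonoid τ))
    (AddMonoidAlgebra.single (⟨m, hm⟩ : dualMonoid σ) (1 : ℂ))

/-- The closed orbit `O_τ` of `Z_τ`, i.e. the closed subset defined by the monomials `X^w` for
`w ∈ (τ^∨ - τ^⊥) ∩ M`. -/
def affineOrbit (τ : PointedCone ℝ (RealSpan N)) : Set (affineToric τ) :=
  (PrimeSpectrum.zeroLocus
    {f : AddMonoidAlgebra ℂ (dualMonoid τ) | ∃ w : dualMonoid τ,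
      (¬ ∀ x ∈ τ, pairing N (1 ⊗ₜ (w : DualLattice N)) x = 0) ∧
        f = AddMonoidAlgebra.single w (1 : ℂ)} : Set (PrimeSpectrum _))

end Affine

/-- A (finite) fan of strictly convex rational cones in `N_ℝ`. -/
structure Fan (N : Type) [AddCommGroup N] where
  /-- The cones of the fan. -/
  cones : Set (PointedCone ℝ (RealSpan N))
  finite : cones.Finite
  isRational : ∀ σ ∈ cones, IsRational σ
  isStrictlyConvex : ∀ σ ∈ cones, IsStrictlyConvex σ
  face_mem : ∀ σ ∈ cones, ∀ τ, IsFace τ σ → τ ∈ cones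
  isFace_inf : ∀ σ ∈ cones, ∀ τ ∈ cones, IsFace (σ ⊓ τ) σ

namespace Fan

variable {N : Type} [AddCommGroup N] (Δ : Fan N)

/-- The support of a fan. -/
def support : Set (RealSpan N) := ⋃ σ ∈ Δ.cones, (σ : Set (RealSpan N))

/-- A fan is regular if all its cones are. -/
def IsRegular : Prop := ∀ σ ∈ Δ.cones, IsRegularCone σ

/-- `Δ'` is a subdivision of `Δ`. -/
def IsSubdivision (Δ' Δ : Fan N) : Prop :=
  Δ'.support = Δ.support ∧ ∀ σ ∈ Δ'.cones, ∃ τ ∈ Δ.cones, σ ≤ τ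

/-- `Δ'` is a resolution of `Δ`: a regular subdivision which contains all regular cones of `Δ`. -/
def IsResolution (Δ' Δ : Fan N) : Prop :=
  IsSubdivision Δ' Δ ∧ Δ'.IsRegular ∧ ∀ σ ∈ Δ.cones, IsRegularCone σ → σ ∈ Δ'.cones

/-- `Δ` is a subdivision of (the fan of faces of) the cone `ρ`, i.e. it is supported on `ρ`. Every
cone of `Δ` is then contained in `ρ`. -/
def Subdivides (ρ : PointedCone ℝ (RealSpan N)) : Prop :=
  Δ.support = (ρ : Set (RealSpan N))

theorem inf_mem {σ τ : PointedCone ℝ (RealSpan N)} (hσ : σ ∈ Δ.cones) (hτ : τ ∈ Δ.cones) :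
    σ ⊓ τ ∈ Δ.cones :=
  Δ.face_mem σ hσ _ (Δ.isFace_inf σ hσ τ hτ)

theorem isFace_of_le {σ τ : PointedCone ℝ (RealSpan N)} (hσ : σ ∈ Δ.cones) (hτ : τ ∈ Δ.cones)
    (h : σ ≤ τ) : IsFace σ τ := by
  have := Δ.isFace_inf τ hτ σ hσ
  rwa [inf_eq_right.2 h] at this

variable {Δ} in
theorem Subdivides.le {ρ : PointedCone ℝ (RealSpan N)} (h : Δ.Subdivides ρ)
    {σ : PointedCone ℝ (RealSpan N)} (hσ : σ ∈ Δ.cones) : σ ≤ ρ := by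
  intro x hx
  have : x ∈ Δ.support := Set.mem_biUnion hσ hx
  rwa [h] at this

/-- The diagram of the affine charts `Z_σ` of a fan and of the inclusions `Z_τ ⊆ Z_σ` for `τ` a
face of `σ`. -/
def diagram : Δ.cones ⥤ Scheme.{0} where
  obj σ := affineToric σ.1
  map f := affineToric.map (leOfHom f)
  map_id _ := affineToric.map_refl _
  map_comp _ _ := (affineToric.map_comp _ _).symm

instance {σ τ : Δ.cones} (f : σ ⟶ τ) : IsOpenImmersion (Δ.diagram.map f) :=
  affineToric.isOpenImmersion_map (Δ.isRational _ τ.2) (leOfHom f)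
    (Δ.isFace_of_le σ.2 τ.2 (leOfHom f))

instance : (Δ.diagram ⋙ Scheme.forget).IsLocallyDirected where
  cond {σ τ κ} f g x y hxy := by
    obtain ⟨m, hm, hmσ⟩ := Δ.isFace_of_le σ.2 κ.2 (leOfHom f)
    obtain ⟨m', hm', hmτ⟩ := Δ.isFace_of_le τ.2 κ.2 (leOfHom g)
    have hr := Δ.isRational _ κ.2
    have hxy' : Δ.diagram.map f x = Δ.diagram.map g y := hxy
    have hinf : ∀ z, z ∈ σ.1 ⊓ τ.1 ↔ z ∈ κ.1 ∧ pairing N (1 ⊗ₜ (m + m')) z = 0 := by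
      intro z
      rw [Submodule.mem_inf, hmσ, hmτ, TensorProduct.tmul_add, map_add, LinearMap.add_apply]
      constructor
      · rintro ⟨⟨h1, h2⟩, -, h3⟩
        exact ⟨h1, by rw [h2, h3, add_zero]⟩
      · rintro ⟨h1, h2⟩
        have h3 := mem_dualMonoid.1 hm z h1
        have h4 := mem_dualMonoid.1 hm' z h1
        exact ⟨⟨h1, by linarith⟩, h1, by linarith⟩
    have hle : σ.1 ⊓ τ.1 ≤ κ.1 := inf_le_left.trans (leOfHom f)
    have h1 : Δ.diagram.map f x ∈ Set.range (affineToric.map (leOfHom f)) := ⟨x, rfl⟩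
    have h2 : Δ.diagram.map f x ∈ Set.range (affineToric.map (leOfHom g)) := ⟨y, hxy'.symm⟩
    have h3 : Δ.diagram.map f x ∈ Set.range (affineToric.map hle) := by
      rw [affineToric.range_map hr _ hm hmσ] at h1
      rw [affineToric.range_map hr _ hm' hmτ] at h2
      rw [affineToric.range_map hr hle (add_mem hm hm') hinf]
      have : AddMonoidAlgebra.single (⟨m + m', add_mem hm hm'⟩ : dualMonoid κ.1) (1 : ℂ) =
          AddMonoidAlgebra.single (⟨m, hm⟩ : dualMonoid κ.1) (1 : ℂ) *
            AddMonoidAlgebra.single (⟨m', hm'⟩ : dualMonoid κ.1) (1 : ℂ) := by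
        rw [AddMonoidAlgebra.single_mul_single, one_mul]
        rfl
      rw [this, PrimeSpectrum.basicOpen_mul]
      exact ⟨h1, h2⟩
    obtain ⟨z, hz⟩ := h3
    let l : Δ.cones := ⟨σ.1 ⊓ τ.1, Δ.inf_mem σ.2 τ.2⟩
    let u : l ⟶ σ := homOfLE (inf_le_left : σ.1 ⊓ τ.1 ≤ σ.1)
    let v : l ⟶ τ := homOfLE (inf_le_right : σ.1 ⊓ τ.1 ≤ τ.1)
    let z' : Δ.diagram.obj l := z
    have hcomp : ∀ {p q : Δ.cones} (a : l ⟶ p) (b : p ⟶ q),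
        Δ.diagram.map b (Δ.diagram.map a z') = Δ.diagram.map (a ≫ b) z' := by
      intro p q a b
      rw [Functor.map_comp, Scheme.Hom.comp_apply]
    refine ⟨l, u, v, z', ?_, ?_⟩
    · exact (Δ.diagram.map f).isOpenEmbedding.injective ((hcomp u f).trans hz)
    · exact (Δ.diagram.map g).isOpenEmbedding.injective ((hcomp v g).trans (hz.trans hxy'))

/-- The toric variety `Z_Δ`, obtained by gluing the affine charts `Z_σ`, `σ ∈ Δ`, along the open
subschemes `Z_τ ⊆ Z_σ`, `τ` a face of `σ`. -/
def toricVariety : Scheme.{0} := colimit Δ.diagram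

/-- The open immersion of a chart. -/
def chart (σ : Δ.cones) : affineToric σ.1 ⟶ Δ.toricVariety := colimit.ι Δ.diagram σ

instance (σ : Δ.cones) : IsOpenImmersion (Δ.chart σ) :=
  inferInstanceAs (IsOpenImmersion (colimit.ι Δ.diagram σ))

/-- The torus orbit `O_τ ⊆ Z_Δ` of a cone of the fan. -/
def orbit (τ : Δ.cones) : Set Δ.toricVariety := Δ.chart τ '' affineOrbit τ.1

theorem map_chart {σ τ : Δ.cones} (h : σ.1 ≤ τ.1) :
    affineToric.map h ≫ Δ.chart τ = Δ.chart σ :=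
  colimit.w Δ.diagram (homOfLE h : σ ⟶ τ)

variable {Δ}

/-- The toric morphism `Z_Δ → Z_ρ` of a subdivision `Δ` of a cone `ρ`. -/
def toCone {ρ : PointedCone ℝ (RealSpan N)} (h : Δ.Subdivides ρ) :
    Δ.toricVariety ⟶ affineToric ρ :=
  colimit.desc Δ.diagram
    { pt := affineToric ρ
      ι :=
        { app := fun σ => affineToric.map (h.le σ.2)
          naturality := fun _ τ f =>
            (affineToric.map_comp (leOfHom f) (h.le τ.2)).trans (Category.comp_id _).symm } }

theorem map_chart_eq {σ : PointedCone ℝ (RealSpan N)} {τ τ' : Δ.cones} (h : σ ≤ τ.1)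
    (h' : σ ≤ τ'.1) :
    affineToric.map h ≫ Δ.chart τ = affineToric.map h' ≫ Δ.chart τ' := by
  let κ : Δ.cones := ⟨τ.1 ⊓ τ'.1, Δ.inf_mem τ.2 τ'.2⟩
  have h1 : κ.1 ≤ τ.1 := inf_le_left
  have h2 : κ.1 ≤ τ'.1 := inf_le_right
  have h3 : σ ≤ κ.1 := le_inf h h'
  rw [← affineToric.map_comp h3 h1, ← affineToric.map_comp h3 h2, Category.assoc, Category.assoc,
    map_chart, map_chart]

/-- The morphism `Z_σ → Z_Δ` for a cone `σ` contained in some cone `τ` of `Δ`, i.e. the composite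
`Z_σ → Z_τ → Z_Δ`; it does not depend on `τ`. -/
def ofLE {σ : PointedCone ℝ (RealSpan N)} (h : ∃ τ ∈ Δ.cones, σ ≤ τ) :
    affineToric σ ⟶ Δ.toricVariety :=
  affineToric.map h.choose_spec.2 ≫ Δ.chart ⟨h.choose, h.choose_spec.1⟩

theorem ofLE_eq {σ : PointedCone ℝ (RealSpan N)} (h : ∃ τ ∈ Δ.cones, σ ≤ τ) {τ : Δ.cones}
    (hτ : σ ≤ τ.1) : ofLE h = affineToric.map hτ ≫ Δ.chart τ := by
  rw [ofLE]
  exact map_chart_eq (τ := ⟨h.choose, h.choose_spec.1⟩) h.choose_spec.2 hτ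

theorem map_ofLE {σ τ : PointedCone ℝ (RealSpan N)} (hστ : σ ≤ τ) (h : ∃ κ ∈ Δ.cones, σ ≤ κ)
    (h' : ∃ κ ∈ Δ.cones, τ ≤ κ) : affineToric.map hστ ≫ ofLE h' = ofLE h := by
  obtain ⟨κ, hκ, hτκ⟩ := id h'
  rw [ofLE_eq h' (τ := ⟨κ, hκ⟩) hτκ, ofLE_eq h (τ := ⟨κ, hκ⟩) (hστ.trans hτκ),
    ← Category.assoc, affineToric.map_comp]

/-- The toric morphism `Z_Δ' → Z_Δ` of a subdivision `Δ'` of a fan `Δ`: on the chart `Z_σ` it is the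
morphism to `Z_τ` for any cone `τ ∈ Δ` containing `σ`. -/
def toFan {Δ' : Fan N} (h : IsSubdivision Δ' Δ) : Δ'.toricVariety ⟶ Δ.toricVariety :=
  colimit.desc Δ'.diagram
    { pt := Δ.toricVariety
      ι :=
        { app := fun σ => ofLE (h.2 σ.1 σ.2)
          naturality := fun σ τ f =>
            (map_ofLE (leOfHom f) (h.2 σ.1 σ.2) (h.2 τ.1 τ.2)).trans (Category.comp_id _).symm } }

end Fan

section Resolution

variable {X Y : Scheme.{0}}

/-- A morphism is birational if it is an isomorphism over a dense open subset of the target whose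
preimage is dense. -/
def IsBirational (f : X ⟶ Y) : Prop :=
  ∃ U : Y.Opens, Dense (U : Set Y) ∧ Dense ((f ⁻¹ᵁ U : X.Opens) : Set X) ∧ IsIso (f ∣_ U)

/-- A modification is a proper birational morphism. -/
def IsModification (f : X ⟶ Y) : Prop := IsProper f ∧ IsBirational f

/-- An integral scheme is normal if all its local rings are integrally closed domains. -/
def IsNormalVariety (X : Scheme.{0}) : Prop :=
  IsIntegral X ∧ ∀ x : X, IsIntegrallyClosed (X.presheaf.stalk x)

/-- `f : X → Y` is the normalization of the variety `Y`: `X` is normal and `f` is finite and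
birational. -/
def IsNormalization (f : X ⟶ Y) : Prop :=
  IsNormalVariety X ∧ IsFinite f ∧ IsBirational f

/-- The largest open subset of the target over which `f` is an isomorphism; if `f` is a
modification, its complement is the discriminant locus of `f`. -/
def isoLocus (f : X ⟶ Y) : Y.Opens := sSup {U : Y.Opens | IsIso (f ∣_ U)}

/-- The exceptional locus of a modification: the preimage of the discriminant locus. -/
def exceptionalLocus (f : X ⟶ Y) : Set X := (f ⁻¹' (isoLocus f : Set Y))ᶜ

/-- The underlying closed set of the strict transform of `V ⊆ Y`: the closure of the preimage of the
part of `V` outside of the discriminant locus. -/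
def strictTransformSet (f : X ⟶ Y) (V : Set Y) : TopologicalSpace.Closeds X :=
  ⟨closure (f ⁻¹' (V ∩ (isoLocus f : Set Y))), isClosed_closure⟩

/-- The strict transform of `V ⊆ Y`, with its reduced scheme structure. -/
def strictTransform (f : X ⟶ Y) (V : Set Y) : Scheme.{0} :=
  (Scheme.IdealSheafData.vanishingIdeal (strictTransformSet f V)).subscheme

/-- The closed immersion of the strict transform. -/
def strictTransform.ι (f : X ⟶ Y) (V : Set Y) : strictTransform f V ⟶ X :=
  (Scheme.IdealSheafData.vanishingIdeal (strictTransformSet f V)).subschemeι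

/-- The nonsingular locus of a complex variety: the largest open subset which is smooth over `ℂ`. -/
def nonsingularLocus (f : X ⟶ Spec (CommRingCat.of ℂ)) : X.Opens :=
  sSup {U : X.Opens | Smooth (U.ι ≫ f)}

/-- The ideal in the local ring at `x` of the reduced closed subscheme with support `closure A`. -/
def stalkIdeal (A : Set X) (x : X) : Ideal (X.presheaf.stalk x) :=
  ⨆ (U : X.affineOpens) (hx : x ∈ U.1),
    ((Scheme.IdealSheafData.vanishingIdeal ⟨closure A, isClosed_closure⟩).ideal U).map
      (X.presheaf.germ U.1 x hx).hom

/-- Two locally closed subvarieties `A`, `B` of `X` are transversal if `T_x A + T_x B = T_x X` at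
all their common points `x`. In terms of the maximal ideal `m` of the local ring at `x`: the images
of the ideals of `A` and `B` in the cotangent space `m / m ^ 2`, which are the spaces of linear forms
that vanish on `T_x A` and on `T_x B`, have intersection zero. -/
def IsTransversal (A B : Set X) : Prop :=
  ∀ x ∈ A ∩ B,
    (stalkIdeal A x ⊔ IsLocalRing.maximalIdeal (X.presheaf.stalk x) ^ 2) ⊓
      (stalkIdeal B x ⊔ IsLocalRing.maximalIdeal (X.presheaf.stalk x) ^ 2) ≤
        IsLocalRing.maximalIdeal (X.presheaf.stalk x) ^ 2

variable {N : Type} [AddCommGroup N] {ρ : PointedCone ℝ (RealSpan N)} {V : Scheme.{0}}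

/-- The toric modification `π : Z_Δ → Z_ρ` is an embedded pseudo-resolution of the subvariety
`i : V → Z_ρ`: the fan is regular, `π` restricts to a modification `r` of the strict transform to
`V`, and the strict transform is nonsingular and transversal to the orbits in the exceptional
locus. -/
def IsEmbeddedPseudoResolution (Δ : Fan N) (π : Δ.toricVariety ⟶ affineToric ρ)
    (i : V ⟶ affineToric ρ) : Prop :=
  Δ.IsRegular ∧ IsModification π ∧
    (∃ r : strictTransform π (Set.range i) ⟶ V,
      r ≫ i = strictTransform.ι π (Set.range i) ≫ π ∧ IsModification r) ∧
    Smooth (strictTransform.ι π (Set.range i) ≫ π ≫ monoidScheme.structure (dualMonoid ρ)) ∧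
    ∀ τ : Δ.cones, Δ.orbit τ ⊆ exceptionalLocus π →
      IsTransversal (strictTransformSet π (Set.range i) : Set Δ.toricVariety) (Δ.orbit τ)

/-- An embedded resolution is an embedded pseudo-resolution such that the restriction of `π` to the
strict transform is an isomorphism outside of the singular locus of `V`. -/
def IsEmbeddedResolution (Δ : Fan N) (π : Δ.toricVariety ⟶ affineToric ρ)
    (i : V ⟶ affineToric ρ) : Prop :=
  IsEmbeddedPseudoResolution Δ π i ∧
    ∃ r : strictTransform π (Set.range i) ⟶ V,
      r ≫ i = strictTransform.ι π (Set.range i) ≫ π ∧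
        IsIso (r ∣_ nonsingularLocus (i ≫ monoidScheme.structure (dualMonoid ρ)))

/-- The toric morphism of a subdivision `Δ` of `ρ` is a partial embedded resolution of `V` if its
composite with the toric morphism of any resolution `Δ'` of the fan `Δ` is an embedded resolution
of `V`. -/
def IsPartialEmbeddedResolution (Δ : Fan N) (h : Δ.Subdivides ρ) (i : V ⟶ affineToric ρ) : Prop :=
  ∀ (Δ' : Fan N) (h' : Fan.IsResolution Δ' Δ),
    IsEmbeddedResolution Δ' (Fan.toFan h'.1 ≫ Fan.toCone h) i

end Resolution

/-- The subspace `ℓ = Ker(φ_ℝ)^⊥ ⊆ N_ℝ` of a homomorphism `φ` of lattices on `M`. -/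
def kerOrthogonal {N L : Type} [AddCommGroup N] [AddCommGroup L] (φ : DualLattice N →ₗ[ℤ] L) :
    Submodule ℝ (RealSpan N) :=
  (LinearMap.ker (φ.baseChange ℝ)).orthogonalBilin (pairing N)

/-- The cone `σ₀ = ρ ∩ ℓ`. -/
def sigmaZero {N L : Type} [AddCommGroup N] [AddCommGroup L] (ρ : PointedCone ℝ (RealSpan N))
    (φ : DualLattice N →ₗ[ℤ] L) : PointedCone ℝ (RealSpan N) :=
  ρ ⊓ PointedCone.ofSubmodule (kerOrthogonal φ)

end Toric

end

open Toric

/-! The strict transform is governed by the image monoids φ(σ^∨ ∩ M). The generic point of Z^Λ lies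
in the torus, where the modification is an isomorphism; so the strict transform is the closure of a
single point, and in the chart Z_σ this closure is Spec ℂ[φ(σ^∨ ∩ M)] (`exists_strictChart`). If σ ∩
ℓ is a face of σ, cut out by a form m, then the duality (σ ∩ ℓ)^∨ = σ^∨ + ℓ^⊥, valid up to positive
multiples by an integral Farkas lemma, makes φ(m) a unit of φ(σ^∨ ∩ M). Hence the part of the strict
transform in Z_σ lies in the open subset Z_{σ ∩ ℓ}, and only cones contained in ℓ matter.

For a cone κ ⊆ ℓ the vectors of κ ∩ N descend to linear forms on -Λ + Λ. So φ(κ^∨ ∩ M) consists of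
all lattice points of a polyhedral cone, and the surjection from κ^∨ ∩ M has a section.

If σ₀ is a cone of the fan, its chart contains the whole strict transform, and the map to Z^Λ is the
one of the inclusion Λ ⊆ φ(σ₀^∨ ∩ M). The larger monoid is saturated, whence normality; each of its
elements has a positive multiple in Λ, whence finiteness; birationality is seen on the torus. If σ₀
has full dimension in ℓ, the larger monoid is the dual semigroup of σ₀ in its own lattice.

A resolution need not contain σ₀, but σ ∩ ℓ is still a face of each of its cones σ. For κ ⊆ ℓ
regular, ℂ[φ(κ^∨ ∩ M)] is a retract of a smooth algebra, hence smooth, and the same section yields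
transversality to the orbits. At a smooth point of Z^Λ a derivation argument shows that the monoid,
after inverting one element, is a free monoid plus a group of units
(`exists_independent_generators`); it is then the semigroup of a regular face of σ₀
(`exists_regular_face`). This face belongs to every resolution, so the map is an isomorphism near
the point.

Properness of the toric morphisms follows from the valuative criterion; existence of limits rests on
`Subdivides.exists_dualMonoid_le`, a Farkas argument which finds a cone adapted to a given total
preorder on M. -/

namespace Toric

/-! ### Integral lemmas of Farkas and Gordan. -/

section Farkas

/-- An integral form of the lemma of Farkas. -/
theorem exists_nsmul_eq_sum_of_nonneg {ι V : Type*} [AddCommGroup V] (s : Finset ι) :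
    ∀ (a : ι → V →+ ℤ) (b : V →+ ℤ), (∀ x, (∀ i ∈ s, 0 ≤ a i x) → 0 ≤ b x) →
      ∃ k : ℕ, 0 < k ∧ ∃ c : ι → ℕ, ∀ x, k * b x = ∑ i ∈ s, c i * a i x := by
  classical
  induction s using Finset.induction_on with
  | empty =>
    intro a b h
    refine ⟨1, one_pos, 0, fun x => ?_⟩
    have h1 := h x (by simp)
    have h2 := h (-x) (by simp)
    rw [map_neg] at h2
    simp only [Finset.sum_empty]
    push_cast
    omega
  | insert j s hj ih =>
    intro a b h
    by_cases hb : ∀ x, (∀ i ∈ s, 0 ≤ a i x) → 0 ≤ b x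
    · obtain ⟨k, hk, c, hc⟩ := ih a b hb
      refine ⟨k, hk, Function.update c j 0, fun x => ?_⟩
      rw [hc, Finset.sum_insert hj]
      simp only [Function.update_self, Nat.cast_zero, zero_mul, zero_add]
      refine Finset.sum_congr rfl fun i hi => ?_
      rw [Function.update_of_ne (by rintro rfl; exact hj hi)]
    push Not at hb
    obtain ⟨y, hy, hby⟩ := hb
    have hjy : a j y < 0 := by
      by_contra hn
      push Not at hn
      refine absurd (h y fun i hi => ?_) (not_le.2 hby)
      rcases Finset.mem_insert.1 hi with rfl | hi
      exacts [hn, hy i hi]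
    obtain ⟨t, ht⟩ := Int.eq_ofNat_of_zero_le (show 0 ≤ -a j y by omega)
    have ht0 : 0 < t := by omega
    -- Fourier–Motzkin elimination: every form is composed with x ↦ t x + a_j(x) y, which maps into
    -- the kernel of a_j because t = -a_j(y). Expanding the resulting identity gives a_j the
    -- coefficient ∑ c_i a_i(y) - k b(y), which is nonnegative by the choice of y.
    obtain ⟨k, hk, c, hc⟩ := ih (fun i => t • a i + a i y • a j) (t • b + b y • a j) (by
      intro x hx
      have key : ∀ f : V →+ ℤ, (t • f + f y • a j) x = f (t • x + a j x • y) := by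
        intro f
        simp only [AddMonoidHom.add_apply, AddMonoidHom.coe_smul, Pi.smul_apply, map_add,
          map_nsmul, map_zsmul, smul_eq_mul]
        ring
      rw [key]
      refine h _ fun i hi => ?_
      rcases Finset.mem_insert.1 hi with rfl | hi
      · simp only [map_add, map_nsmul, map_zsmul, smul_eq_mul, nsmul_eq_mul]
        have : (t : ℤ) = - a i y := by omega
        rw [this]
        apply le_of_eq
        ring
      · rw [← key]; exact hx i hi)
    have hnn : 0 ≤ ∑ i ∈ s, c i * a i y - k * b y := by
      have h1 : 0 ≤ ∑ i ∈ s, (c i : ℤ) * a i y :=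
        Finset.sum_nonneg fun i hi => mul_nonneg (by positivity) (hy i hi)
      have h2 : (k : ℤ) * b y ≤ 0 := mul_nonpos_of_nonneg_of_nonpos (by positivity) hby.le
      omega
    obtain ⟨d, hd⟩ := Int.eq_ofNat_of_zero_le hnn
    refine ⟨k * t, by positivity, Function.update (fun i => c i * t) j d, fun x => ?_⟩
    have hx := hc x
    simp only [AddMonoidHom.add_apply, AddMonoidHom.coe_smul, Pi.smul_apply, smul_eq_mul,
      nsmul_eq_mul] at hx
    rw [Finset.sum_insert hj, Function.update_self]
    have hs : ∑ i ∈ s, ((Function.update (fun i => c i * t) j d i : ℕ) : ℤ) * a i x =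
        ∑ i ∈ s, (c i : ℤ) * (t * a i x) := by
      refine Finset.sum_congr rfl fun i hi => ?_
      rw [Function.update_of_ne (by rintro rfl; exact hj hi)]
      push_cast
      ring
    rw [hs]
    have hsplit : ∑ i ∈ s, (c i : ℤ) * ((t : ℤ) * a i x + a i y * a j x) =
        ∑ i ∈ s, (c i : ℤ) * (t * a i x) + (∑ i ∈ s, (c i : ℤ) * a i y) * a j x := by
      rw [Finset.sum_mul, ← Finset.sum_add_distrib]
      exact Finset.sum_congr rfl fun i _ => by ring
    rw [hsplit] at hx
    have hd' : (d : ℤ) = ∑ i ∈ s, (c i : ℤ) * a i y - k * b y := hd.symm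
    rw [hd']
    push_cast
    linear_combination hx

/-- Lemma of Gordan: the lattice points of a polyhedral cone given by inequalities form a finitely
generated monoid. -/
theorem fg_of_mem_iff_nonneg {L ι : Type*} [AddCommGroup L] [Module.Finite ℤ L] [Finite ι]
    (n : ι → L →+ ℤ) (P : AddSubmonoid L) (hP : ∀ l, l ∈ P ↔ ∀ i, 0 ≤ n i l) : P.FG := by
  classical
  have := Fintype.ofFinite ι
  obtain ⟨d, g, hg⟩ := Module.Finite.exists_fin' ℤ L
  -- The natural variables are the positive parts, the negative parts and one slack variable for
  -- each inequality. The conditions n_i(q x) = slack define an equalizer of homomorphisms out of a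
  -- power of ℕ, which is finitely generated, and P is its image.
  let q : (Fin d ⊕ Fin d ⊕ ι → ℕ) →+ L :=
    { toFun := fun x => g fun i => (x (.inl i) : ℤ) - x (.inr (.inl i))
      map_zero' := by
        rw [← map_zero g]; congr 1
      map_add' := by
        intro x y; rw [← map_add g]; congr 1; ext i; simp [add_sub_add_comm] }
  let f₁ : (Fin d ⊕ Fin d ⊕ ι → ℕ) →+ (ι → ℤ) := AddMonoidHom.pi fun i => (n i).comp q
  let f₂ : (Fin d ⊕ Fin d ⊕ ι → ℕ) →+ (ι → ℤ) := AddMonoidHom.pi fun i =>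
    (Nat.castAddMonoidHom ℤ).comp (Pi.evalAddMonoidHom _ (.inr (.inr i)))
  have hfg := AddSubmonoid.fg_eqLocusM f₁ f₂
  have : P = (f₁.eqLocusM f₂).map q := by
    ext l
    constructor
    · intro hl
      obtain ⟨z, rfl⟩ := hg l
      refine ⟨Sum.elim (fun i => (z i).toNat) (Sum.elim (fun i => (-z i).toNat)
        fun i => (n i (g z)).toNat), ?_, ?_⟩
      · have hq : q (Sum.elim (fun i => (z i).toNat) (Sum.elim (fun i => (-z i).toNat)
            fun i => (n i (g z)).toNat)) = g z := by
          change g _ = g z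
          congr 1; ext i; simp only [Sum.elim_inl, Sum.elim_inr]; omega
        funext i
        change n i (q _) = ((n i (g z)).toNat : ℤ)
        rw [hq]
        have := (hP _).1 hl i
        omega
      · change g _ = g z
        congr 1; ext i; simp only [Sum.elim_inl, Sum.elim_inr]; omega
    · rintro ⟨x, hx, rfl⟩
      refine (hP _).2 fun i => ?_
      have h := congrFun hx i
      change n i (q x) = (x (.inr (.inr i)) : ℤ) at h
      rw [h]; positivity
  rw [this]
  exact hfg.map q

/-- If every lattice vector that is nonnegative on the finitely generated monoid `S` is nonnegative
at `w`, then some positive multiple of `w` belongs to `S`. -/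
theorem exists_nsmul_mem_of_forall_nonneg {N : Type} [AddCommGroup N]
    {S : AddSubmonoid (DualLattice N)} (hS : S.FG) {w : DualLattice N}
    (h : ∀ n : N, (∀ m ∈ S, 0 ≤ m n) → 0 ≤ w n) : ∃ k : ℕ, 0 < k ∧ k • w ∈ S := by
  classical
  obtain ⟨s, rfl⟩ := hS
  obtain ⟨k, hk, c, hc⟩ := exists_nsmul_eq_sum_of_nonneg s
    (fun m : DualLattice N => m.toAddMonoidHom) w.toAddMonoidHom (by
      intro n hn
      refine h n fun m hm => ?_
      induction hm using AddSubmonoid.closure_induction with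
      | mem x hx => exact hn x hx
      | zero => simp
      | add x y _ _ hx hy => simpa using add_nonneg hx hy)
  refine ⟨k, hk, ?_⟩
  have : k • w = ∑ i ∈ s, c i • i := by
    ext n
    have := hc n
    simpa [LinearMap.sum_apply] using this
  rw [this]
  exact sum_mem fun i hi => nsmul_mem (AddSubmonoid.subset_closure hi) _

end Farkas

/-! ### Duality for rational cones and their faces. -/

section Cones

variable {N : Type} [AddCommGroup N]

theorem mem_dualMonoid_hull {s : Set N} {m : DualLattice N} :
    m ∈ dualMonoid (PointedCone.hull ℝ ((fun n : N => (1 : ℝ) ⊗ₜ[ℤ] n) '' s)) ↔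
      ∀ n ∈ s, 0 ≤ m n := by
  change (1 : ℝ) ⊗ₜ[ℤ] m ∈ dualCone _ ↔ _
  rw [dualCone, PointedCone.dual_hull]
  constructor
  · intro h n hn
    have := h ⟨n, hn, rfl⟩
    rw [LinearMap.flip_apply, pairing_tmul] at this
    have h' : (0 : ℝ) ≤ (m n : ℤ) := by simpa using this
    exact_mod_cast h'
  · rintro h _ ⟨n, hn, rfl⟩
    rw [LinearMap.flip_apply, pairing_tmul]
    have : (0 : ℝ) ≤ (m n : ℤ) := by exact_mod_cast h n hn
    simpa using this

theorem nonneg_of_mem_dualMonoid {σ : PointedCone ℝ (RealSpan N)} {m : DualLattice N}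
    (hm : m ∈ dualMonoid σ) {n : N} (hn : (1 : ℝ) ⊗ₜ[ℤ] n ∈ σ) : 0 ≤ m n := by
  have := mem_dualMonoid.1 hm _ hn
  rw [pairing_tmul] at this
  have h' : (0 : ℝ) ≤ (m n : ℤ) := by simpa using this
  exact_mod_cast h'

theorem IsRational.exists_finset {σ : PointedCone ℝ (RealSpan N)} (hσ : IsRational σ) :
    ∃ s : Finset N, (∀ n ∈ s, (1 : ℝ) ⊗ₜ[ℤ] n ∈ σ) ∧
      σ = PointedCone.hull ℝ ((fun n : N => (1 : ℝ) ⊗ₜ[ℤ] n) '' (s : Set N)) ∧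
      ∀ m, m ∈ dualMonoid σ ↔ ∀ n ∈ s, 0 ≤ m n := by
  obtain ⟨s, rfl⟩ := hσ
  exact ⟨s, fun n hn => PointedCone.subset_hull ⟨n, hn, rfl⟩, rfl, fun m => mem_dualMonoid_hull⟩

theorem IsRational.fg_dualMonoid [Module.Finite ℤ N] [Module.Free ℤ N]
    {σ : PointedCone ℝ (RealSpan N)} (hσ : IsRational σ) : (dualMonoid σ).FG := by
  obtain ⟨s, -, -, hs⟩ := hσ.exists_finset
  refine fg_of_mem_iff_nonneg (ι := s)
    (fun n => (Module.Dual.eval ℤ N n.1).toAddMonoidHom) _ fun m => ?_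
  rw [hs]
  simp

/-- The bidual of a rational cone is the cone itself. -/
theorem IsRational.tmul_mem [Module.Finite ℤ N] [Module.Free ℤ N]
    {σ : PointedCone ℝ (RealSpan N)} (hσ : IsRational σ)
    {n : N} (h : ∀ m ∈ dualMonoid σ, 0 ≤ m n) : (1 : ℝ) ⊗ₜ[ℤ] n ∈ σ := by
  obtain ⟨s, hsσ, -, hs⟩ := hσ.exists_finset
  obtain ⟨k, hk, c, hc⟩ := exists_nsmul_eq_sum_of_nonneg s
    (fun n : N => (Module.Dual.eval ℤ N n).toAddMonoidHom) (Module.Dual.eval ℤ N n).toAddMonoidHom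
    fun m hm => h m ((hs m).2 hm)
  have hkn : k • n = ∑ i ∈ s, c i • i := by
    refine sub_eq_zero.1 ((Module.forall_dual_apply_eq_zero_iff ℤ _).1 fun f => ?_)
    have := hc f
    simp only [LinearMap.toAddMonoidHom_coe, Module.Dual.eval_apply] at this
    simp [this]
  have h1 : (1 : ℝ) ⊗ₜ[ℤ] n = (k : ℝ)⁻¹ • ∑ i ∈ s, c i • ((1 : ℝ) ⊗ₜ[ℤ] i) := by
    rw [eq_inv_smul_iff₀ (by positivity), Nat.cast_smul_eq_nsmul, ← TensorProduct.tmul_smul, hkn,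
      TensorProduct.tmul_sum]
    exact Finset.sum_congr rfl fun i _ => TensorProduct.tmul_smul _ _ _
  rw [h1]
  exact σ.smul_mem (by positivity) (sum_mem fun i hi => nsmul_mem (hsσ i hi) _)

/-- The face of `σ` cut out by the linear form `m`. -/
def faceCone (σ : PointedCone ℝ (RealSpan N)) (m : DualLattice N) : PointedCone ℝ (RealSpan N) :=
  σ ⊓ PointedCone.ofSubmodule (LinearMap.ker (pairing N (1 ⊗ₜ m)))

theorem mem_faceCone {σ : PointedCone ℝ (RealSpan N)} {m : DualLattice N} {x : RealSpan N} :
    x ∈ faceCone σ m ↔ x ∈ σ ∧ pairing N (1 ⊗ₜ m) x = 0 := Iff.rfl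

theorem faceCone_le (σ : PointedCone ℝ (RealSpan N)) (m : DualLattice N) : faceCone σ m ≤ σ :=
  inf_le_left

theorem isFace_faceCone {σ : PointedCone ℝ (RealSpan N)} {m : DualLattice N}
    (hm : m ∈ dualMonoid σ) : IsFace (faceCone σ m) σ := ⟨m, hm, fun _ => Iff.rfl⟩

/-- By flatness of ℝ over ℤ the kernel of φ_ℝ is spanned by the kernel of φ, so the integral forms
suffice to define ℓ. -/
theorem mem_kerOrthogonal {L : Type} [AddCommGroup L] {φ : DualLattice N →ₗ[ℤ] L}
    {x : RealSpan N} :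
    x ∈ kerOrthogonal φ ↔ ∀ m, φ m = 0 → pairing N (1 ⊗ₜ m) x = 0 := by
  rw [kerOrthogonal, Submodule.mem_orthogonalBilin_iff]
  constructor
  · intro h m hm
    exact h _ (by simp [hm])
  · intro h y hy
    have hy' : y ∈ LinearMap.range ((LinearMap.ker φ).subtype.baseChange ℝ) := by
      have := Module.Flat.ker_lTensor_eq ℝ ℝ φ
      exact this ▸ hy
    obtain ⟨z, rfl⟩ := hy'
    change pairing N _ x = 0
    clear hy
    induction z using TensorProduct.induction_on with
    | zero => simp
    | add a b ha hb => rw [map_add, map_add, LinearMap.add_apply, ha, hb, add_zero]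
    | tmul a b =>
      have h1 := h b.1 b.2
      rw [LinearMap.baseChange_tmul, ← mul_one a, ← smul_eq_mul, ← TensorProduct.smul_tmul', map_smul,
        LinearMap.smul_apply]
      simp only [Submodule.subtype_apply, h1, smul_zero]

theorem fg_addSubmonoid_ker [Module.Finite ℤ N] [Module.Free ℤ N] {L : Type} [AddCommGroup L]
    (φ : DualLattice N →ₗ[ℤ] L) : (LinearMap.ker φ).toAddSubmonoid.FG := by
  have := (AddGroup.fg_iff_addMonoid_fg (G := LinearMap.ker φ)).1
    (Module.Finite.iff_addGroup_fg.1 inferInstance)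
  exact (AddMonoid.fg_iff_addSubmonoid_fg _).1 this

/-- `(σ ∩ ℓ)^∨ = σ^∨ + ℓ^⊥`, up to positive multiples. -/
theorem exists_nsmul_add_mem_of_mem_inf_kerOrthogonal [Module.Finite ℤ N] [Module.Free ℤ N]
    {L : Type} [AddCommGroup L] {φ : DualLattice N →ₗ[ℤ] L} {σ : PointedCone ℝ (RealSpan N)}
    (hσ : IsRational σ) {w : DualLattice N}
    (hw : w ∈ dualMonoid (σ ⊓ PointedCone.ofSubmodule (kerOrthogonal φ))) :
    ∃ k : ℕ, 0 < k ∧ ∃ m ∈ dualMonoid σ, φ m = k • φ w := by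
  -- A vector that is nonnegative on σ^∨ + ker φ lies in σ by biduality, and in ℓ because ker φ is a
  -- group.
  obtain ⟨k, hk, hkw⟩ := exists_nsmul_mem_of_forall_nonneg
    (hσ.fg_dualMonoid.sup (fg_addSubmonoid_ker φ)) (w := w) (by
      intro n hn
      refine nonneg_of_mem_dualMonoid hw ⟨hσ.tmul_mem fun m hm =>
        hn m (AddSubmonoid.mem_sup_left hm), mem_kerOrthogonal.2 fun m hm => ?_⟩
      have h1 := hn m (AddSubmonoid.mem_sup_right hm)
      have h2 := hn (-m) (AddSubmonoid.mem_sup_right (by simpa using hm))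
      rw [LinearMap.neg_apply] at h2
      have : m n = 0 := by omega
      rw [pairing_tmul, this]; simp)
  obtain ⟨m, hm, z, hz, h⟩ := AddSubmonoid.mem_sup.1 hkw
  refine ⟨k, hk, m, hm, ?_⟩
  have hz' : φ z = 0 := hz
  rw [← map_nsmul, ← h, map_add, hz', add_zero]

/-- `(σ ∩ τ)^∨ = σ^∨ + τ^∨`, up to positive multiples. -/
theorem exists_nsmul_mem_sup_of_mem_inf [Module.Finite ℤ N] [Module.Free ℤ N]
    {σ τ : PointedCone ℝ (RealSpan N)} (hσ : IsRational σ) (hτ : IsRational τ) {w : DualLattice N}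
    (hw : w ∈ dualMonoid (σ ⊓ τ)) :
    ∃ k : ℕ, 0 < k ∧ k • w ∈ dualMonoid σ ⊔ dualMonoid τ :=
  exists_nsmul_mem_of_forall_nonneg (hσ.fg_dualMonoid.sup hτ.fg_dualMonoid) fun _ hn =>
    nonneg_of_mem_dualMonoid hw
      ⟨hσ.tmul_mem fun m hm => hn m (AddSubmonoid.mem_sup_left hm),
        hτ.tmul_mem fun m hm => hn m (AddSubmonoid.mem_sup_right hm)⟩

/-- No nonzero generator n has -n in the cone, so by biduality some form of σ^∨ is positive at n.
The sum of these forms over the generators vanishes only at the origin. -/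
theorem isFace_bot [Module.Finite ℤ N] [Module.Free ℤ N] {σ : PointedCone ℝ (RealSpan N)}
    (hσ : IsRational σ) (hs : IsStrictlyConvex σ) : IsFace ⊥ σ := by
  classical
  obtain ⟨s, hsσ, rfl, hsm⟩ := hσ.exists_finset
  have key : ∀ n ∈ s, ∃ m ∈ dualMonoid (PointedCone.hull ℝ
      ((fun n : N => (1 : ℝ) ⊗ₜ[ℤ] n) '' (s : Set N))), (1 : ℝ) ⊗ₜ[ℤ] n ≠ 0 → 0 < m n := by
    intro n hn
    by_contra hcon
    push Not at hcon
    have h0 := (hcon 0 (zero_mem _)).1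
    refine h0 ?_
    have h1 : (1 : ℝ) ⊗ₜ[ℤ] (-n) ∈ PointedCone.hull ℝ
        ((fun n : N => (1 : ℝ) ⊗ₜ[ℤ] n) '' (s : Set N)) :=
      hσ.tmul_mem fun m hm => by
        have := (hcon m hm).2
        rw [map_neg]; omega
    have h2 : (1 : ℝ) ⊗ₜ[ℤ] n ∈ (PointedCone.hull ℝ
        ((fun n : N => (1 : ℝ) ⊗ₜ[ℤ] n) '' (s : Set N))).lineal := by
      rw [TensorProduct.tmul_neg] at h1
      exact ⟨hsσ n hn, h1⟩
    rw [hs] at h2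
    exact h2
  choose! m hm hmn using key
  have hM : ∑ n ∈ s, m n ∈ dualMonoid (PointedCone.hull ℝ
      ((fun n : N => (1 : ℝ) ⊗ₜ[ℤ] n) '' (s : Set N))) := sum_mem hm
  refine ⟨_, hM, fun x => ⟨fun hx => ?_, fun hx => ?_⟩⟩
  · rw [(Submodule.mem_bot _).1 hx]
    exact ⟨zero_mem _, map_zero _⟩
  · obtain ⟨hx, hx0⟩ := hx
    suffices h : 0 ≤ pairing N (1 ⊗ₜ ∑ n ∈ s, m n) x ∧
        (pairing N (1 ⊗ₜ ∑ n ∈ s, m n) x = 0 → x = 0) from h.2 hx0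
    clear hx0
    induction hx using Submodule.span_induction with
    | zero => simp
    | mem x hx =>
      obtain ⟨n, hn, rfl⟩ := hx
      refine ⟨mem_dualMonoid.1 hM _ (hsσ n hn), fun h => ?_⟩
      by_contra hne
      change (1 : ℝ) ⊗ₜ[ℤ] n ≠ 0 at hne
      have h1 := hmn n hn hne
      have h2 : m n n ≤ (∑ n ∈ s, m n) n := by
        rw [LinearMap.sum_apply]
        exact Finset.single_le_sum (f := fun i => m i n)
          (fun i hi => nonneg_of_mem_dualMonoid (hm i hi) (hsσ n hn)) hn
      rw [pairing_tmul] at h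
      have h3 : (((∑ n ∈ s, m n) n : ℤ) : ℝ) = 0 := by simpa using h
      have h4 : (∑ n ∈ s, m n) n = 0 := by exact_mod_cast h3
      omega
    | add x y _ _ hx hy =>
      rw [map_add]
      refine ⟨add_nonneg hx.1 hy.1, fun h => ?_⟩
      rw [hx.2 (by linarith [hx.1, hy.1]), hy.2 (by linarith [hx.1, hy.1]), add_zero]
    | smul c x _ hx =>
      have hc : pairing N (1 ⊗ₜ ∑ n ∈ s, m n) (c • x) =
          c.1 * pairing N (1 ⊗ₜ ∑ n ∈ s, m n) x := map_smul (pairing N _) c.1 x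
      rw [hc]
      refine ⟨mul_nonneg c.2 hx.1, fun h => ?_⟩
      rcases mul_eq_zero.1 h with h | h
      · change c.1 • x = 0
        rw [h, zero_smul]
      · rw [hx.2 h]; exact smul_zero c.1

/-- A lattice point in the relative interior of a rational cone. -/
theorem IsRational.exists_interior {σ : PointedCone ℝ (RealSpan N)} (hσ : IsRational σ) :
    ∃ n : N, (1 : ℝ) ⊗ₜ[ℤ] n ∈ σ ∧
      ∀ m ∈ dualMonoid σ, m n = 0 → ∀ x ∈ σ, pairing N (1 ⊗ₜ m) x = 0 := by
  classical
  obtain ⟨s, hsσ, hs, -⟩ := hσ.exists_finset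
  -- A form of σ^∨ that vanishes at the sum of the generators vanishes at each of them.
  refine ⟨∑ n ∈ s, n, ?_, fun m hm h x hx => ?_⟩
  · rw [TensorProduct.tmul_sum]
    exact sum_mem hsσ
  rw [map_sum, Finset.sum_eq_zero_iff_of_nonneg
    fun n hn => nonneg_of_mem_dualMonoid hm (hsσ n hn)] at h
  clear hm
  rw [hs] at hx
  induction hx using Submodule.span_induction with
  | zero => simp
  | mem x hx =>
    obtain ⟨n, hn, rfl⟩ := hx
    change pairing N _ ((1 : ℝ) ⊗ₜ[ℤ] n) = 0
    rw [pairing_tmul, h n hn]; simp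
  | add x y _ _ hx hy => rw [map_add, hx, hy, add_zero]
  | smul c x _ hx =>
    have hc : pairing N (1 ⊗ₜ m) (c • x) = c.1 * pairing N (1 ⊗ₜ m) x :=
      map_smul (pairing N _) c.1 x
    rw [hc, hx, mul_zero]

end Cones

/-! ### Combinatorics of subdivisions. -/

namespace Fan

variable {N : Type} [AddCommGroup N] {Δ : Fan N}

/-- A total preorder on `M` which is nonnegative on `ρ^∨` is nonnegative on `σ^∨` for some cone `σ`
of any subdivision of `ρ`. -/
theorem Subdivides.exists_dualMonoid_le [Module.Finite ℤ N] [Module.Free ℤ N]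
    {ρ : PointedCone ℝ (RealSpan N)} (h : Δ.Subdivides ρ)
    (hρ : IsRational ρ) (G : AddSubmonoid (DualLattice N)) (hG : ∀ m, m ∈ G ∨ -m ∈ G)
    (hρG : dualMonoid ρ ≤ G) : ∃ σ ∈ Δ.cones, dualMonoid σ ≤ G := by
  classical
  by_contra hcon
  push Not at hcon
  have key : ∀ σ ∈ Δ.cones, ∃ w ∈ dualMonoid σ, w ∉ G := fun σ hσ => by
    simpa [SetLike.le_def] using hcon σ hσ
  choose! w hw hwG using key
  obtain ⟨u, hu⟩ := hρ.fg_dualMonoid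
  let J := Δ.finite.toFinset
  let T := u.disjSum J
  -- The forms on N × ℤ are m(n), for generators m of ρ^∨, and -w_σ(n) - t. If all are nonnegative,
  -- then n lies in ρ, hence in some σ, where w_σ(n) ≥ 0; this forces t ≤ 0. Farkas thus writes a
  -- multiple of -t as a combination of them. Evaluation at (0, 1) and at (n, 0) shows that the
  -- coefficients of the w_σ are not all zero and that ∑ c_σ w_σ lies in ρ^∨.
  let a : DualLattice N ⊕ PointedCone ℝ (RealSpan N) → N × ℤ →+ ℤ := Sum.elim
    (fun m => m.toAddMonoidHom.comp (AddMonoidHom.fst N ℤ))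
    fun σ => -(w σ).toAddMonoidHom.comp (AddMonoidHom.fst N ℤ) - AddMonoidHom.snd N ℤ
  obtain ⟨k, hk, c, hc⟩ := exists_nsmul_eq_sum_of_nonneg T a (-AddMonoidHom.snd N ℤ) (by
    rintro ⟨n, t⟩ hx
    by_contra ht
    have ht' : 0 < t := by simpa using ht
    have hn : (1 : ℝ) ⊗ₜ[ℤ] n ∈ ρ := by
      refine hρ.tmul_mem fun m hm => ?_
      rw [← hu] at hm
      induction hm using AddSubmonoid.closure_induction with
      | mem x hx' =>
        have := hx (.inl x) (Finset.inl_mem_disjSum.2 hx')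
        simpa [a] using this
      | zero => simp
      | add x y _ _ hx hy => simpa using add_nonneg hx hy
    have hn' : (1 : ℝ) ⊗ₜ[ℤ] n ∈ Δ.support := by rw [h]; exact hn
    obtain ⟨σ, hσ, hnσ⟩ := Set.mem_iUnion₂.1 hn'
    have h1 := nonneg_of_mem_dualMonoid (hw σ hσ) hnσ
    have h2 := hx (.inr σ) (Finset.inr_mem_disjSum.2 (Δ.finite.mem_toFinset.2 hσ))
    simp only [a, Sum.elim_inr, AddMonoidHom.sub_apply, AddMonoidHom.neg_apply,
      AddMonoidHom.comp_apply, AddMonoidHom.coe_fst, AddMonoidHom.coe_snd,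
      LinearMap.toAddMonoidHom_coe] at h2
    omega)
  have hsum : ∀ x, ∑ i ∈ T, (c i : ℤ) * a i x = ∑ m ∈ u, (c (.inl m) : ℤ) * m x.1 +
      ∑ σ ∈ J, (c (.inr σ) : ℤ) * (-(w σ x.1) - x.2) := by
    intro x
    rw [Finset.sum_disjSum]
    rfl
  have h1 : (∑ σ ∈ J, (c (.inr σ) : ℤ)) = k := by
    have := hc (0, 1)
    rw [hsum] at this
    simp only [AddMonoidHom.neg_apply, AddMonoidHom.coe_snd, map_zero, mul_zero,
      Finset.sum_const_zero, neg_zero, zero_sub, zero_add, mul_neg, mul_one,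
      Finset.sum_neg_distrib] at this
    omega
  have h2 : ∑ σ ∈ J, c (.inr σ) • w σ = ∑ m ∈ u, c (.inl m) • m := by
    ext n
    have := hc (n, 0)
    rw [hsum] at this
    simp only [AddMonoidHom.neg_apply, AddMonoidHom.coe_snd, neg_zero, mul_zero, sub_zero,
      mul_neg, Finset.sum_neg_distrib] at this
    simp only [LinearMap.sum_apply, LinearMap.smul_apply, nsmul_eq_mul]
    linarith
  have hmem : ∑ σ ∈ J, c (.inr σ) • w σ ∈ G := by
    rw [h2]
    refine hρG (sum_mem fun m hm => nsmul_mem ?_ _)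
    rw [← hu]
    exact AddSubmonoid.subset_closure hm
  have hneg : ∀ σ ∈ J, -w σ ∈ G := fun σ hσ =>
    (hG (w σ)).resolve_left (hwG σ (Δ.finite.mem_toFinset.1 hσ))
  obtain ⟨σ, hσ, hcσ⟩ : ∃ σ ∈ J, c (.inr σ) ≠ 0 := by
    by_contra hall
    push Not at hall
    rw [Finset.sum_eq_zero fun σ hσ => by rw [hall σ hσ]; rfl] at h1
    omega
  refine hwG σ (Δ.finite.mem_toFinset.1 hσ) ?_
  obtain ⟨e, he⟩ := Nat.exists_eq_succ_of_ne_zero hcσ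
  -- All the -w_κ lie in G, so subtracting the other terms and the surplus copies of w_σ from the
  -- sum leaves w_σ in G, a contradiction.
  have h3 : w σ = ∑ σ ∈ J, c (.inr σ) • w σ + ∑ κ ∈ J.erase σ, c (.inr κ) • -w κ + e • -w σ := by
    rw [← Finset.add_sum_erase J _ hσ, he]
    simp only [smul_neg, Finset.sum_neg_distrib, Nat.succ_eq_add_one, add_smul, one_smul]
    abel
  rw [h3]
  exact add_mem (add_mem hmem (sum_mem fun κ hκ => nsmul_mem (hneg κ (Finset.mem_of_mem_erase hκ)) _))
    (nsmul_mem (hneg σ hσ) _)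

/-- The form that cuts out the face σ ∩ τ of τ vanishes at the interior point n, hence on all of τ.
-/
theorem le_of_interior_mem {σ τ : PointedCone ℝ (RealSpan N)} (hσ : σ ∈ Δ.cones)
    (hτ : τ ∈ Δ.cones) {n : N}
    (hn : ∀ m ∈ dualMonoid τ, m n = 0 → ∀ x ∈ τ, pairing N (1 ⊗ₜ m) x = 0)
    (hnτ : (1 : ℝ) ⊗ₜ[ℤ] n ∈ τ) (hnσ : (1 : ℝ) ⊗ₜ[ℤ] n ∈ σ) : τ ≤ σ := by
  obtain ⟨m, hm, hmτ⟩ := Δ.isFace_inf τ hτ σ hσ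
  have h0 := ((hmτ _).1 ⟨hnτ, hnσ⟩).2
  rw [pairing_tmul] at h0
  have h1 : ((m n : ℤ) : ℝ) = 0 := by simpa using h0
  intro x hx
  exact ((hmτ x).2 ⟨hx, hn m hm (by exact_mod_cast h1) x hx⟩).2

theorem bot_mem [Module.Finite ℤ N] [Module.Free ℤ N]
    {σ : PointedCone ℝ (RealSpan N)} (hσ : σ ∈ Δ.cones) : ⊥ ∈ Δ.cones :=
  Δ.face_mem σ hσ _ (isFace_bot (Δ.isRational σ hσ) (Δ.isStrictlyConvex σ hσ))

end Fan

end Toric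

namespace Toric

/-! ### Semigroup algebras: localization, normality, finiteness, smoothness. -/

section MonoidAlgebra

/-- Inverting one monomial of a monoid algebra is a matter of exponents alone. This is the source of
all the principal open immersions below. -/
theorem isLocalization_mapDomain {P Q : Type} [AddCommMonoid P] [AddCommMonoid Q] (f : P →+ Q)
    (hf : Function.Injective f) (m : P) {n : Q} (hn : f m + n = 0)
    (h : ∀ q : Q, ∃ k : ℕ, ∃ p : P, q + k • f m = f p) :
    letI := (AddMonoidAlgebra.mapDomainRingHom ℂ f).toAlgebra
    IsLocalization.Away (AddMonoidAlgebra.single m (1 : ℂ)) (AddMonoidAlgebra ℂ Q) := by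
  classical
  let _ := (AddMonoidAlgebra.mapDomainRingHom ℂ f).toAlgebra
  have hmap : ∀ x : AddMonoidAlgebra ℂ P,
      algebraMap (AddMonoidAlgebra ℂ P) (AddMonoidAlgebra ℂ Q) x =
        AddMonoidAlgebra.mapDomain f x := fun _ => rfl
  have hinj : Function.Injective
      (algebraMap (AddMonoidAlgebra ℂ P) (AddMonoidAlgebra ℂ Q)) := fun x y hxy =>
    AddMonoidAlgebra.mapDomain_injective hf hxy
  have hpow : ∀ j : ℕ, (AddMonoidAlgebra.single m (1 : ℂ)) ^ j =
      AddMonoidAlgebra.single (j • m) 1 := by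
    intro j; simp [AddMonoidAlgebra.single_pow]
  refine IsLocalization.Away.mk _ ?_ ?_ ?_
  · rw [hmap, AddMonoidAlgebra.mapDomain_single]
    refine IsUnit.of_mul_eq_one (AddMonoidAlgebra.single n 1) ?_
    rw [AddMonoidAlgebra.single_mul_single, AddMonoidAlgebra.one_def, hn, mul_one]
  -- The claim for all j ≥ k, rather than for one exponent, lets the two summands in the additive
  -- step share a common denominator.
  · have : ∀ z : AddMonoidAlgebra ℂ Q, ∃ k : ℕ, ∀ j, k ≤ j →
        ∃ a : AddMonoidAlgebra ℂ P, z * algebraMap _ _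
          ((AddMonoidAlgebra.single m (1 : ℂ)) ^ j) = algebraMap _ _ a := by
      intro z
      induction z using AddMonoidAlgebra.induction_linear with
      | zero => exact ⟨0, fun j _ => ⟨0, by simp⟩⟩
      | add x y hx hy =>
        obtain ⟨k, hk⟩ := hx
        obtain ⟨l, hl⟩ := hy
        refine ⟨max k l, fun j hj => ?_⟩
        obtain ⟨a, ha⟩ := hk j (le_of_max_le_left hj)
        obtain ⟨b, hb⟩ := hl j (le_of_max_le_right hj)
        exact ⟨a + b, by rw [add_mul, ha, hb, map_add]⟩
      | single w c =>
        obtain ⟨k, p, hk⟩ := h w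
        refine ⟨k, fun j hj => ⟨AddMonoidAlgebra.single (p + (j - k) • m) c, ?_⟩⟩
        rw [hpow, hmap, hmap, AddMonoidAlgebra.mapDomain_single, AddMonoidAlgebra.mapDomain_single,
          AddMonoidAlgebra.single_mul_single, mul_one, map_add, ← hk, add_assoc, map_nsmul,
          map_nsmul, ← add_smul, Nat.add_sub_cancel' hj]
    intro z
    obtain ⟨k, hk⟩ := this z
    obtain ⟨a, ha⟩ := hk k le_rfl
    exact ⟨k, a, by rw [← map_pow]; exact ha⟩
  · intro a b hab
    exact ⟨0, by rw [hinj hab]⟩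

/-- A monoid that embeds into some ℤ^d has the unique sums property, which excludes zero divisors.
-/
theorem isDomain_addMonoidAlgebra {L : Type} [AddCommGroup L] [Module.Free ℤ L]
    [Module.Finite ℤ L] {P : Type} [AddCommMonoid P] (f : P →+ L) (hf : Function.Injective f) :
    IsDomain (AddMonoidAlgebra ℂ P) := by
  have : UniqueSums P := by
    let b := Module.finBasis ℤ L
    let g : P →+ (Fin (Module.finrank ℤ L) → ℤ) := b.equivFun.toLinearMap.toAddMonoidHom.comp f
    exact UniqueSums.of_injective_addHom g.toAddHom (b.equivFun.injective.comp hf) inferInstance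
  infer_instance

theorem mapDomainRingHom_surjective {P Q : Type} [AddCommMonoid P] [AddCommMonoid Q] {f : P →+ Q}
    (hf : Function.Surjective f) :
    Function.Surjective (AddMonoidAlgebra.mapDomainRingHom ℂ f) := by
  intro z
  induction z using AddMonoidAlgebra.induction_linear with
  | zero => exact ⟨0, map_zero _⟩
  | add x y hx hy =>
    obtain ⟨a, rfl⟩ := hx
    obtain ⟨b, rfl⟩ := hy
    exact ⟨a + b, map_add _ _ _⟩
  | single w c =>
    obtain ⟨p, rfl⟩ := hf w
    exact ⟨AddMonoidAlgebra.single p c, AddMonoidAlgebra.mapDomain_single⟩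

/-- ℂ[L] is the polynomial ring in rank-many variables localized at the product of the variables. -/
theorem isIntegrallyClosed_lattice (L : Type) [AddCommGroup L] [Module.Free ℤ L]
    [Module.Finite ℤ L] : IsIntegrallyClosed (AddMonoidAlgebra ℂ L) := by
  classical
  let b := Module.finBasis ℤ L
  let d := Module.finrank ℤ L
  let g : (Fin d →₀ ℕ) →+ L :=
    { toFun := fun x => ∑ i, x i • b i
      map_zero' := by simp
      map_add' := by intro x y; simp [add_smul, Finset.sum_add_distrib] }
  have hrepr : ∀ (x : Fin d →₀ ℕ) i, b.repr (g x) i = x i := by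
    intro x i
    change b.repr (∑ i, x i • b i) i = x i
    simp [Finsupp.single_apply]
  have hg : Function.Injective g := by
    intro x y hxy
    ext i
    have := hrepr x i
    rw [hxy, hrepr] at this
    exact_mod_cast this.symm
  let m : Fin d →₀ ℕ := Finsupp.equivFunOnFinite.symm fun _ => 1
  have hloc := isLocalization_mapDomain g hg m (n := -g m) (by simp) (by
    intro q
    refine ⟨∑ i, (b.repr q i).natAbs, Finsupp.equivFunOnFinite.symm
      fun j => (b.repr q j + ∑ i, ((b.repr q i).natAbs : ℤ)).toNat, ?_⟩
    apply b.repr.injective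
    ext j
    rw [hrepr]
    simp only [map_add, map_nsmul, Finsupp.add_apply, Finsupp.smul_apply, hrepr, m,
      Finsupp.equivFunOnFinite_symm_apply_apply]
    have h1 : ((b.repr q j).natAbs : ℤ) ≤ ∑ i, ((b.repr q i).natAbs : ℤ) :=
      Finset.single_le_sum (f := fun i => ((b.repr q i).natAbs : ℤ))
        (fun i _ => by positivity) (Finset.mem_univ j)
    rw [Int.toNat_of_nonneg (by omega)]
    simp)
  let _ := (AddMonoidAlgebra.mapDomainRingHom ℂ g).toAlgebra
  have h1 : IsDomain (AddMonoidAlgebra ℂ (Fin d →₀ ℕ)) :=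
    inferInstanceAs (IsDomain (MvPolynomial (Fin d) ℂ))
  have h2 : IsIntegrallyClosed (AddMonoidAlgebra ℂ (Fin d →₀ ℕ)) :=
    inferInstanceAs (IsIntegrallyClosed (MvPolynomial (Fin d) ℂ))
  refine isIntegrallyClosed_of_isLocalization (R := AddMonoidAlgebra ℂ (Fin d →₀ ℕ)) _
    (Submonoid.powers (AddMonoidAlgebra.single m (1 : ℂ))) ?_
  rw [Submonoid.powers_le]
  refine mem_nonZeroDivisors_of_ne_zero ?_
  exact (AddMonoidAlgebra.single_ne_zero).2 one_ne_zero

open Polynomial in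
-- B[X] is integrally closed in its field of fractions, and the Laurent polynomials embed into that
-- field.
theorem isIntegrallyClosedIn_laurentPolynomial (B : Type) [CommRing B] [IsDomain B]
    [IsIntegrallyClosed B] : IsIntegrallyClosedIn B[X] (LaurentPolynomial B) := by
  let K := FractionRing B[X]
  have hX : Submonoid.powers (X : B[X]) ≤ nonZeroDivisors B[X] := by
    rw [Submonoid.powers_le]
    exact mem_nonZeroDivisors_of_ne_zero X_ne_zero
  let g : LaurentPolynomial B →ₐ[B[X]] K :=
    IsLocalization.liftAlgHom (M := Submonoid.powers (X : B[X])) (f := Algebra.ofId B[X] K) (by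
      intro y
      exact IsLocalization.map_units K (⟨y.1, hX y.2⟩ : nonZeroDivisors B[X]))
  refine AlgHom.isIntegrallyClosedIn g ?_
    ((isIntegrallyClosed_iff_isIntegrallyClosedIn K).1 inferInstance)
  intro x y hxy
  obtain ⟨⟨a, s⟩, ha⟩ := IsLocalization.surj (Submonoid.powers (X : B[X])) x
  obtain ⟨⟨b, t⟩, hb⟩ := IsLocalization.surj (Submonoid.powers (X : B[X])) y
  have hs := IsLocalization.map_units (LaurentPolynomial B) s
  have ht := IsLocalization.map_units (LaurentPolynomial B) t
  refine hs.mul_right_cancel (ht.mul_right_cancel ?_)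
  dsimp only at ha hb
  have h1 := congrArg g ha
  have h2 := congrArg g hb
  rw [map_mul, AlgHom.commutes, AlgHom.commutes] at h1 h2
  have h3 : algebraMap B[X] K (a * t) = algebraMap B[X] K (b * s) := by
    rw [map_mul, map_mul, ← h1, ← h2, hxy]; ring
  have h4 := IsFractionRing.injective B[X] K h3
  calc _ = algebraMap B[X] (LaurentPolynomial B) (a * t) := by rw [map_mul, ← ha]
    _ = _ := by rw [h4, map_mul, ← hb]; ring

open Polynomial in
/-- The semigroup algebra of the lattice points of a polyhedral cone is integrally closed. -/
theorem isIntegrallyClosed_of_mem_iff_nonneg {L ι : Type} [AddCommGroup L] [Module.Free ℤ L]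
    [Module.Finite ℤ L] (n : ι → L →+ ℤ) (P : AddSubmonoid L)
    (hP : ∀ l, l ∈ P ↔ ∀ i, 0 ≤ n i l) : IsIntegrallyClosed (AddMonoidAlgebra ℂ P) := by
  classical
  have hB := isIntegrallyClosed_lattice L
  have hD : IsDomain (AddMonoidAlgebra ℂ L) :=
    isDomain_addMonoidAlgebra (AddMonoidHom.id L) Function.injective_id
  have hD' : IsDomain (AddMonoidAlgebra ℂ P) :=
    isDomain_addMonoidAlgebra P.subtype Subtype.val_injective
  let _ := (AddMonoidAlgebra.mapDomainRingHom ℂ P.subtype).toAlgebra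
  have hinj : Function.Injective (algebraMap (AddMonoidAlgebra ℂ P) (AddMonoidAlgebra ℂ L)) :=
    fun x y hxy => AddMonoidAlgebra.mapDomain_injective Subtype.val_injective hxy
  have : FaithfulSMul (AddMonoidAlgebra ℂ P) (AddMonoidAlgebra ℂ L) :=
    (faithfulSMul_iff_algebraMap_injective _ _).2 hinj
  have : IsIntegrallyClosedIn (AddMonoidAlgebra ℂ P) (AddMonoidAlgebra ℂ L) := by
    refine isIntegrallyClosedIn_iff.2 ⟨hinj, fun {f} hf => ?_⟩
    have hsupp : ∀ i, ∀ l, f.coeff l ≠ 0 → 0 ≤ n i l := by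
      intro i
      -- With B = ℂ[L], the grading by n_i sends X^l to X^l T^{n_i(l)} in B[T, T⁻¹] and maps ℂ[P]
      -- into B[T]. So the image of an element f integral over ℂ[P] is integral over B[T], hence in
      -- B[T]: no exponent of f is negative under n_i. As i varies, the support of f lies in P.
      let Φ : (AddMonoidAlgebra ℂ L) →ₐ[ℂ] LaurentPolynomial (AddMonoidAlgebra ℂ L) := AddMonoidAlgebra.lift ℂ _ L
        { toFun := fun l => LaurentPolynomial.C (AddMonoidAlgebra.single l.toAdd (1 : ℂ)) *
            LaurentPolynomial.T (n i l.toAdd)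
          map_one' := by simp [← AddMonoidAlgebra.one_def]
          map_mul' := by
            intro x y
            have : (AddMonoidAlgebra.single (x.toAdd + y.toAdd) (1 : ℂ)) =
                AddMonoidAlgebra.single x.toAdd 1 * AddMonoidAlgebra.single y.toAdd 1 := by
              rw [AddMonoidAlgebra.single_mul_single, one_mul]
            rw [toAdd_mul, this, map_mul, map_add, LaurentPolynomial.T_add]
            ring }
      have hΦ : ∀ l c, Φ (AddMonoidAlgebra.single l c) =
          AddMonoidAlgebra.single (n i l) (AddMonoidAlgebra.single l c) := by
        intro l c
        simp only [Φ, AddMonoidAlgebra.lift_single]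
        change c • (LaurentPolynomial.C (AddMonoidAlgebra.single l (1 : ℂ)) *
            LaurentPolynomial.T (n i l)) = _
        rw [← LaurentPolynomial.single_eq_C_mul_T, AddMonoidAlgebra.smul_single,
          AddMonoidAlgebra.smul_single, smul_eq_mul, mul_one]
      have hcoeff : ∀ (z : (AddMonoidAlgebra ℂ L)) l, ((Φ z).coeff (n i l)).coeff l = z.coeff l := by
        intro z l
        induction z using AddMonoidAlgebra.induction_linear with
        | zero => simp
        | add x y hx hy =>
          rw [map_add, AddMonoidAlgebra.coeff_add, Finsupp.add_apply, AddMonoidAlgebra.coeff_add,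
            Finsupp.add_apply, hx, hy, AddMonoidAlgebra.coeff_add, Finsupp.add_apply]
        | single w c =>
          rw [hΦ, AddMonoidAlgebra.coeff_single]
          by_cases hn : n i w = n i l
          · rw [hn, Finsupp.single_eq_same]
          · rw [Finsupp.single_eq_of_ne (Ne.symm hn), AddMonoidAlgebra.coeff_single,
              Finsupp.single_eq_of_ne (by rintro rfl; exact hn rfl)]
            rfl
      let Ψ : AddMonoidAlgebra ℂ P →ₐ[ℂ] (AddMonoidAlgebra ℂ L)[X] := AddMonoidAlgebra.lift ℂ _ P
        { toFun := fun l => C (AddMonoidAlgebra.single (l.toAdd : L) (1 : ℂ)) *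
            X ^ (n i l.toAdd).toNat
          map_one' := by simp [← AddMonoidAlgebra.one_def]
          map_mul' := by
            intro x y
            have : (AddMonoidAlgebra.single ((x.toAdd : L) + y.toAdd) (1 : ℂ)) =
                AddMonoidAlgebra.single (x.toAdd : L) 1 *
                  AddMonoidAlgebra.single (y.toAdd : L) 1 := by
              rw [AddMonoidAlgebra.single_mul_single, one_mul]
            rw [toAdd_mul, AddSubmonoid.coe_add, this, map_mul, map_add,
              Int.toNat_add ((hP _).1 x.toAdd.2 i) ((hP _).1 y.toAdd.2 i), pow_add]
            ring }
      have hcomm : (algebraMap (AddMonoidAlgebra ℂ L)[X] (LaurentPolynomial (AddMonoidAlgebra ℂ L))).comp Ψ.toRingHom =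
          Φ.toRingHom.comp (algebraMap (AddMonoidAlgebra ℂ P) (AddMonoidAlgebra ℂ L)) := by
        refine RingHom.ext fun z => ?_
        induction z using AddMonoidAlgebra.induction_linear with
        | zero => simp
        | add x y hx hy => rw [map_add, hx, hy, map_add]
        | single w c =>
          have h1 : (algebraMap (AddMonoidAlgebra ℂ P) (AddMonoidAlgebra ℂ L)) (AddMonoidAlgebra.single w c) =
            AddMonoidAlgebra.single (w : L) c := AddMonoidAlgebra.mapDomain_single
          have h2 : Ψ (AddMonoidAlgebra.single w c) =
              C (AddMonoidAlgebra.single (w : L) c) * X ^ (n i w).toNat := by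
            simp only [Ψ, AddMonoidAlgebra.lift_single]
            change c • (C (AddMonoidAlgebra.single (w : L) (1 : ℂ)) * X ^ (n i w).toNat) = _
            rw [← smul_mul_assoc, smul_C]
            simp
          change algebraMap (AddMonoidAlgebra ℂ L)[X] (LaurentPolynomial (AddMonoidAlgebra ℂ L)) (Ψ _) = Φ (algebraMap _ (AddMonoidAlgebra ℂ L) _)
          rw [h1, h2, hΦ, LaurentPolynomial.algebraMap_eq_toLaurent, toLaurent_C_mul_X_pow,
            ← LaurentPolynomial.single_eq_C_mul_T, Int.toNat_of_nonneg ((hP _).1 w.2 i)]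
      have hintegral : IsIntegral (AddMonoidAlgebra ℂ L)[X] (Φ f) := hf.map_of_comp_eq Ψ.toRingHom Φ.toRingHom hcomm
      have := isIntegrallyClosedIn_laurentPolynomial (AddMonoidAlgebra ℂ L)
      obtain ⟨q, hq⟩ := IsIntegrallyClosedIn.isIntegral_iff.1 hintegral
      have hneg : ∀ (q : (AddMonoidAlgebra ℂ L)[X]) (j : ℤ), j < 0 → (toLaurent q).coeff j = 0 := by
        intro q j hj
        induction q using Polynomial.induction_on' with
        | add p q hp hq => rw [map_add, AddMonoidAlgebra.coeff_add, Finsupp.add_apply, hp, hq, add_zero]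
        | monomial k a =>
          rw [← C_mul_X_pow_eq_monomial, toLaurent_C_mul_X_pow,
            ← LaurentPolynomial.single_eq_C_mul_T, AddMonoidAlgebra.coeff_single,
            Finsupp.single_eq_of_ne (by omega)]
      intro l hl
      by_contra hlt
      refine hl ?_
      rw [← hcoeff, ← hq, LaurentPolynomial.algebraMap_eq_toLaurent, hneg _ _ (not_le.1 hlt)]
      simp
    refine ⟨AddMonoidAlgebra.comapDomain _ Subtype.val_injective f,
      AddMonoidAlgebra.mapDomain_comapDomain ?_ Subtype.val_injective⟩
    intro l hl
    exact ⟨⟨l, (hP l).2 fun i => hsupp i l (Finsupp.mem_support_iff.1 hl)⟩, rfl⟩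
  exact .of_isIntegrallyClosed_of_isIntegrallyClosedIn _ (AddMonoidAlgebra ℂ L)

/-- A power of each monomial comes from ℂ[P], so the extension is integral; it is also of finite
type. -/
theorem finite_mapDomainRingHom {P Q : Type} [AddCommMonoid P] [AddCommMonoid Q]
    (f : P →+ Q) [AddMonoid.FG Q] (h : ∀ q : Q, ∃ k : ℕ, 0 < k ∧ k • q ∈ AddMonoidHom.mrange f) :
    (AddMonoidAlgebra.mapDomainRingHom ℂ f).Finite := by
  let _ := (AddMonoidAlgebra.mapDomainRingHom ℂ f).toAlgebra
  have : IsScalarTower ℂ (AddMonoidAlgebra ℂ P) (AddMonoidAlgebra ℂ Q) :=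
    .of_algebraMap_eq fun c => by
      change _ = AddMonoidAlgebra.mapDomainRingHom ℂ f (AddMonoidAlgebra.single 0 c)
      simp
  have h1 : Algebra.FiniteType (AddMonoidAlgebra ℂ P) (AddMonoidAlgebra ℂ Q) :=
    have := AddMonoidAlgebra.finiteType_of_fg ℂ Q
    Algebra.FiniteType.of_restrictScalars_finiteType ℂ _ _
  have h2 : Algebra.IsIntegral (AddMonoidAlgebra ℂ P) (AddMonoidAlgebra ℂ Q) := by
    refine ⟨fun z => ?_⟩
    induction z using AddMonoidAlgebra.induction_linear with
    | zero => exact isIntegral_zero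
    | add x y hx hy => exact hx.add hy
    | single q c =>
      obtain ⟨k, hk, p, hp⟩ := h q
      refine IsIntegral.of_pow hk ?_
      have : (AddMonoidAlgebra.single q c : AddMonoidAlgebra ℂ Q) ^ k =
          algebraMap (AddMonoidAlgebra ℂ P) _ (AddMonoidAlgebra.single p (c ^ k)) := by
        change _ = AddMonoidAlgebra.mapDomain f _
        rw [AddMonoidAlgebra.mapDomain_single, hp, AddMonoidAlgebra.single_pow]
      rw [this]
      exact isIntegral_algebraMap
  exact Algebra.IsIntegral.finite

/-- The section induces a splitting of A / (ker p)² → B, which is the criterion for formal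
smoothness of a quotient of the formally smooth algebra A. -/
theorem formallySmooth_of_retract {R A B : Type} [CommRing R] [CommRing A] [CommRing B]
    [Algebra R A] [Algebra R B] [Algebra.FormallySmooth R A] (p : A →ₐ[R] B) (s : B →ₐ[R] A)
    (h : p.comp s = AlgHom.id R B) : Algebra.FormallySmooth R B := by
  refine Algebra.FormallySmooth.of_split p ((Ideal.Quotient.mkₐ R _).comp s) ?_
  ext b
  exact DFunLike.congr_fun h b

/-- The semigroup algebra of a monoid isomorphic to `ℕ ^ s × ℤ ^ t` is smooth. -/
theorem smooth_of_basis {Q ι : Type} [Finite ι] [AddCommMonoid Q] (s : Set ι) (e : Q →+ (ι → ℤ))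
    (he : Function.Injective e) (hs : ∀ z, z ∈ AddMonoidHom.mrange e ↔ ∀ i ∈ s, 0 ≤ z i) :
    Algebra.Smooth ℂ (AddMonoidAlgebra ℂ Q) := by
  classical
  have := Fintype.ofFinite ι
  have hnat : ∀ x : ι →₀ ℕ, ∃ q, e q = fun i => (x i : ℤ) := fun x =>
    (hs _).2 fun i _ => by positivity
  choose g hg using hnat
  let g' : (ι →₀ ℕ) →+ Q :=
    { toFun := g
      map_zero' := he (by rw [hg, map_zero]; rfl)
      map_add' := fun x y => he (by rw [map_add, hg, hg, hg]; ext; simp) }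
  -- The sum of the basis vectors outside s. Inverting its monomial makes exactly these coordinates
  -- run through ℤ, so ℂ[Q] is a localization of a polynomial ring.
  let m : ι →₀ ℕ := Finsupp.equivFunOnFinite.symm fun i => if i ∈ s then 0 else 1
  obtain ⟨n, hn⟩ := (hs fun i => if i ∈ s then 0 else -1).2 fun i hi => by simp [hi]
  have hm : e (g m) = fun i => if i ∈ s then 0 else 1 := by
    rw [hg]; ext i; simp [m]
  have hloc := isLocalization_mapDomain g' (fun x y hxy => by
      have h1 : e (g x) = e (g y) := congrArg e hxy
      rw [hg, hg] at h1
      ext i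
      exact_mod_cast congrFun h1 i) m (n := n) (he (by
        rw [map_add, map_zero, hn]
        change e (g m) + _ = 0
        rw [hm]
        ext i
        by_cases hi : i ∈ s <;> simp [hi])) (by
      intro q
      refine ⟨∑ i, (e q i).natAbs, Finsupp.equivFunOnFinite.symm fun j =>
        (e q j + ∑ i, ((e q i).natAbs : ℤ) * (if j ∈ s then 0 else 1)).toNat, he ?_⟩
      change e (q + _ • g m) = e (g _)
      rw [hg, map_add, map_nsmul, hm]
      ext j
      have h0 := (hs (e q)).1 ⟨q, rfl⟩ j
      have h1 : ((e q j).natAbs : ℤ) ≤ ∑ i, ((e q i).natAbs : ℤ) :=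
        Finset.single_le_sum (f := fun i => ((e q i).natAbs : ℤ))
          (fun i _ => by positivity) (Finset.mem_univ j)
      by_cases hj : j ∈ s
      · simpa [hj] using h0 hj
      · rw [Pi.add_apply, Pi.smul_apply]
        simp only [hj, if_false, mul_one, Finsupp.equivFunOnFinite_symm_apply_apply]
        rw [Int.toNat_of_nonneg (by omega)]
        simp)
  let _ := (AddMonoidAlgebra.mapDomainRingHom ℂ g').toAlgebra
  have : IsScalarTower ℂ (AddMonoidAlgebra ℂ (ι →₀ ℕ)) (AddMonoidAlgebra ℂ Q) :=
    .of_algebraMap_eq fun c => by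
      change _ = AddMonoidAlgebra.mapDomainRingHom ℂ g' (AddMonoidAlgebra.single 0 c)
      simp
  have h1 : Algebra.Smooth ℂ (AddMonoidAlgebra ℂ (ι →₀ ℕ)) :=
    by
    change Algebra.Smooth ℂ (MvPolynomial ι ℂ)
    exact { }
  have h2 : Algebra.Smooth (AddMonoidAlgebra ℂ (ι →₀ ℕ)) (AddMonoidAlgebra ℂ Q) :=
    .of_isLocalization_Away (AddMonoidAlgebra.single m (1 : ℂ))
  exact .comp _ (AddMonoidAlgebra ℂ (ι →₀ ℕ)) _

end MonoidAlgebra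

end Toric

namespace Toric

/-! ### Irreducible generators modulo units. -/

section Irreducible

variable {L : Type} [AddCommGroup L]

/-- The group of units of a submonoid of a lattice. -/
def unitsOf (Q : AddSubmonoid L) : AddSubgroup L where
  carrier := {g | g ∈ Q ∧ -g ∈ Q}
  add_mem' {a b} ha hb := ⟨add_mem ha.1 hb.1, by rw [neg_add]; exact add_mem ha.2 hb.2⟩
  zero_mem' := ⟨zero_mem _, by simp⟩
  neg_mem' {a} ha := ⟨ha.2, by simpa using ha.1⟩

theorem mem_unitsOf {Q : AddSubmonoid L} {g : L} : g ∈ unitsOf Q ↔ g ∈ Q ∧ -g ∈ Q := Iff.rfl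

theorem mem_unitsOf_of_add {Q : AddSubmonoid L} {a b : L} (ha : a ∈ Q) (hb : b ∈ Q)
    (hab : a + b ∈ unitsOf Q) : a ∈ unitsOf Q := by
  refine ⟨ha, ?_⟩
  have : -a = b + -(a + b) := by abel
  rw [this]
  exact add_mem hb hab.2

/-- A finitely generated monoid is generated by its units and by finitely many irreducible
elements. -/
theorem exists_irreducible_generators {Q : AddSubmonoid L} (hQ : Q.FG) :
    ∃ s : Finset L, (s : Set L) ⊆ Q ∧
      Q = AddSubmonoid.closure (s : Set L) ⊔ (unitsOf Q).toAddSubmonoid ∧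
      (∀ u ∈ s, u ∉ unitsOf Q) ∧ (∀ u ∈ s, ∀ v ∈ s, u - v ∈ unitsOf Q → u = v) ∧
      ∀ u ∈ s, ∀ w ∈ Q, ∀ w' ∈ Q, w + w' - u ∈ unitsOf Q → w ∈ unitsOf Q ∨ w' ∈ unitsOf Q := by
  classical
  -- The generators form a set of least cardinality among those which generate Q together with its
  -- units; minimality makes each of them irredundant.
  have hex : ∃ k : ℕ, ∃ s : Finset L, s.card = k ∧
      Q = AddSubmonoid.closure (s : Set L) ⊔ (unitsOf Q).toAddSubmonoid := by
    obtain ⟨s, hs⟩ := hQ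
    refine ⟨_, s, rfl, ?_⟩
    rw [hs, eq_comm, sup_eq_left]
    exact fun g hg => hg.1
  obtain ⟨s, hcard, hs⟩ := Nat.find_spec hex
  have hsQ : (s : Set L) ⊆ Q := fun u hu => by
    rw [hs]; exact AddSubmonoid.mem_sup_left (AddSubmonoid.subset_closure hu)
  have hunits : ∀ g ∈ unitsOf Q, ∀ T : AddSubmonoid L, g ∈ T ⊔ (unitsOf Q).toAddSubmonoid :=
    fun g hg T => AddSubmonoid.mem_sup_right hg
  have hnot : ∀ u ∈ s, u ∉ AddSubmonoid.closure ((s.erase u : Finset L) : Set L) ⊔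
      (unitsOf Q).toAddSubmonoid := by
    intro u hu hmem
    have hlt : (s.erase u).card < Nat.find hex := by
      rw [← hcard]; exact Finset.card_erase_lt_of_mem hu
    refine Nat.find_min hex hlt ⟨s.erase u, rfl, le_antisymm ?_ ?_⟩
    · conv_lhs => rw [hs]
      refine sup_le ?_ le_sup_right
      rw [AddSubmonoid.closure_le]
      intro v hv
      by_cases hvu : v = u
      · rw [hvu]; exact hmem
      · exact AddSubmonoid.mem_sup_left (AddSubmonoid.subset_closure
          (Finset.mem_coe.2 (Finset.mem_erase.2 ⟨hvu, hv⟩)))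
    · refine sup_le ?_ fun g hg => hg.1
      rw [AddSubmonoid.closure_le]
      exact fun v hv => hsQ (Finset.mem_of_mem_erase hv)
  have hdec : ∀ u ∈ s, ∀ w ∈ Q, ∃ k : ℕ,
      ∃ t ∈ AddSubmonoid.closure ((s.erase u : Finset L) : Set L) ⊔ (unitsOf Q).toAddSubmonoid,
        w = k • u + t := by
    intro u hu w hw
    have hle : Q ≤ AddSubmonoid.closure {u} ⊔
        (AddSubmonoid.closure ((s.erase u : Finset L) : Set L) ⊔ (unitsOf Q).toAddSubmonoid) := by
      conv_lhs => rw [hs]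
      refine sup_le ?_ (le_sup_right.trans le_sup_right)
      rw [AddSubmonoid.closure_le]
      intro v hv
      by_cases hvu : v = u
      · rw [hvu]; exact AddSubmonoid.mem_sup_left (AddSubmonoid.subset_closure rfl)
      · exact AddSubmonoid.mem_sup_right (AddSubmonoid.mem_sup_left (AddSubmonoid.subset_closure
          (Finset.mem_coe.2 (Finset.mem_erase.2 ⟨hvu, hv⟩))))
    obtain ⟨a, ha, t, ht, rfl⟩ := AddSubmonoid.mem_sup.1 (hle hw)
    obtain ⟨k, rfl⟩ := AddSubmonoid.mem_closure_singleton.1 ha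
    exact ⟨k, t, ht, rfl⟩
  have hTQ : ∀ u, AddSubmonoid.closure ((s.erase u : Finset L) : Set L) ⊔
      (unitsOf Q).toAddSubmonoid ≤ Q := by
    intro u
    refine sup_le ?_ fun g hg => hg.1
    rw [AddSubmonoid.closure_le]
    exact fun v hv => hsQ (Finset.mem_of_mem_erase hv)
  refine ⟨s, hsQ, hs, fun u hu hmem => hnot u hu (hunits u hmem _), ?_, ?_⟩
  · intro u hu v hv huv
    by_contra hne
    refine hnot u hu ?_
    have : u = v + (u - v) := by abel
    rw [this]
    exact add_mem (AddSubmonoid.mem_sup_left (AddSubmonoid.subset_closure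
      (Finset.mem_coe.2 (Finset.mem_erase.2 ⟨Ne.symm (by rwa [← this]), hv⟩)))) (hunits _ huv _)
  · intro u hu w hw w' hw' h
    obtain ⟨k, t, ht, rfl⟩ := hdec u hu w hw
    obtain ⟨k', t', ht', rfl⟩ := hdec u hu w' hw'
    -- Here w = k u + t and w' = k' u + t', with t and t' free of u. If k = k' = 0, then u is
    -- redundant. Otherwise one copy of u cancels in w + w' - u, and the summand other than the one
    -- which supplied it divides a unit.
    rcases k with _ | k
    · rcases k' with _ | k'
      · refine absurd ?_ (hnot u hu)
        have : t + t' + -((0 • u + t) + (0 • u + t') - u) = u := by simp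
        have h1 := add_mem (add_mem ht ht') (hunits _ (neg_mem h) _)
        rwa [this] at h1
      · left
        refine mem_unitsOf_of_add hw (b := k' • u + t')
          (add_mem (nsmul_mem (hsQ hu) _) (hTQ u ht')) ?_
        convert h using 1
        rw [succ_nsmul, zero_nsmul]; abel
    · right
      refine mem_unitsOf_of_add hw' (b := k • u + t)
        (add_mem (nsmul_mem (hsQ hu) _) (hTQ u ht)) ?_
      convert h using 1
      rw [succ_nsmul]; abel

end Irreducible

/-! ### Smooth points of closed orbits: free monoid plus units. -/

section Derivation

variable {L : Type} [AddCommGroup L]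

/-- The derivation `∂ / ∂ X^u` at a point of the closed orbit, for an irreducible element `u`. -/
theorem exists_derivation {Q : AddSubmonoid L} {κ : Type} [Field κ] [Algebra ℂ κ]
    [Algebra (AddMonoidAlgebra ℂ Q) κ] [IsScalarTower ℂ (AddMonoidAlgebra ℂ Q) κ]
    (hκ : ∀ w : Q, (w : L) ∉ unitsOf Q →
      algebraMap (AddMonoidAlgebra ℂ Q) κ (AddMonoidAlgebra.single w 1) = 0)
    {u : L} (hu : u ∈ Q) (hu' : u ∉ unitsOf Q)
    (hirr : ∀ w ∈ Q, ∀ w' ∈ Q, w + w' - u ∈ unitsOf Q → w ∈ unitsOf Q ∨ w' ∈ unitsOf Q) :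
    ∃ D : Derivation ℂ (AddMonoidAlgebra ℂ Q) κ,
      D (AddMonoidAlgebra.single ⟨u, hu⟩ 1) = 1 ∧
      ∀ w : Q, (w : L) - u ∉ unitsOf Q → D (AddMonoidAlgebra.single w 1) = 0 := by
  classical
  let ev := algebraMap (AddMonoidAlgebra ℂ Q) κ
  -- Only w ≡ u modulo units contributes, with the value of X^{w-u} at the point. In the Leibniz
  -- rule, if w + w' ≡ u then one of w, w' is a unit by irreducibility. If not, both products
  -- vanish: X^w is zero at the point unless w is a unit, and then w' ≢ u.
  let d : Q → κ := fun w => if h : (w : L) - u ∈ unitsOf Q then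
    ev (AddMonoidAlgebra.single ⟨w - u, h.1⟩ 1) else 0
  have hd : ∀ w w' : Q, d (w + w') =
      ev (AddMonoidAlgebra.single w 1) * d w' + ev (AddMonoidAlgebra.single w' 1) * d w := by
    have key : ∀ w w' : Q, ((w + w' : Q) : L) - u ∈ unitsOf Q → (w : L) ∈ unitsOf Q →
        d (w + w') =
      ev (AddMonoidAlgebra.single w 1) * d w' + ev (AddMonoidAlgebra.single w' 1) * d w := by
      intro w w' h hw
      have h1 : (w' : L) - u ∈ unitsOf Q := by
        have : (w' : L) - u = ((w + w' : Q) : L) - u - w := by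
          rw [AddSubmonoid.coe_add]; abel
        rw [this]; exact sub_mem h hw
      have h2 : (w : L) - u ∉ unitsOf Q := fun h2 => hu' (by
        have := sub_mem hw h2
        simpa using this)
      simp only [d]
      rw [dif_pos h, dif_pos h1, dif_neg h2, mul_zero, add_zero, ← map_mul,
        AddMonoidAlgebra.single_mul_single, one_mul]
      congr 2
      ext
      simp only [AddSubmonoid.coe_add]
      abel
    intro w w'
    by_cases h : ((w + w' : Q) : L) - u ∈ unitsOf Q
    · rcases hirr w w.2 w' w'.2 h with hw | hw
      · exact key w w' h hw
      · rw [add_comm w w', key w' w (by rwa [add_comm w' w]) hw, add_comm]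
    · have h0 : ∀ w w' : Q, ((w + w' : Q) : L) - u ∉ unitsOf Q →
          ev (AddMonoidAlgebra.single w 1) * d w' = 0 := by
        intro w w' h
        by_cases hw : (w : L) ∈ unitsOf Q
        · have h1 : (w' : L) - u ∉ unitsOf Q := fun h1 => h (by
            have := add_mem hw h1
            rw [AddSubmonoid.coe_add]
            convert this using 1; abel)
          simp only [d, dif_neg h1, mul_zero]
        · rw [hκ w hw, zero_mul]
      rw [h0 w w' h, h0 w' w (by rwa [add_comm w' w])]
      simp only [d, dif_neg h, add_zero]
  let l : AddMonoidAlgebra ℂ Q →ₗ[ℂ] κ :=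
    Finsupp.linearCombination ℂ d ∘ₗ (AddMonoidAlgebra.coeffLinearEquiv ℂ).toLinearMap
  have hl : ∀ w c, l (AddMonoidAlgebra.single w c) = c • d w := by
    intro w c
    exact Finsupp.linearCombination_single ℂ c w
  have hev : ∀ (w : Q) (c : ℂ), ev (AddMonoidAlgebra.single w c) =
      c • ev (AddMonoidAlgebra.single w 1) := by
    intro w c
    rw [← algebraMap_smul (AddMonoidAlgebra ℂ Q) c (ev _), Algebra.smul_def, ← map_mul]
    congr 1
    rw [← Algebra.smul_def, AddMonoidAlgebra.smul_single, smul_eq_mul, mul_one]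
  refine ⟨Derivation.mk' l fun a b => ?_, ?_, ?_⟩
  · induction a using AddMonoidAlgebra.induction_linear with
    | zero => simp
    | add x y hx hy => rw [add_mul, map_add, hx, hy, map_add, add_smul, smul_add]; abel
    | single w c =>
      induction b using AddMonoidAlgebra.induction_linear with
      | zero => simp
      | add x y hx hy => rw [mul_add, map_add, hx, hy, map_add, add_smul, smul_add]; abel
      | single w' c' =>
        rw [AddMonoidAlgebra.single_mul_single, hl, hl, hl, hd]
        simp only [Algebra.smul_def (R := AddMonoidAlgebra ℂ Q)]
        change _ = ev _ * _ + ev _ * _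
        rw [hev w c, hev w' c']
        simp only [Algebra.smul_def, map_mul]
        ring
  · change l _ = 1
    rw [hl, one_smul]
    simp only [d]
    rw [dif_pos (by simp), ← map_one ev, AddMonoidAlgebra.one_def]
    congr 2
    ext; simp
  · intro w hw
    change l _ = 0
    rw [hl]
    simp only [d, dif_neg hw, smul_zero]

/-- A derivation at a smooth point extends to the local ring. -/
theorem exists_derivation_lift {A : Type} [CommRing A] [Algebra ℂ A] (p : Ideal A) [p.IsPrime]
    [Algebra.IsSmoothAt ℂ p] (D : Derivation ℂ A p.ResidueField) :
    ∃ D' : Derivation ℂ (Localization.AtPrime p) (Localization.AtPrime p), ∀ a,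
      IsLocalRing.residue (Localization.AtPrime p) (D' (algebraMap A _ a)) = D a := by
  let S := Localization.AtPrime p
  let g : Ω[A⁄ℂ] →ₗ[A] p.ResidueField := D.liftKaehlerDifferential
  have hunit : ∀ x : p.primeCompl, IsUnit (algebraMap A (Module.End A p.ResidueField) x) := by
    intro x
    have h1 : algebraMap A p.ResidueField x ≠ 0 := by
      rw [ne_eq, Ideal.algebraMap_residueField_eq_zero]; exact x.2
    rw [Module.End.isUnit_iff]
    constructor
    · intro a b hab
      have hab' : (x : A) • a = (x : A) • b := hab
      rw [Algebra.smul_def, Algebra.smul_def] at hab'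
      exact mul_left_cancel₀ h1 hab'
    · intro b
      refine ⟨(algebraMap A p.ResidueField x)⁻¹ * b, ?_⟩
      change (x : A) • ((algebraMap A p.ResidueField x)⁻¹ * b) = b
      rw [Algebra.smul_def, mul_inv_cancel_left₀ h1]
  let g' : Ω[S⁄ℂ] →ₗ[A] p.ResidueField :=
    IsLocalizedModule.lift p.primeCompl (KaehlerDifferential.map ℂ ℂ A S) g hunit
  let g'' : Ω[S⁄ℂ] →ₗ[S] p.ResidueField :=
    LinearMap.extendScalarsOfIsLocalization p.primeCompl S g'
  -- Smoothness enters here: the differentials of the local ring are projective, so the map to the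
  -- residue field which represents D lifts to the local ring.
  have hproj : Module.Projective S Ω[S⁄ℂ] :=
    Algebra.FormallySmooth.projective_kaehlerDifferential
  obtain ⟨h, hh⟩ := Module.projective_lifting_property
    (Algebra.linearMap S p.ResidueField) g'' (IsLocalRing.residue_surjective)
  refine ⟨h.compDer (KaehlerDifferential.D ℂ S), fun a => ?_⟩
  change Algebra.linearMap S p.ResidueField (h (KaehlerDifferential.D ℂ S (algebraMap A S a))) = _
  rw [← LinearMap.comp_apply, hh]
  change g' _ = _
  rw [← KaehlerDifferential.map_D ℂ ℂ A S a]
  change IsLocalizedModule.lift p.primeCompl (KaehlerDifferential.map ℂ ℂ A S) g hunit _ = _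
  rw [IsLocalizedModule.lift_apply]
  exact D.liftKaehlerDifferential_comp_D a

/-- The logarithmic derivatives w ↦ D_u(χ w) / χ w are additive. Applied to the relation ∑ a_v v = g
with g a unit, they give a linear system for the a_v / χ(v) with right-hand side in S, whose matrix
is the identity modulo the maximal ideal and hence invertible. So a_u is a multiple of χ(u) in S;
being an integer in the maximal ideal of a local ℂ-algebra, it is zero. -/
theorem eq_zero_of_derivations [DecidableEq L] {Q : AddSubmonoid L} {S : Type} [CommRing S] [IsDomain S]
    [IsLocalRing S] [Algebra ℂ S] (χ : Q → S) (hχadd : ∀ w w', χ (w + w') = χ w * χ w')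
    (hχ0 : χ 0 = 1) (hχ : ∀ w, χ w ≠ 0) (s : Finset L) (hsQ : ∀ u ∈ s, u ∈ Q)
    (D : s → Derivation ℂ S S)
    (hD : ∀ u v : s, IsLocalRing.residue S (D u (χ ⟨v, hsQ v v.2⟩)) = if u = v then 1 else 0)
    {a : L → ℤ} {g : L} (hg : ∑ u ∈ s, a u • u = g) (ha : g ∈ unitsOf Q) {u : L} (hu : u ∈ s)
    (hmem : χ ⟨u, hsQ u hu⟩ ∈ IsLocalRing.maximalIdeal S) : a u = 0 := by
  let K := FractionRing S
  have hχne : ∀ w, algebraMap S K (χ w) ≠ 0 := fun w => by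
    rw [ne_eq, FaithfulSMul.algebraMap_eq_zero_iff]
    exact hχ w
  let J : Matrix s s S := fun u v => D u (χ ⟨v, hsQ v v.2⟩)
  have hJ : IsUnit J.det := by
    have h1 : IsLocalRing.residue S J.det = 1 := by
      rw [RingHom.map_det]
      have : (IsLocalRing.residue S).mapMatrix J = 1 := by
        ext u v
        rw [RingHom.mapMatrix_apply, Matrix.map_apply, Matrix.one_apply]
        exact hD u v
      rw [this, Matrix.det_one]
    by_contra hn
    have h2 : J.det ∈ IsLocalRing.maximalIdeal S := (IsLocalRing.mem_maximalIdeal _).2 hn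
    rw [← IsLocalRing.residue_eq_zero_iff, h1] at h2
    exact one_ne_zero h2
  let δ : s → (Q →+ K) := fun u =>
    { toFun := fun w => algebraMap S K (D u (χ w)) / algebraMap S K (χ w)
      map_zero' := by rw [hχ0]; simp
      map_add' := fun w w' => by
        have h1 := hχne w
        have h2 := hχne w'
        rw [hχadd, Derivation.leibniz, map_add, smul_eq_mul, smul_eq_mul, map_mul, map_mul, map_mul]
        rw [div_add_div _ _ h1 h2]
        congr 1
        ring }
  -- The relation is split into positive and negative parts, so that it holds inside the monoid Q on
  -- which χ and the logarithmic derivatives are defined.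
  have hrel : ∑ v : s, (a v).toNat • (⟨v, hsQ v v.2⟩ : Q) =
      ⟨g, ha.1⟩ + ∑ v : s, (-a v).toNat • (⟨v, hsQ v v.2⟩ : Q) := by
    ext
    rw [AddSubmonoid.coe_add, AddSubmonoid.coe_finsetSum, AddSubmonoid.coe_finsetSum]
    simp only [AddSubmonoidClass.coe_nsmul]
    rw [← sub_eq_iff_eq_add, ← Finset.sum_sub_distrib, ← hg, ← Finset.sum_coe_sort s]
    refine Finset.sum_congr rfl fun v _ => ?_
    rw [← natCast_zsmul, ← natCast_zsmul, ← sub_smul]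
    congr 1
    omega
  let t : s → S := fun u => χ ⟨-g, ha.2⟩ * D u (χ ⟨g, ha.1⟩)
  have ht : ∀ u, δ u ⟨g, ha.1⟩ = algebraMap S K (t u) := by
    intro u
    change algebraMap S K (D u (χ ⟨g, ha.1⟩)) / algebraMap S K (χ ⟨g, ha.1⟩) = _
    rw [div_eq_iff (hχne _), ← map_mul]
    congr 1
    have : χ ⟨-g, ha.2⟩ * χ ⟨g, ha.1⟩ = 1 := by
      rw [← hχadd, ← hχ0]; congr 1; ext; simp
    simp only [t]
    linear_combination -(D u (χ ⟨g, ha.1⟩)) * this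
  have heq : ∀ u, ∑ v : s, algebraMap S K (J u v) *
      ((a v : K) / algebraMap S K (χ ⟨v, hsQ v v.2⟩)) = algebraMap S K (t u) := by
    intro u
    have h1 := congrArg (δ u) hrel
    rw [map_add, map_sum, map_sum, ← sub_eq_iff_eq_add, ← Finset.sum_sub_distrib, ht] at h1
    rw [← h1]
    refine Finset.sum_congr rfl fun v _ => ?_
    rw [map_nsmul, map_nsmul, nsmul_eq_mul, nsmul_eq_mul, ← sub_mul]
    have h2 : ((a v : ℤ) : K) = ((a v).toNat : K) - ((-a v).toNat : K) := by
      have : (a v : ℤ) = ((a v).toNat : ℤ) - ((-a v).toNat : ℤ) := by omega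
      exact_mod_cast congrArg (Int.cast (R := K)) this
    rw [← h2]
    change _ = (a v : K) * (algebraMap S K (J u v) / algebraMap S K (χ ⟨v, hsQ v v.2⟩))
    ring
  -- The u-th coordinate of the solution J⁻¹ t of the linear system; it is a_u / χ(u), now seen to
  -- lie in S.
  let r : S := ∑ v, J⁻¹ ⟨u, hu⟩ v * t v
  have hr : (a u : K) / algebraMap S K (χ ⟨u, hsQ u hu⟩) = algebraMap S K r := by
    have h1 : algebraMap S K r = ∑ v, algebraMap S K (J⁻¹ ⟨u, hu⟩ v) * ∑ w : s,
        algebraMap S K (J v w) * ((a w : K) / algebraMap S K (χ ⟨w, hsQ w w.2⟩)) := by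
      simp only [r]
      rw [map_sum]
      exact Finset.sum_congr rfl fun v _ => by rw [map_mul, heq]
    rw [h1]
    simp only [Finset.mul_sum]
    rw [Finset.sum_comm]
    have h2 : ∀ w : s, ∑ v, algebraMap S K (J⁻¹ ⟨u, hu⟩ v) * (algebraMap S K (J v w) *
        ((a w : K) / algebraMap S K (χ ⟨w, hsQ w w.2⟩))) =
        if ⟨u, hu⟩ = w then (a w : K) / algebraMap S K (χ ⟨w, hsQ w w.2⟩) else 0 := by
      intro w
      have h3 : ∑ v, J⁻¹ ⟨u, hu⟩ v * J v w = (1 : Matrix s s S) ⟨u, hu⟩ w := by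
        rw [← Matrix.nonsing_inv_mul J hJ, Matrix.mul_apply]
      simp only [← mul_assoc, ← map_mul]
      rw [← Finset.sum_mul, ← map_sum, h3, Matrix.one_apply]
      split_ifs <;> simp
    rw [Finset.sum_congr rfl fun w _ => h2 w, Finset.sum_ite_eq]
    simp
  rw [div_eq_iff (hχne _), ← map_mul, ← map_intCast (algebraMap S K)] at hr
  have hr' : ((a u : ℤ) : S) = r * χ ⟨u, hsQ u hu⟩ := IsFractionRing.injective S K hr
  by_contra hne
  have hmem' : ((a u : ℤ) : S) ∈ IsLocalRing.maximalIdeal S := by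
    rw [hr']; exact Ideal.mul_mem_left _ _ hmem
  refine (IsLocalRing.mem_maximalIdeal _).1 hmem' ?_
  have : ((a u : ℤ) : S) = algebraMap ℂ S (a u) := by simp
  rw [this]
  exact (IsUnit.mk0 _ (by exact_mod_cast hne)).map _

/-- If `Spec ℂ[Q]` is smooth at a point of its closed orbit, then `Q` is the direct sum of its group
of units and of a free monoid. -/
theorem exists_independent_generators [Module.Free ℤ L] [Module.Finite ℤ L] {Q : AddSubmonoid L}
    (hQ : Q.FG) (p : Ideal (AddMonoidAlgebra ℂ Q)) [p.IsPrime] [Algebra.IsSmoothAt ℂ p]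
    (hp : ∀ w : Q, (w : L) ∉ unitsOf Q → AddMonoidAlgebra.single w 1 ∈ p) :
    ∃ s : Finset L, (s : Set L) ⊆ Q ∧
      Q = AddSubmonoid.closure (s : Set L) ⊔ (unitsOf Q).toAddSubmonoid ∧
      ∀ a : L → ℤ, ∑ u ∈ s, a u • u ∈ unitsOf Q → ∀ u ∈ s, a u = 0 := by
  classical
  obtain ⟨s, hsQ, hs, hunit, hdist, hirr⟩ := exists_irreducible_generators hQ
  refine ⟨s, hsQ, hs, fun a ha => ?_⟩
  have hdom : IsDomain (AddMonoidAlgebra ℂ Q) :=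
    isDomain_addMonoidAlgebra Q.subtype Subtype.val_injective
  let A := AddMonoidAlgebra ℂ Q
  let S := Localization.AtPrime p
  have hinj : Function.Injective (algebraMap A S) :=
    IsLocalization.injective S p.primeCompl_le_nonZeroDivisors
  have hSdom : IsDomain S := IsLocalization.isDomain_localization p.primeCompl_le_nonZeroDivisors
  let χ : Q → S := fun w => algebraMap A S (AddMonoidAlgebra.single w 1)
  have hχadd : ∀ w w', χ (w + w') = χ w * χ w' := fun w w' => by
    simp only [χ]
    rw [← map_mul, AddMonoidAlgebra.single_mul_single, one_mul]
  have hχ0 : χ 0 = 1 := by simp only [χ]; rw [← AddMonoidAlgebra.one_def, map_one]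
  have hχne : ∀ w, χ w ≠ 0 := fun w => by
    rw [ne_eq, ← map_zero (algebraMap A S)]
    exact fun h => (AddMonoidAlgebra.single_ne_zero).2 one_ne_zero (hinj h)
  have hD : ∀ u : s, ∃ D : Derivation ℂ S S, ∀ v : s,
      IsLocalRing.residue S (D (χ ⟨v, hsQ v.2⟩)) = if u = v then 1 else 0 := by
    intro u
    obtain ⟨D, hD1, hD0⟩ := exists_derivation (Q := Q) (κ := p.ResidueField)
      (fun w hw => by rw [Ideal.algebraMap_residueField_eq_zero]; exact hp w hw)
      (hsQ u.2) (hunit u u.2) (hirr u u.2)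
    obtain ⟨D', hD'⟩ := exists_derivation_lift p D
    refine ⟨D', fun v => ?_⟩
    rw [hD']
    by_cases h : u = v
    · subst h; rw [if_pos rfl]; exact hD1
    · rw [if_neg h]
      exact hD0 _ fun hc => h (Subtype.ext (hdist v v.2 u u.2 hc).symm)
  choose D hD using hD
  intro u hu
  refine eq_zero_of_derivations χ hχadd hχ0 hχne s (fun u hu => hsQ hu) D hD rfl ha hu ?_
  rw [← Localization.AtPrime.map_eq_maximalIdeal]
  exact Ideal.mem_map_of_mem _ (hp ⟨u, hsQ hu⟩ (hunit u hu))

end Derivation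

end Toric

namespace Toric

/-! ### Spectra of monoid algebras and their points. -/

section MonoidScheme

variable {P Q : Type} [AddCommMonoid P] [AddCommMonoid Q]

instance : IsAffine (monoidScheme P) := inferInstanceAs (IsAffine (Spec _))

theorem monoidScheme.isClosedImmersion_map {f : P →+ Q} (hf : Function.Surjective f) :
    IsClosedImmersion (monoidScheme.map f) :=
  IsClosedImmersion.spec_of_surjective _ (mapDomainRingHom_surjective hf)

theorem monoidScheme.map_structure (f : P →+ Q) :
    monoidScheme.map f ≫ monoidScheme.structure P = monoidScheme.structure Q := by
  rw [monoidScheme.map, monoidScheme.structure, monoidScheme.structure]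
  refine (Spec.map_comp _ _).symm.trans ?_
  congr 1
  ext c
  simp

theorem monoidScheme.isOpenImmersion_map {f : P →+ Q} (hf : Function.Injective f) (m : P) {n : Q}
    (hn : f m + n = 0) (h : ∀ q, ∃ (k : ℕ) (p : P), q + k • f m = f p) :
    IsOpenImmersion (monoidScheme.map f) := by
  let _ := (AddMonoidAlgebra.mapDomainRingHom ℂ f).toAlgebra
  have := isLocalization_mapDomain f hf m hn h
  exact IsOpenImmersion.of_isLocalization (S := AddMonoidAlgebra ℂ Q)
    (AddMonoidAlgebra.single m (1 : ℂ))

theorem monoidScheme.range_map {f : P →+ Q} (hf : Function.Injective f) (m : P) {n : Q}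
    (hn : f m + n = 0) (h : ∀ q, ∃ (k : ℕ) (p : P), q + k • f m = f p) :
    Set.range (monoidScheme.map f) = (PrimeSpectrum.basicOpen
      (AddMonoidAlgebra.single m (1 : ℂ)) : Set (PrimeSpectrum (AddMonoidAlgebra ℂ P))) := by
  let _ := (AddMonoidAlgebra.mapDomainRingHom ℂ f).toAlgebra
  have := isLocalization_mapDomain f hf m hn h
  exact PrimeSpectrum.localization_away_comap_range (AddMonoidAlgebra ℂ Q)
    (AddMonoidAlgebra.single m (1 : ℂ))

/-- The point of `Spec ℂ[P]` with values in `A` defined by a ring homomorphism. -/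
noncomputable def specPoint {A : Type} [CommRing A] (x : AddMonoidAlgebra ℂ P →+* A) :
    Spec (CommRingCat.of A) ⟶ monoidScheme P :=
  Spec.map (CommRingCat.ofHom x)

theorem specPoint_surjective {A : Type} [CommRing A]
    (g : Spec (CommRingCat.of A) ⟶ monoidScheme P) : ∃ x, specPoint x = g := by
  obtain ⟨f, hf⟩ := Spec.map_surjective (R := CommRingCat.of (AddMonoidAlgebra ℂ P)) g
  exact ⟨f.hom, hf⟩

theorem specPoint_injective {A : Type} [CommRing A] {x y : AddMonoidAlgebra ℂ P →+* A}
    (h : specPoint x = specPoint y) : x = y :=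
  CommRingCat.hom_ext_iff.1 (Spec.map_injective h)

theorem specPoint_map {A : Type} [CommRing A] (x : AddMonoidAlgebra ℂ Q →+* A) (f : P →+ Q) :
    specPoint x ≫ monoidScheme.map f =
      specPoint (x.comp (AddMonoidAlgebra.mapDomainRingHom ℂ f)) :=
  (Spec.map_comp _ _).symm

theorem map_specPoint {A B : Type} [CommRing A] [CommRing B] (g : A →+* B)
    (x : AddMonoidAlgebra ℂ P →+* A) :
    Spec.map (CommRingCat.ofHom g) ≫ specPoint x = specPoint (g.comp x) :=
  (Spec.map_comp _ _).symm

/-- The closed point of the spectrum of a local ring. -/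
def specClosedPoint (A : Type) [CommRing A] [IsLocalRing A] : ↥(Spec (CommRingCat.of A)) :=
  IsLocalRing.closedPoint A

theorem specPoint_mem_basicOpen {K : Type} [Field K] (x : AddMonoidAlgebra ℂ P →+* K)
    {a : AddMonoidAlgebra ℂ P} (ha : x a ≠ 0) : specPoint x (specClosedPoint K) ∈
      (PrimeSpectrum.basicOpen a : Set (PrimeSpectrum (AddMonoidAlgebra ℂ P))) := by
  intro h
  change x a ∈ IsLocalRing.maximalIdeal K at h
  rw [IsLocalRing.maximalIdeal_eq_bot] at h
  exact ha h

/-- A homomorphism from a monoid algebra to `K` which maps scalars and monomials to the injective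
image of `R` comes from a homomorphism to `R`. -/
theorem exists_lift_ringHom {R K : Type} [CommRing R] [CommRing K] [Algebra R K]
    (hinj : Function.Injective (algebraMap R K)) (x : AddMonoidAlgebra ℂ P →+* K)
    (hc : ∀ c : ℂ, x (algebraMap ℂ _ c) ∈ (algebraMap R K).range)
    (hx : ∀ p : P, x (AddMonoidAlgebra.single p 1) ∈ (algebraMap R K).range) :
    ∃ y : AddMonoidAlgebra ℂ P →+* R, (algebraMap R K).comp y = x := by
  have h : ∀ a, x a ∈ (algebraMap R K).range := by
    intro a
    induction a using AddMonoidAlgebra.induction_linear with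
    | zero => rw [map_zero]; exact zero_mem _
    | add a b ha hb => rw [map_add]; exact add_mem ha hb
    | single p c =>
      have : (AddMonoidAlgebra.single p c : AddMonoidAlgebra ℂ P) =
          algebraMap ℂ _ c * AddMonoidAlgebra.single p 1 := by
        simp [AddMonoidAlgebra.single_mul_single]
      rw [this, map_mul]
      exact mul_mem (hc c) (hx p)
  let e : R ≃+* (algebraMap R K).range :=
    RingEquiv.ofBijective (algebraMap R K).rangeRestrict
      ⟨fun a b hab => hinj (congrArg Subtype.val hab), (algebraMap R K).rangeRestrict_surjective⟩
  refine ⟨e.symm.toRingHom.comp (x.codRestrict _ h), RingHom.ext fun a => ?_⟩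
  have := congrArg Subtype.val (e.apply_symm_apply ⟨x a, h a⟩)
  exact this

end MonoidScheme

/-! ### Charts of a toric variety. -/

namespace Fan

variable {N : Type} [AddCommGroup N] {Δ : Fan N} {ρ : PointedCone ℝ (RealSpan N)}

theorem exists_chart (x : Δ.toricVariety) : ∃ (σ : Δ.cones) (y : affineToric σ.1),
    Δ.chart σ y = x :=
  Scheme.IsLocallyDirected.ι_jointly_surjective Δ.diagram x

theorem chart_map_apply {σ τ : Δ.cones} (h : σ.1 ≤ τ.1) (x : affineToric σ.1) :
    Δ.chart τ (affineToric.map h x) = Δ.chart σ x := by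
  rw [← Scheme.Hom.comp_apply, Δ.map_chart]

/-- Two points of charts are glued only if both come from the chart of a cone κ below the two cones;
such a κ lies in their intersection. -/
theorem mem_range_chart_inf {σ τ : Δ.cones} {x : Δ.toricVariety} (hσ : x ∈ Set.range (Δ.chart σ))
    (hτ : x ∈ Set.range (Δ.chart τ)) :
    x ∈ Set.range (Δ.chart ⟨σ.1 ⊓ τ.1, Δ.inf_mem σ.2 τ.2⟩) := by
  obtain ⟨y, rfl⟩ := hσ
  obtain ⟨z, hz⟩ := hτ
  obtain ⟨κ, f, g, w, hw, -⟩ := (Scheme.IsLocallyDirected.ι_eq_ι_iff Δ.diagram).1 hz.symm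
  have hκ : κ.1 ≤ σ.1 ⊓ τ.1 := le_inf (leOfHom f) (leOfHom g)
  have hw' : affineToric.map (leOfHom f) w = y := hw
  exact ⟨affineToric.map hκ w, (chart_map_apply (τ := ⟨_, Δ.inf_mem σ.2 τ.2⟩) hκ w).trans
    ((chart_map_apply (leOfHom f) w).symm.trans (congrArg _ hw'))⟩

theorem range_chart_mono {σ τ : Δ.cones} (h : σ.1 ≤ τ.1) :
    Set.range (Δ.chart σ) ⊆ Set.range (Δ.chart τ) := by
  rintro _ ⟨x, rfl⟩
  rw [← Δ.map_chart h, Scheme.Hom.comp_apply]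
  exact ⟨_, rfl⟩

theorem chart_toCone (h : Δ.Subdivides ρ) (σ : Δ.cones) :
    Δ.chart σ ≫ toCone h = affineToric.map (h.le σ.2) :=
  colimit.ι_desc _ _

theorem chart_toFan {Δ' : Fan N} (h : IsSubdivision Δ' Δ) (σ : Δ'.cones) :
    Δ'.chart σ ≫ toFan h = ofLE (h.2 σ.1 σ.2) :=
  colimit.ι_desc _ _

theorem hom_ext {Y : Scheme.{0}} {f g : Δ.toricVariety ⟶ Y}
    (h : ∀ σ, Δ.chart σ ≫ f = Δ.chart σ ≫ g) : f = g :=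
  colimit.hom_ext h

theorem toFan_toCone {Δ' : Fan N} (h' : IsSubdivision Δ' Δ) (h : Δ.Subdivides ρ)
    (h'' : Δ'.Subdivides ρ) : toFan h' ≫ toCone h = toCone h'' := by
  refine hom_ext fun σ => ?_
  obtain ⟨τ, hτ, hστ⟩ := h'.2 σ.1 σ.2
  rw [← Category.assoc, chart_toFan, ofLE_eq _ (τ := ⟨τ, hτ⟩) hστ, Category.assoc, chart_toCone,
    chart_toCone, affineToric.map_comp]

/-- A morphism from the spectrum of a local ring factors through a chart as soon as the image of
the closed point is contained in it. -/
theorem exists_specPoint_chart {A : Type} [CommRing A] [IsLocalRing A]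
    (g : Spec (CommRingCat.of A) ⟶ Δ.toricVariety) (σ : Δ.cones)
    (h : g (specClosedPoint A) ∈ Set.range (Δ.chart σ)) :
    ∃ x : AddMonoidAlgebra ℂ (dualMonoid σ.1) →+* A, specPoint x ≫ Δ.chart σ = g := by
  have hr : Set.range g ⊆ Set.range (Δ.chart σ) := by
    rintro _ ⟨y, rfl⟩
    exact ((IsLocalRing.specializes_closedPoint (R := A) y).map g.continuous).mem_open
      (Δ.chart σ).isOpenEmbedding.isOpen_range h
  obtain ⟨x, hx⟩ := specPoint_surjective (IsOpenImmersion.lift (Δ.chart σ) g hr)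
  exact ⟨x, by rw [hx, IsOpenImmersion.lift_fac]⟩

/-- Serves to shrink charts: wherever a monomial of σ^∨ is nonzero, σ may be replaced by the face on
which its exponent vanishes. -/
theorem mem_range_chart_faceCone {σ : Δ.cones} {w : DualLattice N} (hw : w ∈ dualMonoid σ.1)
    {y : affineToric σ.1} (hy : y ∈ (PrimeSpectrum.basicOpen
      (AddMonoidAlgebra.single (⟨w, hw⟩ : dualMonoid σ.1) (1 : ℂ)) : Set (PrimeSpectrum _))) :
    Δ.chart σ y ∈ Set.range
      (Δ.chart ⟨faceCone σ.1 w, Δ.face_mem _ σ.2 _ (isFace_faceCone hw)⟩) := by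
  rw [← affineToric.range_map (Δ.isRational _ σ.2) (faceCone_le σ.1 w) hw fun _ => Iff.rfl] at hy
  obtain ⟨z, rfl⟩ := hy
  exact ⟨z, (chart_map_apply (σ := ⟨faceCone σ.1 w, Δ.face_mem _ σ.2 _ (isFace_faceCone hw)⟩) (τ := σ)
    (faceCone_le σ.1 w) z).symm⟩

instance : Finite Δ.cones := Δ.finite

/-- The charts form an affine open cover. -/
noncomputable def chartCover (Δ : Fan N) : Δ.toricVariety.OpenCover :=
  Scheme.IsLocallyDirected.openCover Δ.diagram

end Fan

end Toric

namespace Toric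

/-! ### Saturated sublattices as direct summands. -/

section Splitting

variable {N : Type} [AddCommGroup N]

/-- The sublattice `τ^⊥ ∩ M`. -/
noncomputable def perpLattice (τ : PointedCone ℝ (RealSpan N)) :
    Submodule ℤ (DualLattice N) where
  carrier := {m | ∀ x ∈ τ, pairing N (1 ⊗ₜ m) x = 0}
  add_mem' {a b} ha hb x hx := by
    rw [TensorProduct.tmul_add, map_add, LinearMap.add_apply, ha x hx, hb x hx, add_zero]
  zero_mem' x _ := by simp
  smul_mem' c m hm x hx := by
    rw [← TensorProduct.smul_tmul, ← mul_one (c • (1 : ℝ)), ← smul_eq_mul, smul_assoc,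
      ← TensorProduct.smul_tmul', map_zsmul, LinearMap.smul_apply, smul_eq_mul, mul_one, hm x hx,
      smul_zero]

theorem mem_perpLattice {τ : PointedCone ℝ (RealSpan N)} {m : DualLattice N} :
    m ∈ perpLattice τ ↔ ∀ x ∈ τ, pairing N (1 ⊗ₜ m) x = 0 := Iff.rfl

theorem perpLattice_le_dualMonoid {τ : PointedCone ℝ (RealSpan N)} {m : DualLattice N}
    (hm : m ∈ perpLattice τ) : m ∈ dualMonoid τ := fun x hx => (hm x hx).ge

theorem pairing_zsmul (k : ℤ) (m : DualLattice N) (x : RealSpan N) :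
    pairing N (1 ⊗ₜ (k • m)) x = k * pairing N (1 ⊗ₜ m) x := by
  rw [TensorProduct.tmul_smul, map_zsmul, LinearMap.smul_apply, zsmul_eq_mul]

/-- A saturated sublattice is a direct summand. -/
theorem exists_projection_of_saturated [Module.Finite ℤ N] {K : Submodule ℤ N}
    (hK : ∀ (k : ℕ) (n : N), 0 < k → k • n ∈ K → n ∈ K) :
    ∃ p : N →ₗ[ℤ] K, ∀ n : K, p n = n := by
  have htf : Module.IsTorsionFree ℤ (N ⧸ K) := by
    refine Module.isTorsionFree_iff_smul_eq_zero.2 fun k m h => ?_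
    obtain ⟨m, rfl⟩ := Submodule.mkQ_surjective _ m
    rw [← map_smul, Submodule.mkQ_apply, Submodule.Quotient.mk_eq_zero] at h
    refine or_iff_not_imp_left.2 fun hk => ?_
    rw [Submodule.mkQ_apply, Submodule.Quotient.mk_eq_zero]
    refine hK k.natAbs m (Int.natAbs_pos.2 hk) ?_
    obtain ⟨j, rfl | rfl⟩ := k.eq_nat_or_neg
    · simpa using h
    · simpa using h
  have : Module.Free ℤ (N ⧸ K) := inferInstance
  obtain ⟨s, hs⟩ := Module.projective_lifting_property K.mkQ LinearMap.id
    (Submodule.mkQ_surjective _)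
  have hmem : ∀ m, ((LinearMap.id : N →ₗ[ℤ] N) - s ∘ₗ K.mkQ) m ∈ K := by
    intro m
    rw [← Submodule.Quotient.mk_eq_zero, ← Submodule.mkQ_apply, LinearMap.sub_apply, map_sub]
    have := LinearMap.congr_fun hs (K.mkQ m)
    simpa [sub_eq_zero] using this.symm
  refine ⟨LinearMap.codRestrict _ _ hmem, fun m => Subtype.ext ?_⟩
  simp [(Submodule.Quotient.mk_eq_zero K).2 m.2]

theorem exists_projection_perpLattice [Module.Finite ℤ N] [Module.Free ℤ N]
    (τ : PointedCone ℝ (RealSpan N)) :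
    ∃ p : DualLattice N →ₗ[ℤ] perpLattice τ, ∀ m : perpLattice τ, p m = m := by
  refine exists_projection_of_saturated fun k m hk hm x hx => ?_
  have := hm x hx
  rw [← natCast_zsmul, pairing_zsmul] at this
  exact (mul_eq_zero.1 this).resolve_left (by exact_mod_cast hk.ne')

end Splitting

/-! ### Properness of toric morphisms by the valuative criterion. -/

namespace Fan

variable {N : Type} [AddCommGroup N] {Δ : Fan N} {ρ : PointedCone ℝ (RealSpan N)}

/-- A point of `Z_Δ` with values in a field lies in the orbit of a cone `τ`: it is given by a
homomorphism which is nonzero precisely on the monomials of `τ^⊥`. -/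
theorem exists_specPoint_field {K : Type} [Field K]
    (g : Spec (CommRingCat.of K) ⟶ Δ.toricVariety) :
    ∃ (τ : Δ.cones) (x : AddMonoidAlgebra ℂ (dualMonoid τ.1) →+* K),
      specPoint x ≫ Δ.chart τ = g ∧ ∀ w : dualMonoid τ.1,
        x (AddMonoidAlgebra.single w 1) ≠ 0 ↔ (w : DualLattice N) ∈ perpLattice τ.1 := by
  let pt := specClosedPoint K
  obtain ⟨σ, y, hy⟩ := exists_chart (g pt)
  -- The orbit is that of the smallest cone whose chart contains the point: a nonvanishing monomial
  -- outside τ^⊥ would place it in the chart of a proper face.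
  obtain ⟨τ, hτ, hmin⟩ := Set.Finite.exists_minimal
    (s := {τ : Δ.cones | g pt ∈ Set.range (Δ.chart τ)}) (Set.toFinite _) ⟨σ, y, hy⟩
  obtain ⟨x, hx⟩ := exists_specPoint_chart g τ hτ
  refine ⟨τ, x, hx, fun w => ⟨fun hw => ?_, fun hw => ?_⟩⟩
  · let τ' : Δ.cones := ⟨faceCone τ.1 w, Δ.face_mem _ τ.2 _ (isFace_faceCone w.2)⟩
    have h2 : g pt ∈ Set.range (Δ.chart τ') := by
      rw [← hx, Scheme.Hom.comp_apply]
      exact mem_range_chart_faceCone w.2 (specPoint_mem_basicOpen x hw)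
    have h3 : τ.1 ≤ τ'.1 := hmin h2 (faceCone_le τ.1 w)
    exact fun v hv => (mem_faceCone.1 (h3 hv)).2
  · have hn : -(w : DualLattice N) ∈ dualMonoid τ.1 := perpLattice_le_dualMonoid (neg_mem hw)
    have : x (AddMonoidAlgebra.single w 1) * x (AddMonoidAlgebra.single ⟨_, hn⟩ 1) = 1 := by
      rw [← map_mul, AddMonoidAlgebra.single_mul_single]
      convert map_one x using 2
      rw [AddMonoidAlgebra.one_def]
      congr 1
      · ext1; simp
      · simp
    exact left_ne_zero_of_mul_eq_one this

/-- The generic point gives a cone τ, a vector n in its interior and a character X on τ^⊥ ∩ M.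
Ordering M first by the value at n, then by the valuation of X, gives a total preorder that is
nonnegative on ρ^∨, hence on σ^∨ for some cone σ of the fan. Then n ∈ σ, so τ ⊆ σ, and the point
extends to an R-valued point of Z_σ. -/
theorem valuativeCriterion_existence [Module.Finite ℤ N] [Module.Free ℤ N] (hρ : IsRational ρ)
    (h : Δ.Subdivides ρ) : ValuativeCriterion.Existence (toCone h) := by
  intro S
  obtain ⟨τ, x, hx, hxτ⟩ := exists_specPoint_field S.i₁
  obtain ⟨z, hz⟩ := specPoint_surjective S.i₂
  have hinj : Function.Injective (algebraMap S.R S.K) := IsFractionRing.injective _ _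
  have hcomm : (algebraMap S.R S.K).comp z = x.comp (AddMonoidAlgebra.mapDomainRingHom ℂ
      (AddSubmonoid.inclusion (dualMonoid_anti (h.le τ.2)))) := by
    apply specPoint_injective
    rw [← map_specPoint, ← specPoint_map, hz, ← S.commSq.w, ← hx, Category.assoc, chart_toCone]
    rfl
  obtain ⟨n, hnτ, hn⟩ := (Δ.isRational _ τ.2).exists_interior
  obtain ⟨p, hp⟩ := exists_projection_perpLattice τ.1
  -- The character of τ^⊥ ∩ M is extended to all of M through a projection; it agrees with the point
  -- on the exponents of τ^∨ that vanish at n.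
  let X : DualLattice N → S.K := fun w =>
    x (AddMonoidAlgebra.single ⟨p w, perpLattice_le_dualMonoid (p w).2⟩ 1)
  have hXadd : ∀ v w, X (v + w) = X v * X w := by
    intro v w
    rw [← map_mul, AddMonoidAlgebra.single_mul_single, one_mul]
    refine congrArg (fun v => x (AddMonoidAlgebra.single v 1)) (Subtype.ext ?_)
    simp
  have hX0 : X 0 = 1 := by
    refine Eq.trans ?_ (map_one x)
    rw [AddMonoidAlgebra.one_def]
    refine congrArg (fun v => x (AddMonoidAlgebra.single v 1)) (Subtype.ext ?_)
    simp
  have hXmem : ∀ w : dualMonoid τ.1, (w : DualLattice N) n = 0 →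
      x (AddMonoidAlgebra.single w 1) = X w := by
    intro w hw
    have := congrArg Subtype.val (hp ⟨w, hn w w.2 hw⟩)
    dsimp only [X]
    exact congrArg (fun v => x (AddMonoidAlgebra.single v 1)) (Subtype.ext this.symm)
  -- The nonnegative part of the lexicographic preorder. It is total because R is a valuation ring:
  -- X(w) or its inverse lies in R.
  let G : AddSubmonoid (DualLattice N) :=
    { carrier := {w | 0 ≤ w n ∧ (w n = 0 → X w ∈ (algebraMap S.R S.K).range)}
      zero_mem' := ⟨by simp, fun _ => by rw [hX0]; exact one_mem _⟩
      add_mem' := by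
        rintro v w ⟨hv, hv'⟩ ⟨hw, hw'⟩
        refine ⟨by rw [LinearMap.add_apply]; omega, fun h0 => ?_⟩
        rw [LinearMap.add_apply] at h0
        rw [hXadd]
        exact mul_mem (hv' (by omega)) (hw' (by omega)) }
  obtain ⟨σ, hσ, hσG⟩ := h.exists_dualMonoid_le hρ G (by
    intro w
    rcases lt_trichotomy (w n) 0 with h0 | h0 | h0
    · exact Or.inr ⟨by rw [LinearMap.neg_apply]; omega, fun h1 => by
        rw [LinearMap.neg_apply] at h1; omega⟩
    · have hunit : X w * X (-w) = 1 := by rw [← hXadd, add_neg_cancel, hX0]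
      rcases (ValuationRing.isInteger_or_isInteger S.R (X w)) with h1 | h1
      · exact Or.inl ⟨h0.ge, fun _ => h1⟩
      · refine Or.inr ⟨by rw [LinearMap.neg_apply]; omega, fun _ => ?_⟩
        rw [← eq_inv_of_mul_eq_one_right hunit] at h1
        exact h1
    · exact Or.inl ⟨h0.le, fun h1 => by omega⟩) (by
    intro w hw
    have hwτ : w ∈ dualMonoid τ.1 := dualMonoid_anti (h.le τ.2) hw
    refine ⟨nonneg_of_mem_dualMonoid hwτ hnτ, fun h0 => ?_⟩
    rw [← hXmem ⟨w, hwτ⟩ h0]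
    refine ⟨z (AddMonoidAlgebra.single ⟨w, hw⟩ 1), ?_⟩
    have := RingHom.congr_fun hcomm (AddMonoidAlgebra.single ⟨w, hw⟩ 1)
    simp only [RingHom.comp_apply, AddMonoidAlgebra.mapDomainRingHom_apply,
      AddMonoidAlgebra.mapDomain_single] at this
    exact this)
  have hnσ : (1 : ℝ) ⊗ₜ[ℤ] n ∈ σ := (Δ.isRational σ hσ).tmul_mem fun m hm => (hσG hm).1
  have hτσ : τ.1 ≤ σ := le_of_interior_mem hσ τ.2 hn hnτ hnσ
  obtain ⟨y, hy⟩ := exists_lift_ringHom hinj (x.comp (AddMonoidAlgebra.mapDomainRingHom ℂ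
      (AddSubmonoid.inclusion (dualMonoid_anti hτσ)))) (by
    intro c
    refine ⟨z (algebraMap ℂ _ c), ?_⟩
    have := RingHom.congr_fun hcomm (algebraMap ℂ _ c)
    simpa [AddMonoidAlgebra.mapDomain_single] using this) (by
    intro w
    have hw := hσG w.2
    have hwτ : (w : DualLattice N) ∈ dualMonoid τ.1 := dualMonoid_anti hτσ w.2
    have he : (x.comp (AddMonoidAlgebra.mapDomainRingHom ℂ
        (AddSubmonoid.inclusion (dualMonoid_anti hτσ)))) (AddMonoidAlgebra.single w 1) =
        x (AddMonoidAlgebra.single ⟨w, hwτ⟩ 1) := by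
      simp [AddMonoidAlgebra.mapDomain_single]
      rfl
    rw [he]
    -- On exponents with w(n) = 0 the preorder gives a value in R; on the others the monomial
    -- vanishes, since the point lies in the orbit of τ.
    by_cases h0 : (w : DualLattice N) n = 0
    · rw [hXmem ⟨w, hwτ⟩ h0]
      exact hw.2 h0
    · have : x (AddMonoidAlgebra.single ⟨w, hwτ⟩ 1) = 0 := by
        by_contra hne
        have h1 := (hxτ ⟨w, hwτ⟩).1 hne _ hnτ
        rw [pairing_tmul] at h1
        exact h0 (by simpa using h1)
      rw [this]
      exact zero_mem _)
  refine ⟨⟨⟨specPoint y ≫ Δ.chart ⟨σ, hσ⟩, ?_, ?_⟩⟩⟩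
  · rw [← Category.assoc, map_specPoint, hy, ← specPoint_map, Category.assoc, ← hx]
    congr 1
    exact Δ.map_chart (τ := ⟨σ, hσ⟩) hτσ
  · rw [Category.assoc, chart_toCone, ← hz, affineToric.map, specPoint_map]
    congr 1
    refine RingHom.ext fun a => hinj ?_
    have h1 := RingHom.congr_fun hcomm a
    have h2 := RingHom.congr_fun hy (AddMonoidAlgebra.mapDomainRingHom ℂ
      (AddSubmonoid.inclusion (dualMonoid_anti (h.le hσ))) a)
    simp only [RingHom.comp_apply] at h1 h2 ⊢
    rw [h1, h2, ← RingHom.comp_apply (AddMonoidAlgebra.mapDomainRingHom ℂ _),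
      ← AddMonoidAlgebra.mapDomainRingHom_comp]
    rfl

/-- The generic point lies in the chart of κ = σ₁ ∩ σ₂, where σ₁ and σ₂ are cones whose charts
receive the two lifts. Since κ^∨ = σ₁^∨ + σ₂^∨ up to positive multiples, a power of the value of
each monomial of κ^∨ lies in R, hence so does the value, R being integrally closed. Both lifts
therefore equal one R-valued point of Z_κ. -/
theorem valuativeCriterion_uniqueness [Module.Finite ℤ N] [Module.Free ℤ N]
    (h : Δ.Subdivides ρ) : ValuativeCriterion.Uniqueness (toCone h) := by
  intro S
  constructor
  rintro ⟨l₁, hl₁, -⟩ ⟨l₂, hl₂, -⟩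
  congr 1
  have hinj : Function.Injective (algebraMap S.R S.K) := IsFractionRing.injective _ _
  obtain ⟨σ₁, a₁, ha₁⟩ := exists_chart (l₁ (specClosedPoint S.R))
  obtain ⟨σ₂, a₂, ha₂⟩ := exists_chart (l₂ (specClosedPoint S.R))
  obtain ⟨y₁, hy₁⟩ := exists_specPoint_chart l₁ σ₁ ⟨a₁, ha₁⟩
  obtain ⟨y₂, hy₂⟩ := exists_specPoint_chart l₂ σ₂ ⟨a₂, ha₂⟩
  let κ : Δ.cones := ⟨σ₁.1 ⊓ σ₂.1, Δ.inf_mem σ₁.2 σ₂.2⟩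
  have hκ₁ : κ.1 ≤ σ₁.1 := inf_le_left
  have hκ₂ : κ.1 ≤ σ₂.1 := inf_le_right
  have e₁ : specPoint ((algebraMap S.R S.K).comp y₁) ≫ Δ.chart σ₁ = S.i₁ := by
    rw [← map_specPoint, Category.assoc, hy₁, hl₁]
  have e₂ : specPoint ((algebraMap S.R S.K).comp y₂) ≫ Δ.chart σ₂ = S.i₁ := by
    rw [← map_specPoint, Category.assoc, hy₂, hl₂]
  obtain ⟨x, hx⟩ := exists_specPoint_chart S.i₁ κ (mem_range_chart_inf
    ⟨specPoint ((algebraMap S.R S.K).comp y₁) (specClosedPoint S.K), by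
      rw [← e₁, Scheme.Hom.comp_apply]⟩
    ⟨specPoint ((algebraMap S.R S.K).comp y₂) (specClosedPoint S.K), by
      rw [← e₂, Scheme.Hom.comp_apply]⟩)
  have key : ∀ (σ : Δ.cones) (hκ : κ.1 ≤ σ.1) (y : AddMonoidAlgebra ℂ (dualMonoid σ.1) →+* S.R),
      specPoint ((algebraMap S.R S.K).comp y) ≫ Δ.chart σ = S.i₁ →
      (algebraMap S.R S.K).comp y = x.comp (AddMonoidAlgebra.mapDomainRingHom ℂ
        (AddSubmonoid.inclusion (dualMonoid_anti hκ))) := by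
    intro σ hκ y e
    apply specPoint_injective
    rw [← specPoint_map, ← cancel_mono (Δ.chart σ), e, Category.assoc, ← hx]
    congr 1
    exact (Δ.map_chart hκ).symm
  have k₁ := key σ₁ hκ₁ y₁ e₁
  have k₂ := key σ₂ hκ₂ y₂ e₂
  have hmono : ∀ (σ : Δ.cones) (hκ : κ.1 ≤ σ.1)
      (y : AddMonoidAlgebra ℂ (dualMonoid σ.1) →+* S.R),
      (algebraMap S.R S.K).comp y = x.comp (AddMonoidAlgebra.mapDomainRingHom ℂ
        (AddSubmonoid.inclusion (dualMonoid_anti hκ))) → ∀ w (hw : w ∈ dualMonoid σ.1),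
      x (AddMonoidAlgebra.single ⟨w, dualMonoid_anti hκ hw⟩ 1) ∈ (algebraMap S.R S.K).range := by
    intro σ hκ y hk w hw
    refine ⟨y (AddMonoidAlgebra.single ⟨w, hw⟩ 1), ?_⟩
    have := RingHom.congr_fun hk (AddMonoidAlgebra.single ⟨w, hw⟩ 1)
    simp [AddMonoidAlgebra.mapDomain_single] at this
    exact this
  obtain ⟨y, hy⟩ := exists_lift_ringHom hinj x (by
    intro c
    refine ⟨y₁ (algebraMap ℂ _ c), ?_⟩
    have := RingHom.congr_fun k₁ (algebraMap ℂ _ c)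
    simpa [AddMonoidAlgebra.mapDomain_single] using this) (by
    intro w
    obtain ⟨k, hk, hkw⟩ := exists_nsmul_mem_sup_of_mem_inf (Δ.isRational _ σ₁.2)
      (Δ.isRational _ σ₂.2) w.2
    obtain ⟨a, ha, b, hb, hab⟩ := AddSubmonoid.mem_sup.1 hkw
    have hpow : x (AddMonoidAlgebra.single w 1) ^ k ∈ (algebraMap S.R S.K).range := by
      have : x (AddMonoidAlgebra.single w 1) ^ k =
          x (AddMonoidAlgebra.single ⟨a, dualMonoid_anti hκ₁ ha⟩ 1) *
            x (AddMonoidAlgebra.single ⟨b, dualMonoid_anti hκ₂ hb⟩ 1) := by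
        rw [← map_pow, ← map_mul, AddMonoidAlgebra.single_mul_single, AddMonoidAlgebra.single_pow,
          one_pow, one_mul]
        congr 2
        ext1
        exact hab.symm
      rw [this]
      exact mul_mem (hmono σ₁ hκ₁ y₁ k₁ a ha) (hmono σ₂ hκ₂ y₂ k₂ b hb)
    obtain ⟨r, hr⟩ := hpow
    obtain ⟨t, ht⟩ := IsIntegrallyClosed.exists_algebraMap_eq_of_isIntegral_pow (R := S.R) hk
      (hr ▸ isIntegral_algebraMap)
    exact ⟨t, ht⟩)
  have fin : ∀ (σ : Δ.cones) (hκ : κ.1 ≤ σ.1)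
      (y' : AddMonoidAlgebra ℂ (dualMonoid σ.1) →+* S.R),
      (algebraMap S.R S.K).comp y' = x.comp (AddMonoidAlgebra.mapDomainRingHom ℂ
        (AddSubmonoid.inclusion (dualMonoid_anti hκ))) →
      specPoint y' ≫ Δ.chart σ = specPoint y ≫ Δ.chart κ := by
    intro σ hκ y' hk
    rw [← Δ.map_chart hκ, ← Category.assoc, affineToric.map, specPoint_map]
    congr 2
    refine RingHom.ext fun a => hinj ?_
    have h1 := RingHom.congr_fun hk a
    rw [← hy] at h1
    exact h1
  rw [← hy₁, ← hy₂, fin σ₁ hκ₁ y₁ k₁, fin σ₂ hκ₂ y₂ k₂]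

theorem affineToric.locallyOfFiniteType_map [Module.Finite ℤ N] [Module.Free ℤ N]
    {σ τ : PointedCone ℝ (RealSpan N)} (hσ : IsRational σ) (h : σ ≤ τ) :
    LocallyOfFiniteType (affineToric.map h) := by
  have h1 : Algebra.FiniteType ℂ (AddMonoidAlgebra ℂ (dualMonoid σ)) := by
    have := (AddMonoid.fg_iff_addSubmonoid_fg _).2 hσ.fg_dualMonoid
    infer_instance
  have h2 : LocallyOfFiniteType (affineToric.map h ≫ monoidScheme.structure (dualMonoid τ)) := by
    rw [affineToric.map, monoidScheme.map_structure, monoidScheme.structure]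
    exact (HasRingHomProperty.Spec_iff (P := @LocallyOfFiniteType)).2
      (RingHom.finiteType_algebraMap.2 h1)
  exact locallyOfFiniteType_of_comp _ (monoidScheme.structure (dualMonoid τ))

theorem isProper_toCone [Module.Finite ℤ N] [Module.Free ℤ N] (hρ : IsRational ρ)
    (h : Δ.Subdivides ρ) : IsProper (toCone h) := by
  have : LocallyOfFiniteType (toCone h) := by
    have : IsZariskiLocalAtSource @LocallyOfFiniteType.{0} :=
      HasRingHomProperty.instIsZariskiLocalAtSource (P := @LocallyOfFiniteType.{0})
    refine (IsZariskiLocalAtSource.iff_of_openCover (P := @LocallyOfFiniteType.{0})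
      Δ.chartCover).2 fun σ => ?_
    have := affineToric.locallyOfFiniteType_map (Δ.isRational _ σ.2) (h.le σ.2)
    rw [← chart_toCone h σ] at this
    exact this
  have : CompactSpace Δ.toricVariety := by
    refine ⟨?_⟩
    have : (Set.univ : Set Δ.toricVariety) = ⋃ σ, Set.range (Δ.chart σ) := by
      refine (Set.eq_univ_of_forall fun x => ?_).symm
      obtain ⟨σ, y, hy⟩ := exists_chart x
      exact Set.mem_iUnion.2 ⟨σ, y, hy⟩
    rw [this]
    exact isCompact_iUnion fun σ => isCompact_range (Δ.chart σ).continuous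
  have : QuasiCompact (toCone h) := inferInstance
  have : IsNoetherianRing (AddMonoidAlgebra ℂ (dualMonoid ρ)) := by
    have := (AddMonoid.fg_iff_addSubmonoid_fg _).2 hρ.fg_dualMonoid
    exact Algebra.FiniteType.isNoetherianRing ℂ _
  have : IsLocallyNoetherian (affineToric ρ) :=
    inferInstanceAs (IsLocallyNoetherian (Spec (CommRingCat.of (AddMonoidAlgebra ℂ _))))
  have : IsLocallyNoetherian Δ.toricVariety := LocallyOfFiniteType.isLocallyNoetherian (toCone h)
  have : QuasiSeparated (toCone h) := inferInstance
  exact IsProper.of_valuativeCriterion _ (ValuativeCriterion.iff.2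
    ⟨valuativeCriterion_existence hρ h, valuativeCriterion_uniqueness h⟩)

end Fan

end Toric

namespace Toric

/-! ### Reduced closed subschemes and strict transforms. -/

section SchemeLemmas

variable {X Y : Scheme.{0}}

theorem isIso_morphismRestrict_of_range {U : Scheme.{0}} (f : X ⟶ Y) (i : U ⟶ X)
    [IsOpenImmersion i] [IsOpenImmersion (i ≫ f)] (V : Y.Opens)
    (h : Set.range i = f ⁻¹' (V : Set Y)) (h' : Set.range (i ≫ f) = (V : Set Y)) :
    IsIso (f ∣_ V) := by
  let e := IsOpenImmersion.isoOfRangeEq i (f ⁻¹ᵁ V).ι (by rw [h, Scheme.Opens.range_ι]; rfl)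
  let e' := IsOpenImmersion.isoOfRangeEq (i ≫ f) V.ι (by rw [h', Scheme.Opens.range_ι])
  have : f ∣_ V = e.inv ≫ e'.hom := by
    rw [← cancel_mono V.ι, morphismRestrict_ι, Category.assoc,
      IsOpenImmersion.isoOfRangeEq_hom_fac, ← Category.assoc,
      IsOpenImmersion.isoOfRangeEq_inv_fac]
  rw [this]
  infer_instance

theorem ker_eq_vanishingIdeal [IsReduced X] (f : X ⟶ Y) :
    f.ker = Scheme.IdealSheafData.vanishingIdeal (.closure (Set.range f)) := by
  rw [← Scheme.IdealSheafData.map_bot, ← Scheme.nilradical_eq_bot,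
    ← Scheme.IdealSheafData.vanishingIdeal_top, Scheme.IdealSheafData.map_vanishingIdeal]
  congr
  exact Set.image_univ

instance isReduced_subscheme_vanishingIdeal (Z : TopologicalSpace.Closeds X) :
    IsReduced (Scheme.IdealSheafData.vanishingIdeal Z).subscheme := by
  let I := Scheme.IdealSheafData.vanishingIdeal Z
  have hred : ∀ U : X.affineOpens, IsReduced (Spec (.of (Γ(X, U) ⧸ I.ideal U))) := by
    intro U
    have : _root_.IsReduced (Γ(X, U) ⧸ I.ideal U) := by
      rw [← Ideal.isRadical_iff_quotient_reduced]
      exact PrimeSpectrum.isRadical_vanishingIdeal _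
    infer_instance
  apply +allowSynthFailures isReduced_of_isReduced_stalk
  intro x
  let 𝒰 := I.subschemeCover.openCover
  obtain ⟨y, hy⟩ := 𝒰.covers x
  have : IsReduced (𝒰.X (𝒰.idx x)) := hred _
  rw [← hy]
  exact isReduced_of_injective ((𝒰.f (𝒰.idx x)).stalkMap y).hom
    (asIso ((𝒰.f (𝒰.idx x)).stalkMap y)).commRingCatIsoToRingEquiv.injective

/-- The reduced closed subscheme with support `Z` is, over an open subscheme `S` of `X`, any reduced
closed subscheme `A` of `S` with support `Z ∩ S`. -/
theorem exists_isOpenImmersion_subscheme (Z : TopologicalSpace.Closeds X) {A S : Scheme.{0}}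
    [IsReduced A] (c : A ⟶ S) [IsClosedImmersion c] (u : S ⟶ X) [IsOpenImmersion u]
    (hr : Set.range c = u ⁻¹' (Z : Set X)) :
    ∃ j : A ⟶ (Scheme.IdealSheafData.vanishingIdeal Z).subscheme, IsOpenImmersion j ∧
      j ≫ (Scheme.IdealSheafData.vanishingIdeal Z).subschemeι = c ≫ u ∧
      Set.range j =
        (Scheme.IdealSheafData.vanishingIdeal Z).subschemeι ⁻¹' (Set.range u) := by
  let ι := (Scheme.IdealSheafData.vanishingIdeal Z).subschemeι
  have hι : Set.range ι = Z := by simp [ι]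
  have : IsReduced (pullback ι u) := isReduced_of_isOpenImmersion (pullback.fst ι u)
  have hrange : Set.range (pullback.snd ι u) = Set.range c := by
    rw [hr, ← hι]
    exact Scheme.Pullback.range_snd ι u
  -- Both are closed immersions of reduced schemes with the same image, hence they have the same
  -- ideal.
  have hker : c.ker = (pullback.snd ι u).ker := by
    rw [ker_eq_vanishingIdeal, ker_eq_vanishingIdeal, hrange]
  let l := IsClosedImmersion.lift (pullback.snd ι u) c hker.ge
  have : IsIso l := IsClosedImmersion.isIso_lift _ _ hker.symm
  refine ⟨l ≫ pullback.fst ι u, inferInstance, ?_, ?_⟩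
  · change (l ≫ pullback.fst ι u) ≫ ι = c ≫ u
    rw [Category.assoc, pullback.condition, ← Category.assoc, IsClosedImmersion.lift_fac]
  · have : Set.range (l ≫ pullback.fst ι u) = Set.range (pullback.fst ι u) := by
      rw [Scheme.Hom.comp_base, TopCat.coe_comp, Set.range_comp, l.surjective.range_eq,
        Set.image_univ]
    rw [this]
    exact Scheme.Pullback.range_fst ι u

/-- Over an open set where f is an isomorphism, specializations lift: f η ⤳ f x gives η ⤳ x. So the
preimage of V over the isomorphism locus consists of specializations of η. -/
theorem strictTransformSet_eq_closure (f : X ⟶ Y) (V : Set Y) (η : X) (hη : f η ∈ isoLocus f)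
    (hηV : f η ∈ V) (hV : ∀ y ∈ V, f η ⤳ y) :
    (strictTransformSet f V : Set X) = closure {η} := by
  change closure _ = _
  apply subset_antisymm
  · refine closure_minimal ?_ isClosed_closure
    rintro x ⟨hxV, hxU⟩
    obtain ⟨U, hU, hxU⟩ := TopologicalSpace.Opens.mem_sSup.1 hxU
    have hU' : IsIso (f ∣_ U) := hU
    have hs : f η ⤳ f x := hV _ hxV
    have hηU : f η ∈ U := hs.mem_open U.2 hxU
    let x' : ↥(f ⁻¹ᵁ U).toScheme := ⟨x, hxU⟩
    let η' : ↥(f ⁻¹ᵁ U).toScheme := ⟨η, hηU⟩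
    have hopen : IsOpenImmersion ((f ⁻¹ᵁ U).ι ≫ f) := by
      rw [← morphismRestrict_ι]
      infer_instance
    have h1 : η' ⤳ x' :=
      ((f ⁻¹ᵁ U).ι ≫ f).isOpenEmbedding.isInducing.specializes_iff.1 hs
    exact specializes_iff_mem_closure.1 (h1.map (f ⁻¹ᵁ U).ι.continuous)
  · exact closure_mono (Set.singleton_subset_iff.2 ⟨hηV, hη⟩)

theorem exists_lift_of_mapsTo {V : Scheme.{0}} [IsReduced V] [IsReduced X] (i : V ⟶ Y)
    [IsClosedImmersion i] (g : X ⟶ Y) (h : ∀ x, g x ∈ Set.range i) : ∃ r : X ⟶ V, r ≫ i = g := by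
  refine ⟨IsClosedImmersion.lift i g ?_, IsClosedImmersion.lift_fac _ _ _⟩
  rw [ker_eq_vanishingIdeal, ker_eq_vanishingIdeal]
  refine Scheme.IdealSheafData.vanishingIdeal_antimono ?_
  exact closure_mono (Set.range_subset_iff.2 h)

end SchemeLemmas

end Toric

namespace Toric

/-! ### Generic points and invertible monomials. -/

section GenericPoint

variable {P Q : Type} [AddCommMonoid P] [AddCommMonoid Q]

/-- The generic point of `Spec ℂ[P]`. -/
noncomputable def genericPt (P : Type) [AddCommMonoid P] [IsDomain (AddMonoidAlgebra ℂ P)] : monoidScheme P :=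
  (⟨⊥, Ideal.isPrime_bot⟩ : PrimeSpectrum (AddMonoidAlgebra ℂ P))

theorem genericPt_specializes [IsDomain (AddMonoidAlgebra ℂ P)] (x : monoidScheme P) :
    genericPt P ⤳ x :=
  (PrimeSpectrum.le_iff_specializes (⟨⊥, Ideal.isPrime_bot⟩ : PrimeSpectrum (AddMonoidAlgebra ℂ P))
    x).1 bot_le

theorem map_genericPt [IsDomain (AddMonoidAlgebra ℂ P)] [IsDomain (AddMonoidAlgebra ℂ Q)]
    {f : P →+ Q} (hf : Function.Injective f) :
    monoidScheme.map f (genericPt Q) = genericPt P := by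
  apply PrimeSpectrum.ext
  change Ideal.comap (AddMonoidAlgebra.mapDomainRingHom ℂ f) ⊥ = ⊥
  exact (RingHom.injective_iff_ker_eq_bot _).1 (AddMonoidAlgebra.mapDomain_injective hf)

theorem map_mem_basicOpen {f : P →+ Q} {x : monoidScheme Q} {p : P} :
    monoidScheme.map f x ∈ (PrimeSpectrum.basicOpen (AddMonoidAlgebra.single p (1 : ℂ)) :
      Set (PrimeSpectrum (AddMonoidAlgebra ℂ P))) ↔
    x ∈ (PrimeSpectrum.basicOpen (AddMonoidAlgebra.single (f p) (1 : ℂ)) :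
      Set (PrimeSpectrum (AddMonoidAlgebra ℂ Q))) := by
  have : AddMonoidAlgebra.mapDomainRingHom ℂ f (AddMonoidAlgebra.single p (1 : ℂ)) =
      AddMonoidAlgebra.single (f p) 1 := by
    simp [AddMonoidAlgebra.mapDomain_single]
  rw [← this]
  exact Iff.rfl

theorem mem_basicOpen_of_add_eq_zero {x : PrimeSpectrum (AddMonoidAlgebra ℂ P)} {p q : P}
    (h : p + q = 0) :
    x ∈ (PrimeSpectrum.basicOpen (AddMonoidAlgebra.single p (1 : ℂ)) :
      Set (PrimeSpectrum (AddMonoidAlgebra ℂ P))) := by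
  have hu : IsUnit (AddMonoidAlgebra.single p (1 : ℂ)) := by
    refine IsUnit.of_mul_eq_one (AddMonoidAlgebra.single q 1) ?_
    rw [AddMonoidAlgebra.single_mul_single, h, one_mul, AddMonoidAlgebra.one_def]
  exact fun hx => x.isPrime.ne_top (Ideal.eq_top_of_isUnit_mem _ hx hu)

end GenericPoint

/-! ### The image monoids φ(σ^∨ ∩ M). -/

section ImageMonoid

variable {N L : Type} [AddCommGroup N] [AddCommGroup L] (φ : DualLattice N →ₗ[ℤ] L)

/-- The image `φ(σ^∨ ∩ M)` of the semigroup of a cone. -/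
abbrev imageMonoid (σ : PointedCone ℝ (RealSpan N)) : AddSubmonoid L :=
  (dualMonoid σ).map φ.toAddMonoidHom

/-- The surjection `σ^∨ ∩ M → φ(σ^∨ ∩ M)`. -/
abbrev imageHom (σ : PointedCone ℝ (RealSpan N)) : dualMonoid σ →+ imageMonoid φ σ :=
  φ.toAddMonoidHom.addSubmonoidMap (dualMonoid σ)

theorem imageHom_surjective (σ : PointedCone ℝ (RealSpan N)) :
    Function.Surjective (imageHom φ σ) :=
  AddMonoidHom.addSubmonoidMap_surjective _ _

/-- The equivariant closed immersion `Spec ℂ[φ(σ^∨ ∩ M)] → Z_σ`. -/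
noncomputable def imageι (σ : PointedCone ℝ (RealSpan N)) :
    monoidScheme (imageMonoid φ σ) ⟶ affineToric σ :=
  monoidScheme.map (imageHom φ σ)

instance (σ : PointedCone ℝ (RealSpan N)) : IsClosedImmersion (imageι φ σ) :=
  monoidScheme.isClosedImmersion_map (imageHom_surjective φ σ)

variable {φ}

theorem imageMonoid_anti {σ τ : PointedCone ℝ (RealSpan N)} (h : σ ≤ τ) :
    imageMonoid φ τ ≤ imageMonoid φ σ :=
  AddSubmonoid.monotone_map (dualMonoid_anti h)

/-- The morphism `Spec ℂ[φ(σ^∨ ∩ M)] → Spec ℂ[φ(τ^∨ ∩ M)]` for `σ ⊆ τ`. -/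
noncomputable def imageMap {σ τ : PointedCone ℝ (RealSpan N)} (h : σ ≤ τ) :
    monoidScheme (imageMonoid φ σ) ⟶ monoidScheme (imageMonoid φ τ) :=
  monoidScheme.map (AddSubmonoid.inclusion (imageMonoid_anti h))

theorem imageι_map {σ τ : PointedCone ℝ (RealSpan N)} (h : σ ≤ τ) :
    imageι φ σ ≫ affineToric.map h = imageMap h ≫ imageι φ τ := by
  rw [imageι, affineToric.map, imageMap, imageι, monoidScheme.map_comp, monoidScheme.map_comp]
  rfl

variable [Module.Free ℤ L] [Module.Finite ℤ L]

instance isDomain_addMonoidAlgebra_addSubmonoid (P : AddSubmonoid L) :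
    IsDomain (AddMonoidAlgebra ℂ P) :=
  isDomain_addMonoidAlgebra P.subtype Subtype.val_injective

instance (P : AddSubmonoid L) : IsIntegral (monoidScheme P) :=
  inferInstanceAs (IsIntegral (Spec (CommRingCat.of (AddMonoidAlgebra ℂ P))))

theorem imageι_specializes_iff {σ : PointedCone ℝ (RealSpan N)} {x : affineToric σ} :
    imageι φ σ (genericPt _) ⤳ x ↔ x ∈ Set.range (imageι φ σ) := by
  constructor
  · intro h
    exact h.mem_closed (imageι φ σ).isClosedEmbedding.isClosed_range ⟨_, rfl⟩
  · rintro ⟨y, rfl⟩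
    exact (genericPt_specializes y).map (imageι φ σ).continuous

end ImageMonoid

/-! ### The common generic point in all charts; the torus. -/

namespace Fan

variable {N L : Type} [AddCommGroup N] [AddCommGroup L] [Module.Free ℤ L] [Module.Finite ℤ L]
  {ρ : PointedCone ℝ (RealSpan N)} {Δ : Fan N} {φ : DualLattice N →ₗ[ℤ] L}

theorem chart_imageι_genericPt {σ τ : Δ.cones} (h : σ.1 ≤ τ.1) :
    Δ.chart τ (imageι φ τ.1 (genericPt _)) = Δ.chart σ (imageι φ σ.1 (genericPt _)) := by
  rw [← map_genericPt (AddSubmonoid.inclusion_injective (imageMonoid_anti (φ := φ) h)),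
    ← chart_map_apply h]
  congr 1
  change (imageMap h ≫ imageι φ τ.1) _ = (imageι φ σ.1 ≫ affineToric.map h) _
  rw [imageι_map]

theorem chart_imageι_genericPt_eq (σ τ : Δ.cones) :
    Δ.chart τ (imageι φ τ.1 (genericPt _)) = Δ.chart σ (imageι φ σ.1 (genericPt _)) := by
  let κ : Δ.cones := ⟨σ.1 ⊓ τ.1, Δ.inf_mem σ.2 τ.2⟩
  rw [chart_imageι_genericPt (σ := κ) (τ := τ) inf_le_right,
    chart_imageι_genericPt (σ := κ) (τ := σ) inf_le_left]

/-- The closure is that of the generic point of Spec ℂ[φ(σ^∨ ∩ M)], the same point for all cones,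
and this spectrum is closed in Z_σ. -/
theorem preimage_chart_closure (σ τ : Δ.cones) :
    Δ.chart σ ⁻¹' closure {Δ.chart τ (imageι φ τ.1 (genericPt _))} =
      Set.range (imageι φ σ.1) := by
  ext x
  rw [chart_imageι_genericPt_eq σ τ, ← imageι_specializes_iff, Set.mem_preimage,
    ← specializes_iff_mem_closure]
  exact (Δ.chart σ).isOpenEmbedding.isInducing.specializes_iff

theorem faceCone_inf_eq_bot {σ : PointedCone ℝ (RealSpan N)} (h : σ ≤ ρ) {m : DualLattice N}
    (hm : ∀ x, x ∈ (⊥ : PointedCone ℝ (RealSpan N)) ↔ x ∈ ρ ∧ pairing N (1 ⊗ₜ m) x = 0) :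
    faceCone σ m = ⊥ :=
  le_bot_iff.1 fun x hx => (hm x).2 ⟨h hx.1, hx.2⟩

/-- The toric modification is an isomorphism over the torus. -/
theorem isIso_toCone_restrict (h : Δ.Subdivides ρ) (hρ : IsRational ρ) (hb : ⊥ ∈ Δ.cones)
    {m : DualLattice N} (hmρ : m ∈ dualMonoid ρ)
    (hm : ∀ x, x ∈ (⊥ : PointedCone ℝ (RealSpan N)) ↔ x ∈ ρ ∧ pairing N (1 ⊗ₜ m) x = 0)
    (T : (affineToric ρ).Opens) (hT : (T : Set (affineToric ρ)) =
      Set.range (affineToric.map (bot_le : ⊥ ≤ ρ))) :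
    (toCone h) ⁻¹' (T : Set (affineToric ρ)) = Set.range (Δ.chart ⟨⊥, hb⟩) ∧
      IsIso (toCone h ∣_ T) := by
  have hf : IsOpenImmersion (affineToric.map (bot_le : ⊥ ≤ ρ)) :=
    affineToric.isOpenImmersion_map hρ _ ⟨m, hmρ, hm⟩
  have hc := chart_toCone h ⟨⊥, hb⟩
  have hr : (toCone h) ⁻¹' (T : Set (affineToric ρ)) = Set.range (Δ.chart ⟨⊥, hb⟩) := by
    rw [hT]
    apply subset_antisymm
    · intro x hx
      obtain ⟨σ, y, rfl⟩ := exists_chart x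
      rw [Set.mem_preimage, ← Scheme.Hom.comp_apply, chart_toCone,
        affineToric.range_map hρ _ hmρ hm] at hx
      have hx' := map_mem_basicOpen.1 hx
      have := mem_range_chart_faceCone (dualMonoid_anti (h.le σ.2) hmρ) hx'
      exact range_chart_mono (faceCone_inf_eq_bot (h.le σ.2) hm).le this
    · rintro _ ⟨x, rfl⟩
      rw [Set.mem_preimage, ← Scheme.Hom.comp_apply, hc]
      exact ⟨x, rfl⟩
  refine ⟨hr, ?_⟩
  have : IsOpenImmersion (Δ.chart ⟨⊥, hb⟩ ≫ toCone h) := by rwa [hc]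
  refine isIso_morphismRestrict_of_range _ (Δ.chart ⟨⊥, hb⟩) T hr.symm ?_
  rw [hT, hc]

end Fan

end Toric

namespace Toric

/-- A monomial which cuts out the face `σ ∩ ℓ` of `σ` is invertible on `Spec ℂ[φ(σ^∨ ∩ M)]`. -/
theorem mem_basicOpen_of_inf_kerOrthogonal {N L : Type} [AddCommGroup N] [Module.Free ℤ N]
    [Module.Finite ℤ N] [AddCommGroup L] [Module.Free ℤ L] [Module.Finite ℤ L]
    {φ : DualLattice N →ₗ[ℤ] L} {σ : PointedCone ℝ (RealSpan N)} (hσ : IsRational σ)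
    {m : DualLattice N} (hm : m ∈ dualMonoid σ)
    (hmσ : ∀ x, x ∈ σ ⊓ PointedCone.ofSubmodule (kerOrthogonal φ) ↔
      x ∈ σ ∧ pairing N (1 ⊗ₜ m) x = 0) (y : monoidScheme (imageMonoid φ σ)) :
    y ∈ (PrimeSpectrum.basicOpen (AddMonoidAlgebra.single (imageHom φ σ ⟨m, hm⟩) (1 : ℂ)) :
      Set (PrimeSpectrum (AddMonoidAlgebra ℂ (imageMonoid φ σ)))) := by
  have hneg : -m ∈ dualMonoid (σ ⊓ PointedCone.ofSubmodule (kerOrthogonal φ)) := by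
    intro v hv
    simp [TensorProduct.tmul_neg, ((hmσ v).1 hv).2]
  obtain ⟨k, hk, m', hm', hkm⟩ := exists_nsmul_add_mem_of_mem_inf_kerOrthogonal hσ hneg
  -- Duality gives k φ(-m) = φ(m') with m' ∈ σ^∨, so φ(m') + (k - 1) φ(m) is an inverse of φ(m) in
  -- the image monoid.
  refine mem_basicOpen_of_add_eq_zero
    (q := imageHom φ σ ⟨m', hm'⟩ + (k - 1) • imageHom φ σ ⟨m, hm⟩) (Subtype.ext ?_)
  obtain ⟨j, rfl⟩ := Nat.exists_eq_succ_of_ne_zero hk.ne'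
  change φ m + (φ m' + (j + 1 - 1) • φ m) = 0
  rw [hkm, Nat.add_sub_cancel, map_neg, Nat.succ_eq_add_one, add_smul, one_smul, smul_neg]
  abel

namespace Fan

/-! ### The toric morphism is a modification. -/

section Modification

variable {N : Type} [AddCommGroup N] {ρ : PointedCone ℝ (RealSpan N)} {Δ : Fan N}

theorem cones_nonempty (h : Δ.Subdivides ρ) : ∃ σ, σ ∈ Δ.cones := by
  have : (0 : RealSpan N) ∈ Δ.support := by
    rw [h]
    exact zero_mem ρ
  obtain ⟨σ, hσ, -⟩ := Set.mem_iUnion₂.1 this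
  exact ⟨σ, hσ⟩

variable [Module.Free ℤ N] [Module.Finite ℤ N]

theorem Subdivides.bot_mem (h : Δ.Subdivides ρ) : ⊥ ∈ Δ.cones := by
  obtain ⟨σ, hσ⟩ := cones_nonempty h
  exact Δ.bot_mem hσ

/-- The origin is a face of ρ and a cone of every subdivision, so one torus serves all of them. -/
theorem exists_torus (hρ : IsRational ρ) (hρs : IsStrictlyConvex ρ) :
    ∃ T : (affineToric ρ).Opens, (T : Set (affineToric ρ)) =
      Set.range (affineToric.map (bot_le : ⊥ ≤ ρ)) ∧ ∀ (Δ : Fan N) (h : Δ.Subdivides ρ),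
        toCone h ⁻¹' (T : Set (affineToric ρ)) = Set.range (Δ.chart ⟨⊥, h.bot_mem⟩) ∧
        IsIso (toCone h ∣_ T) := by
  obtain ⟨m, hm, hmb⟩ := isFace_bot hρ hρs
  have := affineToric.isOpenImmersion_map hρ bot_le ⟨m, hm, hmb⟩
  refine ⟨(affineToric.map (bot_le : ⊥ ≤ ρ)).opensRange, rfl, fun Δ h => ?_⟩
  exact isIso_toCone_restrict h hρ h.bot_mem hm hmb _ rfl

theorem isModification_toCone (hρ : IsRational ρ) (hρs : IsStrictlyConvex ρ)
    (h : Δ.Subdivides ρ) : IsModification (toCone h) := by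
  refine ⟨isProper_toCone hρ h, ?_⟩
  obtain ⟨T, hT, hTΔ⟩ := exists_torus hρ hρs
  obtain ⟨hpre, hiso⟩ := hTΔ Δ h
  refine ⟨T, ?_, ?_, hiso⟩
  · intro x
    rw [hT]
    refine closure_mono (s := {genericPt _}) ?_
      (specializes_iff_mem_closure.1 (genericPt_specializes x))
    rw [Set.singleton_subset_iff]
    exact ⟨genericPt _, map_genericPt (AddSubmonoid.inclusion_injective _)⟩
  · change Dense (toCone h ⁻¹' (T : Set (affineToric ρ)))
    rw [hpre]
    intro x
    obtain ⟨σ, y, rfl⟩ := exists_chart x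
    refine closure_mono (s := {Δ.chart σ (genericPt _)}) ?_
      (specializes_iff_mem_closure.1 ((genericPt_specializes y).map (Δ.chart σ).continuous))
    rw [Set.singleton_subset_iff]
    refine ⟨genericPt _, ?_⟩
    rw [← chart_map_apply (σ := ⟨⊥, h.bot_mem⟩) (τ := σ) bot_le]
    exact congrArg _ (map_genericPt (AddSubmonoid.inclusion_injective _))

end Modification

/-! ### Charts of the strict transform and its map to Z^Λ. -/

section StrictTransform

variable {N L : Type} [AddCommGroup N] [Module.Free ℤ N] [Module.Finite ℤ N]
  [AddCommGroup L] [Module.Free ℤ L] [Module.Finite ℤ L]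
  {ρ : PointedCone ℝ (RealSpan N)} (hρ : IsRational ρ) (hρs : IsStrictlyConvex ρ)
  (φ : DualLattice N →ₗ[ℤ] L) {Δ : Fan N} (h : Δ.Subdivides ρ)

include hρ hρs in
-- The generic point of Z^Λ lies in the torus, which is contained in the isomorphism locus, and it
-- is seen in every chart.
theorem coe_strictTransformSet (σ : Δ.cones) :
    (strictTransformSet (toCone h) (Set.range (imageι φ ρ)) : Set Δ.toricVariety) =
      closure {Δ.chart σ (imageι φ σ.1 (genericPt _))} := by
  have hc : ∀ σ : Δ.cones, toCone h (Δ.chart σ (imageι φ σ.1 (genericPt _))) =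
      imageι φ ρ (genericPt _) := by
    intro σ
    rw [← Scheme.Hom.comp_apply, chart_toCone, ← Scheme.Hom.comp_apply, imageι_map,
      Scheme.Hom.comp_apply]
    exact congrArg _ (map_genericPt (AddSubmonoid.inclusion_injective _))
  apply strictTransformSet_eq_closure
  · obtain ⟨T, hT, hTΔ⟩ := exists_torus hρ hρs
    obtain ⟨-, hiso⟩ := hTΔ Δ h
    have hTU : T ≤ isoLocus (toCone h) := le_sSup hiso
    apply hTU
    rw [hc σ, ← hc ⟨⊥, h.bot_mem⟩, ← SetLike.mem_coe, hT, ← Scheme.Hom.comp_apply, chart_toCone]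
    exact ⟨_, rfl⟩
  · rw [hc]
    exact ⟨_, rfl⟩
  · rintro _ ⟨y, rfl⟩
    rw [hc]
    exact (genericPt_specializes y).map (imageι φ ρ).continuous

include hρ hρs in
/-- The strict transform is covered by open subschemes `Spec ℂ[φ(σ^∨ ∩ M)]`. -/
theorem exists_strictChart (σ : Δ.cones) :
    ∃ j : monoidScheme (imageMonoid φ σ.1) ⟶
        strictTransform (toCone h) (Set.range (imageι φ ρ)),
      IsOpenImmersion j ∧
      j ≫ strictTransform.ι (toCone h) (Set.range (imageι φ ρ)) = imageι φ σ.1 ≫ Δ.chart σ ∧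
      Set.range j =
        strictTransform.ι (toCone h) (Set.range (imageι φ ρ)) ⁻¹' Set.range (Δ.chart σ) := by
  refine exists_isOpenImmersion_subscheme _ (imageι φ σ.1) (Δ.chart σ) ?_
  rw [coe_strictTransformSet hρ hρs φ h σ, preimage_chart_closure]

/-- The open immersion `Spec ℂ[φ(σ^∨ ∩ M)] → Z^Λ_Δ`. -/
noncomputable def strictChart (σ : Δ.cones) :
    monoidScheme (imageMonoid φ σ.1) ⟶ strictTransform (toCone h) (Set.range (imageι φ ρ)) :=
  (exists_strictChart hρ hρs φ h σ).choose

instance (σ : Δ.cones) : IsOpenImmersion (strictChart hρ hρs φ h σ) :=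
  (exists_strictChart hρ hρs φ h σ).choose_spec.1

theorem strictChart_ι (σ : Δ.cones) :
    strictChart hρ hρs φ h σ ≫ strictTransform.ι (toCone h) (Set.range (imageι φ ρ)) =
      imageι φ σ.1 ≫ Δ.chart σ :=
  (exists_strictChart hρ hρs φ h σ).choose_spec.2.1

theorem range_strictChart (σ : Δ.cones) : Set.range (strictChart hρ hρs φ h σ) =
    strictTransform.ι (toCone h) (Set.range (imageι φ ρ)) ⁻¹' Set.range (Δ.chart σ) :=
  (exists_strictChart hρ hρs φ h σ).choose_spec.2.2

instance : IsClosedImmersion (strictTransform.ι (toCone h) (Set.range (imageι φ ρ))) :=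
  inferInstanceAs (IsClosedImmersion (Scheme.IdealSheafData.subschemeι _))

instance : IsReduced (strictTransform (toCone h) (Set.range (imageι φ ρ))) :=
  inferInstanceAs (IsReduced (Scheme.IdealSheafData.vanishingIdeal _).subscheme)

theorem exists_strictChart_apply (x : strictTransform (toCone h) (Set.range (imageι φ ρ))) :
    ∃ (σ : Δ.cones) (y : monoidScheme (imageMonoid φ σ.1)), strictChart hρ hρs φ h σ y = x := by
  obtain ⟨σ, z, hz⟩ := exists_chart (strictTransform.ι (toCone h) (Set.range (imageι φ ρ)) x)
  have : x ∈ Set.range (strictChart hρ hρs φ h σ) := by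
    rw [range_strictChart]
    exact ⟨z, hz⟩
  obtain ⟨y, hy⟩ := this
  exact ⟨σ, y, hy⟩

/-- The strict transform is contained in the union of the charts of the cones contained in `ℓ`. -/
theorem exists_strictChart_apply_of_le
    (hface : ∀ σ ∈ Δ.cones, IsFace (σ ⊓ PointedCone.ofSubmodule (kerOrthogonal φ)) σ)
    (x : strictTransform (toCone h) (Set.range (imageι φ ρ))) :
    ∃ (σ : Δ.cones) (y : monoidScheme (imageMonoid φ σ.1)),
      σ.1 ≤ PointedCone.ofSubmodule (kerOrthogonal φ) ∧ strictChart hρ hρs φ h σ y = x := by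
  obtain ⟨σ, y, rfl⟩ := exists_strictChart_apply hρ hρs φ h x
  obtain ⟨m, hm, hmσ⟩ := hface σ.1 σ.2
  -- The form m cutting out σ ∩ ℓ has an invertible monomial on the strict transform, so the point
  -- already lies in the chart of this face.
  have hy := mem_basicOpen_of_inf_kerOrthogonal (Δ.isRational _ σ.2) hm hmσ y
  have h1 := mem_range_chart_faceCone hm (map_mem_basicOpen.2 hy)
  let κ : Δ.cones := ⟨faceCone σ.1 m, Δ.face_mem _ σ.2 _ (isFace_faceCone hm)⟩
  have h2 : strictChart hρ hρs φ h σ y ∈ Set.range (strictChart hρ hρs φ h κ) := by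
    rw [range_strictChart, Set.mem_preimage, ← Scheme.Hom.comp_apply, strictChart_ι,
      Scheme.Hom.comp_apply]
    exact h1
  obtain ⟨z, hz⟩ := h2
  exact ⟨κ, z, fun v hv => ((hmσ v).2 (mem_faceCone.1 hv)).2, hz⟩

omit [Module.Free ℤ N] [Module.Finite ℤ N] in
theorem exists_restriction :
    ∃ r : strictTransform (toCone h) (Set.range (imageι φ ρ)) ⟶ monoidScheme (imageMonoid φ ρ),
      r ≫ imageι φ ρ = strictTransform.ι (toCone h) (Set.range (imageι φ ρ)) ≫ toCone h := by
  refine exists_lift_of_mapsTo _ _ fun x => ?_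
  have hsub : (strictTransformSet (toCone h) (Set.range (imageι φ ρ)) : Set Δ.toricVariety) ⊆
      toCone h ⁻¹' (Set.range (imageι φ ρ)) := by
    refine closure_minimal (Set.preimage_mono Set.inter_subset_left) ?_
    exact (imageι φ ρ).isClosedEmbedding.isClosed_range.preimage (toCone h).continuous
  rw [Scheme.Hom.comp_apply]
  apply hsub
  exact (Scheme.IdealSheafData.range_subschemeι (Scheme.IdealSheafData.vanishingIdeal
    (strictTransformSet (toCone h) (Set.range (imageι φ ρ))))).subset ⟨x, rfl⟩

variable {φ h} {r : strictTransform (toCone h) (Set.range (imageι φ ρ)) ⟶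
    monoidScheme (imageMonoid φ ρ)}
  (hr : r ≫ imageι φ ρ = strictTransform.ι (toCone h) (Set.range (imageι φ ρ)) ≫ toCone h)

include hr

theorem strictChart_comp (σ : Δ.cones) :
    strictChart hρ hρs φ h σ ≫ r = imageMap (h.le σ.2) := by
  rw [← cancel_mono (imageι φ ρ), Category.assoc, hr, ← Category.assoc, strictChart_ι,
    Category.assoc, chart_toCone, imageι_map]

/-- A criterion for the restriction of `π` to the strict transform to be an isomorphism over the
open subset where a given monomial does not vanish. -/
theorem isIso_restriction_basicOpen
    (hface : ∀ σ ∈ Δ.cones, IsFace (σ ⊓ PointedCone.ofSubmodule (kerOrthogonal φ)) σ)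
    {m : DualLattice N} (hm : m ∈ dualMonoid ρ) (hτ : faceCone (sigmaZero ρ φ) m ∈ Δ.cones)
    (hsat : ∀ w ∈ dualMonoid (faceCone (sigmaZero ρ φ) m), ∃ k : ℕ, ∃ v ∈ dualMonoid ρ,
      φ w + k • φ m = φ v)
    (V : (monoidScheme (imageMonoid φ ρ)).Opens)
    (hV : (V : Set (monoidScheme (imageMonoid φ ρ))) =
      (PrimeSpectrum.basicOpen (AddMonoidAlgebra.single (imageHom φ ρ ⟨m, hm⟩) (1 : ℂ)) :
      Set (PrimeSpectrum (AddMonoidAlgebra ℂ (imageMonoid φ ρ))))) :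
    r ⁻¹' (V : Set (monoidScheme (imageMonoid φ ρ))) =
      Set.range (strictChart hρ hρs φ h ⟨_, hτ⟩) ∧ IsIso (r ∣_ V) := by
  let τ : Δ.cones := ⟨_, hτ⟩
  have hneg : -m ∈ dualMonoid τ.1 := by
    intro v hv
    simp [TensorProduct.tmul_neg, (mem_faceCone.1 hv).2]
  have hinj : Function.Injective
      (AddSubmonoid.inclusion (imageMonoid_anti (φ := φ) (h.le τ.2))) :=
    AddSubmonoid.inclusion_injective _
  have hadd : AddSubmonoid.inclusion (imageMonoid_anti (φ := φ) (h.le τ.2))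
      (imageHom φ ρ ⟨m, hm⟩) + imageHom φ τ.1 ⟨-m, hneg⟩ = 0 := by
    refine Subtype.ext ?_
    change φ m + φ (-m) = 0
    rw [map_neg, add_neg_cancel]
  -- Together with the invertibility of φ(m), this identifies φ(τ^∨ ∩ M) with the localization of
  -- φ(ρ^∨ ∩ M) at φ(m).
  have hloc : ∀ q : imageMonoid φ τ.1, ∃ (k : ℕ) (p : imageMonoid φ ρ),
      q + k • AddSubmonoid.inclusion (imageMonoid_anti (φ := φ) (h.le τ.2))
        (imageHom φ ρ ⟨m, hm⟩) =
      AddSubmonoid.inclusion (imageMonoid_anti (φ := φ) (h.le τ.2)) p := by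
    rintro ⟨_, w, hw, rfl⟩
    obtain ⟨k, v, hv, hkv⟩ := hsat w hw
    exact ⟨k, imageHom φ ρ ⟨v, hv⟩, Subtype.ext hkv⟩
  have hopen : IsOpenImmersion (imageMap (φ := φ) (h.le τ.2)) :=
    monoidScheme.isOpenImmersion_map hinj _ hadd hloc
  have hrange : Set.range (imageMap (φ := φ) (h.le τ.2)) = V :=
    (monoidScheme.range_map hinj _ hadd hloc).trans hV.symm
  have hpre : r ⁻¹' (V : Set (monoidScheme (imageMonoid φ ρ))) =
      Set.range (strictChart hρ hρs φ h τ) := by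
    apply subset_antisymm
    · intro x hx
      obtain ⟨σ, y, hσ, rfl⟩ := exists_strictChart_apply_of_le hρ hρs φ h hface x
      rw [Set.mem_preimage, ← Scheme.Hom.comp_apply, strictChart_comp hρ hρs hr, hV] at hx
      have hx' := map_mem_basicOpen.1 hx
      have h1 := mem_range_chart_faceCone (dualMonoid_anti (h.le σ.2) hm)
        (map_mem_basicOpen (f := imageHom φ σ.1)
          (p := ⟨m, dualMonoid_anti (h.le σ.2) hm⟩) |>.2 hx')
      rw [range_strictChart, Set.mem_preimage, ← Scheme.Hom.comp_apply, strictChart_ι,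
        Scheme.Hom.comp_apply]
      -- Since σ lies in ρ ∩ ℓ = σ₀, its face where m vanishes lies in τ; so no chart other than
      -- that of τ is needed over V.
      refine range_chart_mono (τ := τ) ?_ h1
      intro v hv
      exact ⟨⟨h.le σ.2 hv.1, hσ hv.1⟩, hv.2⟩
    · rintro _ ⟨y, rfl⟩
      rw [Set.mem_preimage, ← Scheme.Hom.comp_apply, strictChart_comp hρ hρs hr, ← hrange]
      exact ⟨y, rfl⟩
  refine ⟨hpre, ?_⟩
  have : IsOpenImmersion (strictChart hρ hρs φ h τ ≫ r) := by
    rwa [strictChart_comp hρ hρs hr]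
  refine isIso_morphismRestrict_of_range r (strictChart hρ hρs φ h τ) V hpre.symm ?_
  rw [strictChart_comp hρ hρs hr, hrange]

include hρ hρs in
-- The criterion is applied to a form that vanishes on ρ only at the origin: the face of σ₀ is then
-- the zero cone and its chart is the torus.
theorem isBirational_restriction
    (hface : ∀ σ ∈ Δ.cones, IsFace (σ ⊓ PointedCone.ofSubmodule (kerOrthogonal φ)) σ) :
    IsBirational r := by
  obtain ⟨m, hm, hmb⟩ := isFace_bot hρ hρs
  have hbot : faceCone (sigmaZero ρ φ) m = ⊥ := faceCone_inf_eq_bot inf_le_left hmb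
  have hτ : faceCone (sigmaZero ρ φ) m ∈ Δ.cones := hbot ▸ h.bot_mem
  let V : (monoidScheme (imageMonoid φ ρ)).Opens :=
    PrimeSpectrum.basicOpen (AddMonoidAlgebra.single (imageHom φ ρ ⟨m, hm⟩) (1 : ℂ))
  obtain ⟨hpre, hiso⟩ := isIso_restriction_basicOpen hρ hρs hr hface hm hτ (by
    rw [hbot]
    intro w hw
    obtain ⟨k, hk⟩ := exists_add_nsmul_mem hρ hm hmb hw
    exact ⟨k, _, hk k le_rfl, by simp⟩) V rfl
  refine ⟨V, ?_, ?_, hiso⟩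
  · intro x
    refine closure_mono (s := {genericPt _}) ?_
      (specializes_iff_mem_closure.1 (genericPt_specializes x))
    rw [Set.singleton_subset_iff]
    intro hx
    have h0 : AddMonoidAlgebra.single (imageHom φ ρ ⟨m, hm⟩) (1 : ℂ) = 0 := hx
    simp at h0
  · change Dense (r ⁻¹' (V : Set (monoidScheme (imageMonoid φ ρ))))
    rw [hpre]
    intro x
    obtain ⟨σ, y, rfl⟩ := exists_strictChart_apply hρ hρs φ h x
    refine closure_mono (s := {strictChart hρ hρs φ h σ (genericPt _)}) ?_
      (specializes_iff_mem_closure.1 ((genericPt_specializes y).map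
        (strictChart hρ hρs φ h σ).continuous))
    rw [Set.singleton_subset_iff, range_strictChart, Set.mem_preimage, ← Scheme.Hom.comp_apply,
      strictChart_ι, Scheme.Hom.comp_apply, chart_imageι_genericPt_eq ⟨_, hτ⟩ σ]
    exact ⟨_, rfl⟩

include hρ hρs in
theorem isModification_restriction
    (hface : ∀ σ ∈ Δ.cones, IsFace (σ ⊓ PointedCone.ofSubmodule (kerOrthogonal φ)) σ) :
    IsModification r := by
  refine ⟨?_, isBirational_restriction hρ hρs hr hface⟩
  have := isProper_toCone hρ h
  have h1 : IsProper (r ≫ imageι φ ρ) := by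
    rw [hr]
    infer_instance
  exact IsProper.of_comp r (imageι φ ρ)

end StrictTransform

end Fan

end Toric

namespace Toric

/-! ### Normality of monoid schemes. -/

section Normal

theorem isNormalVariety_monoidScheme {L : Type} [AddCommGroup L] [Module.Free ℤ L]
    [Module.Finite ℤ L] (P : AddSubmonoid L) [IsIntegrallyClosed (AddMonoidAlgebra ℂ P)] :
    IsNormalVariety (monoidScheme P) := by
  refine ⟨inferInstance, fun x => ?_⟩
  let y : PrimeSpectrum (AddMonoidAlgebra ℂ P) := x
  have := isIntegrallyClosed_of_isLocalization (Localization.AtPrime y.asIdeal)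
    y.asIdeal.primeCompl (le_nonZeroDivisors_of_noZeroDivisors (by simp [Ideal.primeCompl]))
  exact IsIntegrallyClosed.of_equiv
    (Spec.stalkIso (CommRingCat.of (AddMonoidAlgebra ℂ P)) y).symm.commRingCatIsoToRingEquiv

theorem IsNormalVariety.of_iso {X Y : Scheme.{0}} (hX : IsNormalVariety X) (f : X ⟶ Y) [IsIso f] :
    IsNormalVariety Y := by
  have := hX.1
  have : Nonempty Y := ⟨f (Classical.arbitrary X)⟩
  refine ⟨isIntegral_of_isOpenImmersion (inv f), fun y => ?_⟩
  have := hX.2 (inv f y)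
  exact IsIntegrallyClosed.of_equiv
    (asIso ((inv f).stalkMap y)).commRingCatIsoToRingEquiv

end Normal

/-! ### Vectors of ℓ as linear forms on the lattice of Λ. -/

section Forms

variable {N L : Type} [AddCommGroup N] [AddCommGroup L] {φ : DualLattice N →ₗ[ℤ] L}

/-- A lattice vector in `ℓ` defines a linear form on `L`. -/
theorem exists_form_of_mem_kerOrthogonal (hφ : Function.Surjective φ) {n : N}
    (hn : (1 : ℝ) ⊗ₜ[ℤ] n ∈ kerOrthogonal φ) : ∃ n' : L →+ ℤ, ∀ m, n' (φ m) = m n := by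
  have hker : φ.toAddMonoidHom.ker ≤ (Module.Dual.eval ℤ N n).toAddMonoidHom.ker := by
    intro m hm
    have := mem_kerOrthogonal.1 hn m hm
    rw [pairing_tmul] at this
    have h' : m n = 0 := by simpa using this
    exact h'
  refine ⟨φ.toAddMonoidHom.liftOfSurjective hφ ⟨_, hker⟩, fun m => ?_⟩
  exact φ.toAddMonoidHom.liftOfRightInverse_comp_apply _ (Function.rightInverse_surjInv hφ)
    ⟨(Module.Dual.eval ℤ N n).toAddMonoidHom, hker⟩ m

/-- The generators of κ kill ker φ and descend to L, so membership of φ(m) in the image monoid does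
not depend on the choice of m. In particular the image monoid is saturated. -/
theorem exists_forms_imageMonoid (hφ : Function.Surjective φ) {κ : PointedCone ℝ (RealSpan N)}
    (hκ : IsRational κ) (hle : κ ≤ PointedCone.ofSubmodule (kerOrthogonal φ)) :
    ∃ (s : Finset N) (n' : s → L →+ ℤ), (∀ i m, n' i (φ m) = m i.1) ∧
      ∀ l, l ∈ imageMonoid φ κ ↔ ∀ i, 0 ≤ n' i l := by
  obtain ⟨s, hsκ, -, hs⟩ := hκ.exists_finset
  choose n' hn' using fun i : s => exists_form_of_mem_kerOrthogonal hφ (hle (hsκ i.1 i.2))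
  refine ⟨s, n', hn', fun l => ⟨?_, fun hl => ?_⟩⟩
  · rintro ⟨m, hm, rfl⟩ i
    exact (hn' i m).symm ▸ (hs m).1 hm i.1 i.2
  · obtain ⟨m, rfl⟩ := hφ l
    exact ⟨m, (hs m).2 fun n hn => by simpa [hn'] using hl ⟨n, hn⟩, rfl⟩

end Forms

/-! ### The strict transform as normalization. -/

section Main

variable {N L : Type} [AddCommGroup N] [Module.Free ℤ N] [Module.Finite ℤ N]
  [AddCommGroup L] [Module.Free ℤ L] [Module.Finite ℤ L]
  {ρ : PointedCone ℝ (RealSpan N)} (hρ : IsRational ρ) (hρs : IsStrictlyConvex ρ)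
  {φ : DualLattice N →ₗ[ℤ] L} {Δ : Fan N} (h : Δ.Subdivides ρ)

omit [Module.Free ℤ N] [Module.Finite ℤ N] [Module.Free ℤ L] [Module.Finite ℤ L] in
include h in
theorem inf_kerOrthogonal_eq {σ : PointedCone ℝ (RealSpan N)} (hσ : σ ∈ Δ.cones) :
    σ ⊓ PointedCone.ofSubmodule (kerOrthogonal φ) = σ ⊓ sigmaZero ρ φ := by
  rw [sigmaZero, ← inf_assoc, inf_eq_left.2 (h.le hσ)]

omit [Module.Free ℤ N] [Module.Finite ℤ N] [Module.Free ℤ L] [Module.Finite ℤ L] in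
include h in
theorem isFace_inf_kerOrthogonal (hσ₀ : sigmaZero ρ φ ∈ Δ.cones)
    {σ : PointedCone ℝ (RealSpan N)} (hσ : σ ∈ Δ.cones) :
    IsFace (σ ⊓ PointedCone.ofSubmodule (kerOrthogonal φ)) σ := by
  rw [inf_kerOrthogonal_eq h hσ]
  exact Δ.isFace_inf _ hσ _ hσ₀

/-- Every cone of the fan contained in ℓ lies in ρ ∩ ℓ = σ₀, so one chart covers the strict
transform. -/
theorem isIso_strictChart_sigmaZero (hσ₀ : sigmaZero ρ φ ∈ Δ.cones) :
    IsIso (Fan.strictChart hρ hρs φ h ⟨_, hσ₀⟩) := by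
  refine isIso_of_isOpenImmersion_of_opensRange_eq_top _ (SetLike.coe_injective ?_)
  refine Set.eq_univ_of_forall fun x => ?_
  obtain ⟨σ, y, hσ, rfl⟩ := Fan.exists_strictChart_apply_of_le hρ hρs φ h
    (fun σ hσ => isFace_inf_kerOrthogonal h hσ₀ hσ) x
  change _ ∈ Set.range _
  rw [Fan.range_strictChart]
  refine Fan.range_chart_mono (σ := σ) (τ := ⟨_, hσ₀⟩) (le_inf (h.le σ.2) hσ) ?_
  rw [← Scheme.Hom.comp_apply, Fan.strictChart_ι, Scheme.Hom.comp_apply]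
  exact ⟨_, rfl⟩

include hρ hρs in
-- In the chart of σ₀ the map is that of an inclusion of monoids. The larger one is cut out by
-- linear forms, which gives normality; the duality for ρ ∩ ℓ puts a multiple of each of its
-- elements in the smaller one, which gives finiteness.
theorem isNormalization_restriction (hφ : Function.Surjective φ)
    (hσ₀ : sigmaZero ρ φ ∈ Δ.cones)
    {r : strictTransform (Fan.toCone h) (Set.range (imageι φ ρ)) ⟶
      monoidScheme (imageMonoid φ ρ)}
    (hr : r ≫ imageι φ ρ =
      strictTransform.ι (Fan.toCone h) (Set.range (imageι φ ρ)) ≫ Fan.toCone h) :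
    IsNormalization r := by
  have hiso := isIso_strictChart_sigmaZero hρ hρs h hσ₀
  have hrat := Δ.isRational _ hσ₀
  obtain ⟨s, n', -, hn'⟩ := exists_forms_imageMonoid hφ hrat inf_le_right
  have hr' : r = inv (Fan.strictChart hρ hρs φ h ⟨_, hσ₀⟩) ≫ imageMap (h.le hσ₀) := by
    rw [← Fan.strictChart_comp hρ hρs hr, IsIso.inv_hom_id_assoc]
  refine ⟨?_, ?_, ?_⟩
  · have := isIntegrallyClosed_of_mem_iff_nonneg n' (imageMonoid φ (sigmaZero ρ φ)) hn'
    exact (isNormalVariety_monoidScheme (imageMonoid φ (sigmaZero ρ φ))).of_iso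
      (Fan.strictChart hρ hρs φ h ⟨_, hσ₀⟩)
  · have : AddMonoid.FG (imageMonoid φ (sigmaZero ρ φ)) :=
      (AddMonoid.fg_iff_addSubmonoid_fg _).2 (fg_of_mem_iff_nonneg n' _ hn')
    have hfin : IsFinite (imageMap (φ := φ) (h.le hσ₀)) := by
      refine (IsFinite.SpecMap_iff _).2 (finite_mapDomainRingHom _ ?_)
      rintro ⟨_, w, hw, rfl⟩
      obtain ⟨k, hk, m, hm, hkm⟩ := exists_nsmul_add_mem_of_mem_inf_kerOrthogonal hρ hw
      exact ⟨k, hk, imageHom φ ρ ⟨m, hm⟩, Subtype.ext hkm⟩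
    rw [hr']
    infer_instance
  · exact Fan.isBirational_restriction hρ hρs hr fun σ hσ => isFace_inf_kerOrthogonal h hσ₀ hσ

end Main

end Toric

namespace Toric

/-- Isomorphic monoids have isomorphic spectra. -/
noncomputable def monoidScheme.isoOfAddEquiv {P Q : Type} [AddCommMonoid P] [AddCommMonoid Q]
    (e : P ≃+ Q) : monoidScheme P ≅ monoidScheme Q where
  hom := monoidScheme.map e.symm.toAddMonoidHom
  inv := monoidScheme.map e.toAddMonoidHom
  hom_inv_id := by
    rw [monoidScheme.map_comp, ← monoidScheme.map_id]
    congr 1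
    ext x
    simp
  inv_hom_id := by
    rw [monoidScheme.map_comp, ← monoidScheme.map_id]
    congr 1
    ext x
    simp

/-! ### The cone σ in the lattice that it spans. -/

section ConeLattice

variable {N : Type} [AddCommGroup N] {σ : PointedCone ℝ (RealSpan N)}

theorem exists_sub_of_mem_coneLattice {n : N} (hn : n ∈ coneLattice σ) :
    ∃ a b : N, (1 : ℝ) ⊗ₜ[ℤ] a ∈ σ ∧ (1 : ℝ) ⊗ₜ[ℤ] b ∈ σ ∧ n = a - b := by
  induction hn using Submodule.span_induction with
  | mem x hx => exact ⟨x, 0, hx, by simp, by simp⟩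
  | zero => exact ⟨0, 0, by simp, by simp, by simp⟩
  | add x y _ _ hx hy =>
    obtain ⟨a, b, ha, hb, rfl⟩ := hx
    obtain ⟨c, d, hc, hd, rfl⟩ := hy
    exact ⟨a + c, b + d, by rw [TensorProduct.tmul_add]; exact add_mem ha hc,
      by rw [TensorProduct.tmul_add]; exact add_mem hb hd, by abel⟩
  | smul k x _ hx =>
    obtain ⟨a, b, ha, hb, rfl⟩ := hx
    have hmul : ∀ (j : ℕ) (c : N), (1 : ℝ) ⊗ₜ[ℤ] c ∈ σ → (1 : ℝ) ⊗ₜ[ℤ] (j • c) ∈ σ := by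
      intro j c hc
      rw [TensorProduct.tmul_smul]
      exact nsmul_mem hc j
    obtain ⟨j, rfl | rfl⟩ := k.eq_nat_or_neg
    · exact ⟨j • a, j • b, hmul j a ha, hmul j b hb, by simp [smul_sub]⟩
    · exact ⟨j • b, j • a, hmul j b hb, hmul j a ha, by simp [smul_sub]; abel⟩

/-- If k n = a - b with a, b in σ, then n + b = (a + (k - 1) b) / k lies in σ, and n = (n + b) - b.
-/
theorem mem_coneLattice_of_nsmul_mem {n : N} {k : ℕ} (hk : 0 < k) (hn : k • n ∈ coneLattice σ) :
    n ∈ coneLattice σ := by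
  obtain ⟨a, b, ha, hb, hab⟩ := exists_sub_of_mem_coneLattice hn
  have hk' : (0 : ℝ) < k := by exact_mod_cast hk
  have h1 : (1 : ℝ) ⊗ₜ[ℤ] (n + b) ∈ σ := by
    have h2 : (k : ℝ) • ((1 : ℝ) ⊗ₜ[ℤ] (n + b)) = 1 ⊗ₜ[ℤ] a + ((k - 1 : ℝ)) • (1 ⊗ₜ[ℤ] b) := by
      have h3 : (1 : ℝ) ⊗ₜ[ℤ] a = (k : ℝ) • ((1 : ℝ) ⊗ₜ[ℤ] n) + 1 ⊗ₜ[ℤ] b := by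
        rw [Nat.cast_smul_eq_nsmul, ← TensorProduct.tmul_smul, hab, TensorProduct.tmul_sub,
          sub_add_cancel]
      rw [h3, TensorProduct.tmul_add, smul_add, sub_smul, one_smul]
      abel
    have h4 : (1 : ℝ) ⊗ₜ[ℤ] (n + b) =
        (k : ℝ)⁻¹ • (1 ⊗ₜ[ℤ] a + ((k - 1 : ℝ)) • (1 ⊗ₜ[ℤ] b)) := by
      rw [← h2, smul_smul, inv_mul_cancel₀ hk'.ne', one_smul]
    rw [h4]
    have hk1 : (0 : ℝ) ≤ k - 1 := by
      have : (1 : ℝ) ≤ k := by exact_mod_cast hk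
      linarith
    exact σ.smul_mem (inv_nonneg.2 hk'.le) (add_mem ha (σ.smul_mem hk1 hb))
  have := sub_mem (Submodule.subset_span h1 : n + b ∈ coneLattice σ)
    (Submodule.subset_span hb : b ∈ coneLattice σ)
  rwa [add_sub_cancel_right] at this

variable [Module.Finite ℤ N]

theorem restrict_surjective_of_saturated {K : Submodule ℤ N}
    (hK : ∀ (k : ℕ) (n : N), 0 < k → k • n ∈ K → n ∈ K) :
    Function.Surjective (K.subtype.dualMap) := by
  obtain ⟨p, hp⟩ := exists_projection_of_saturated hK
  refine fun f => ⟨f ∘ₗ p, LinearMap.ext fun n => ?_⟩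
  simp [hp]

omit [Module.Finite ℤ N] in
theorem pairing_baseChange_subtype (K : Submodule ℤ N) (m : DualLattice N) (x : RealSpan K) :
    pairing N (1 ⊗ₜ m) (K.subtype.baseChange ℝ x) =
      pairing K (1 ⊗ₜ (K.subtype.dualMap m)) x := by
  induction x using TensorProduct.induction_on with
  | zero => simp
  | tmul a n =>
    rw [LinearMap.baseChange_tmul, pairing_tmul, pairing_tmul]
    rfl
  | add x y hx hy => rw [map_add, map_add, map_add, hx, hy]

omit [Module.Finite ℤ N] in
theorem dualMap_mem_dualMonoid_coneInLattice (hσ : IsRational σ) {m : DualLattice N} :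
    (coneLattice σ).subtype.dualMap m ∈ dualMonoid (coneInLattice σ) ↔ m ∈ dualMonoid σ := by
  constructor
  · intro h
    obtain ⟨s, hsσ, -, hs⟩ := hσ.exists_finset
    refine (hs m).2 fun n hn => ?_
    have hnK : n ∈ coneLattice σ := Submodule.subset_span (hsσ n hn)
    refine nonneg_of_mem_dualMonoid (n := (⟨n, hnK⟩ : coneLattice σ)) h ?_
    change (coneLattice σ).subtype.baseChange ℝ _ ∈ σ
    rw [LinearMap.baseChange_tmul]
    exact hsσ n hn
  · intro h x hx
    rw [LinearMap.flip_apply, ← pairing_baseChange_subtype]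
    exact mem_dualMonoid.1 h _ hx

variable [Module.Free ℤ N]

theorem finrank_span_eq (hσ : IsRational σ) :
    Module.finrank ℝ (Submodule.span ℝ (σ : Set (RealSpan N))) =
      Module.finrank ℤ (coneLattice σ) := by
  have hinj : Function.Injective ((coneLattice σ).subtype.baseChange ℝ) :=
    Module.Flat.lTensor_preserves_injective_linearMap (M := ℝ) _ (coneLattice σ).injective_subtype
  have hspan : Submodule.span ℝ (σ : Set (RealSpan N)) =
      LinearMap.range ((coneLattice σ).subtype.baseChange ℝ) := by
    apply le_antisymm
    · obtain ⟨s, hsσ, hs, -⟩ := hσ.exists_finset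
      rw [Submodule.span_le]
      have : σ ≤ PointedCone.ofSubmodule
          (LinearMap.range ((coneLattice σ).subtype.baseChange ℝ)) := by
        conv_lhs => rw [hs]
        refine Submodule.span_le.2 ?_
        rintro _ ⟨n, hn, rfl⟩
        exact ⟨1 ⊗ₜ ⟨n, Submodule.subset_span (hsσ n hn)⟩, by simp⟩
      exact this
    · rintro _ ⟨x, rfl⟩
      induction x using TensorProduct.induction_on with
      | zero => simp
      | add x y hx hy => rw [map_add]; exact add_mem hx hy
      | tmul a n =>
        obtain ⟨n, hn⟩ := n
        obtain ⟨c, d, hc, hd, rfl⟩ := exists_sub_of_mem_coneLattice hn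
        rw [LinearMap.baseChange_tmul, ← mul_one a, ← smul_eq_mul, ← TensorProduct.smul_tmul']
        refine Submodule.smul_mem _ _ ?_
        rw [Submodule.subtype_apply, TensorProduct.tmul_sub]
        exact sub_mem (Submodule.subset_span hc) (Submodule.subset_span hd)
  rw [hspan, LinearMap.finrank_range_of_inj hinj, Module.finrank_baseChange]

/-- If `σ ⊆ ℓ` spans a space of dimension `rk L`, then `φ(σ^∨ ∩ M)` is the semigroup of `σ` in the
lattice `N_σ`. -/
theorem exists_addEquiv_imageMonoid {L : Type} [AddCommGroup L] [Module.Free ℤ L]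
    [Module.Finite ℤ L] {φ : DualLattice N →ₗ[ℤ] L} (hφ : Function.Surjective φ)
    (hσ : IsRational σ) (hle : σ ≤ PointedCone.ofSubmodule (kerOrthogonal φ))
    (hrank : Module.finrank ℝ (Submodule.span ℝ (σ : Set (RealSpan N))) = Module.finrank ℤ L) :
    Nonempty (imageMonoid φ σ ≃+ dualMonoid (coneInLattice σ)) := by
  have hsurj := restrict_surjective_of_saturated (K := coneLattice σ)
    fun k n hk hn => mem_coneLattice_of_nsmul_mem hk hn
  have hker : LinearMap.ker φ ≤ LinearMap.ker (coneLattice σ).subtype.dualMap := by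
    intro m hm
    refine LinearMap.ext fun n => ?_
    have hz : ∀ a : N, (1 : ℝ) ⊗ₜ[ℤ] a ∈ σ → m a = 0 := by
      intro a ha
      have := mem_kerOrthogonal.1 (hle ha) m hm
      rw [pairing_tmul] at this
      simpa using this
    obtain ⟨a, b, ha, hb, hab⟩ := exists_sub_of_mem_coneLattice n.2
    change m n = 0
    rw [hab, map_sub, hz a ha, hz b hb, sub_zero]
  let E₀ : L →ₗ[ℤ] DualLattice (coneLattice σ) :=
    (LinearMap.ker φ).liftQ _ hker ∘ₗ (φ.quotKerEquivOfSurjective hφ).symm.toLinearMap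
  have hE₀ : ∀ m, E₀ (φ m) = (coneLattice σ).subtype.dualMap m := by
    intro m
    have : (φ.quotKerEquivOfSurjective hφ).symm (φ m) = (LinearMap.ker φ).mkQ m := by
      rw [LinearEquiv.symm_apply_eq]
      rfl
    simp only [E₀, LinearMap.comp_apply, LinearEquiv.coe_coe, this]
    rfl
  have hE₀s : Function.Surjective E₀ := by
    intro f
    obtain ⟨m, rfl⟩ := hsurj f
    exact ⟨φ m, hE₀ m⟩
  -- The rank hypothesis makes source and target free of the same rank, so the surjection induced by
  -- restriction of forms to N_σ is injective.
  have hE₀i : Function.Injective E₀ := by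
    have hr : Module.finrank ℤ (DualLattice (coneLattice σ)) = Module.finrank ℤ L := by
      rw [← hrank, finrank_span_eq hσ, Module.finrank_linearMap_self]
    let e := LinearEquiv.ofFinrankEq (R := ℤ) _ _ hr
    have := OrzechProperty.injective_of_surjective_endomorphism (e.toLinearMap ∘ₗ E₀)
      (e.surjective.comp hE₀s)
    exact Function.Injective.of_comp this
  let E : L ≃+ DualLattice (coneLattice σ) :=
    AddEquiv.ofBijective E₀.toAddMonoidHom ⟨hE₀i, hE₀s⟩
  have hmap : (imageMonoid φ σ).map E.toAddMonoidHom = dualMonoid (coneInLattice σ) := by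
    ext f
    constructor
    · rintro ⟨_, ⟨m, hm, rfl⟩, rfl⟩
      have : E.toAddMonoidHom (φ.toAddMonoidHom m) = (coneLattice σ).subtype.dualMap m := hE₀ m
      rw [this]
      exact (dualMap_mem_dualMonoid_coneInLattice hσ).2 hm
    · intro hf
      obtain ⟨m, rfl⟩ := hsurj f
      exact ⟨φ m, ⟨m, (dualMap_mem_dualMonoid_coneInLattice hσ).1 hf, rfl⟩, hE₀ m⟩
  exact ⟨(E.addSubmonoidMap _).trans (AddEquiv.addSubmonoidCongr hmap)⟩

end ConeLattice

/-! ### The isomorphism with the toric variety of σ₀. -/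

section Main

variable {N L : Type} [AddCommGroup N] [Module.Free ℤ N] [Module.Finite ℤ N]
  [AddCommGroup L] [Module.Free ℤ L] [Module.Finite ℤ L]
  {ρ : PointedCone ℝ (RealSpan N)} (hρ : IsRational ρ) (hρs : IsStrictlyConvex ρ)
  {φ : DualLattice N →ₗ[ℤ] L} {Δ : Fan N} (h : Δ.Subdivides ρ)

theorem strictChart_structure (σ : Δ.cones) :
    Fan.strictChart hρ hρs φ h σ ≫ strictTransform.ι (Fan.toCone h) (Set.range (imageι φ ρ)) ≫
      Fan.toCone h ≫ monoidScheme.structure (dualMonoid ρ) =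
    monoidScheme.structure (imageMonoid φ σ.1) := by
  rw [← Category.assoc, Fan.strictChart_ι, ← Category.assoc, Category.assoc (imageι φ σ.1),
    Fan.chart_toCone, Category.assoc, affineToric.map, monoidScheme.map_structure, imageι,
    monoidScheme.map_structure]

include hρ hρs in
theorem exists_iso_coneInLattice (hφ : Function.Surjective φ)
    (hσ₀ : sigmaZero ρ φ ∈ Δ.cones)
    (hrank : Module.finrank ℝ (Submodule.span ℝ (sigmaZero ρ φ : Set (RealSpan N))) =
      Module.finrank ℤ L) :
    ∃ e : strictTransform (Fan.toCone h) (Set.range (imageι φ ρ)) ≅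
        affineToric (coneInLattice (sigmaZero ρ φ)),
      e.hom ≫ monoidScheme.structure (dualMonoid (coneInLattice (sigmaZero ρ φ))) =
        strictTransform.ι (Fan.toCone h) (Set.range (imageι φ ρ)) ≫
          Fan.toCone h ≫ monoidScheme.structure (dualMonoid ρ) := by
  have hiso := isIso_strictChart_sigmaZero hρ hρs h hσ₀
  obtain ⟨e⟩ := exists_addEquiv_imageMonoid hφ (Δ.isRational _ hσ₀) inf_le_right hrank
  refine ⟨(asIso (Fan.strictChart hρ hρs φ h ⟨_, hσ₀⟩)).symm ≪≫ monoidScheme.isoOfAddEquiv e, ?_⟩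
  rw [← cancel_epi (Fan.strictChart hρ hρs φ h ⟨_, hσ₀⟩), strictChart_structure]
  simp only [Iso.trans_hom, Iso.symm_hom, asIso_inv, Category.assoc, IsIso.hom_inv_id_assoc]
  exact monoidScheme.map_structure _

end Main

end Toric

namespace Toric

/-! ### Sections over cones in ℓ, and smoothness. -/

section Retraction

variable {N L : Type} [AddCommGroup N] [AddCommGroup L] {φ : DualLattice N →ₗ[ℤ] L}

theorem mem_perpLattice_of_ker {κ : PointedCone ℝ (RealSpan N)}
    (hle : κ ≤ PointedCone.ofSubmodule (kerOrthogonal φ)) {m : DualLattice N} (hm : φ m = 0) :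
    m ∈ perpLattice κ := fun _ hx => mem_kerOrthogonal.1 (hle hx) m hm

/-- For `κ ⊆ ℓ`, the surjection `κ^∨ ∩ M → φ(κ^∨ ∩ M)` has a section. -/
theorem exists_section_imageHom [Module.Free ℤ L] (hφ : Function.Surjective φ)
    {κ : PointedCone ℝ (RealSpan N)}
    (hle : κ ≤ PointedCone.ofSubmodule (kerOrthogonal φ)) :
    ∃ s : imageMonoid φ κ →+ dualMonoid κ, ∀ l, imageHom φ κ (s l) = l := by
  obtain ⟨s, hs⟩ := Module.projective_lifting_property φ LinearMap.id hφ
  have hs' : ∀ l, φ (s l) = l := fun l => LinearMap.congr_fun hs l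
  have hmem : ∀ l ∈ imageMonoid φ κ, s l ∈ dualMonoid κ := by
    rintro _ ⟨m, hm, rfl⟩
    -- A linear section moves m only by an element of ker φ, which vanishes on κ ⊆ ℓ; so it
    -- preserves the dual monoid.
    have h1 : s (φ m) - m ∈ perpLattice κ := mem_perpLattice_of_ker hle (by rw [map_sub, hs', sub_self])
    have h2 := add_mem (perpLattice_le_dualMonoid h1) hm
    rwa [sub_add_cancel] at h2
  refine ⟨(s.toAddMonoidHom.comp (imageMonoid φ κ).subtype).codRestrict _
    fun l => hmem l.1 l.2, fun l => Subtype.ext (hs' l.1)⟩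

theorem smooth_dualMonoid {κ : PointedCone ℝ (RealSpan N)} (hκ : IsRegularCone κ) :
    Algebra.Smooth ℂ (AddMonoidAlgebra ℂ (dualMonoid κ)) := by
  obtain ⟨k, b, s, rfl⟩ := hκ
  have hmem : ∀ m : DualLattice N, m ∈ dualMonoid (PointedCone.hull ℝ
      ((fun i => (1 : ℝ) ⊗ₜ[ℤ] b i) '' s)) ↔ ∀ i ∈ s, 0 ≤ m (b i) := by
    intro m
    have : ((fun i => (1 : ℝ) ⊗ₜ[ℤ] b i) '' s) = (fun n : N => (1 : ℝ) ⊗ₜ[ℤ] n) '' (b '' s) := by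
      rw [Set.image_image]
    rw [this, mem_dualMonoid_hull, Set.forall_mem_image]
  refine smooth_of_basis s
    { toFun := fun m i => m.1 (b i)
      map_zero' := rfl
      map_add' := fun _ _ => rfl } ?_ fun z => ?_
  · intro m m' hmm
    exact Subtype.ext (b.ext fun i => congrFun hmm i)
  · constructor
    · rintro ⟨m, rfl⟩
      exact (hmem m.1).1 m.2
    · intro hz
      refine ⟨⟨b.constr ℤ z, (hmem _).2 fun i hi => ?_⟩, funext fun i => ?_⟩
      · rw [b.constr_basis]
        exact hz i hi
      · exact b.constr_basis ℤ z i

/-- The section exhibits the algebra as a retract of the smooth algebra ℂ[κ^∨ ∩ M]. -/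
theorem smooth_imageMonoid [Module.Finite ℤ L] [Module.Free ℤ L] (hφ : Function.Surjective φ)
    {κ : PointedCone ℝ (RealSpan N)} (hκ : IsRational κ)
    (hle : κ ≤ PointedCone.ofSubmodule (kerOrthogonal φ)) (hreg : IsRegularCone κ) :
    Algebra.Smooth ℂ (AddMonoidAlgebra ℂ (imageMonoid φ κ)) := by
  have := smooth_dualMonoid hreg
  obtain ⟨s, hs⟩ := exists_section_imageHom hφ hle
  obtain ⟨t, n', -, hn'⟩ := exists_forms_imageMonoid hφ hκ hle
  have : AddMonoid.FG (imageMonoid φ κ) :=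
    (AddMonoid.fg_iff_addSubmonoid_fg _).2 (fg_of_mem_iff_nonneg n' _ hn')
  have h1 : Algebra.FormallySmooth ℂ (AddMonoidAlgebra ℂ (dualMonoid κ)) :=
    Algebra.Smooth.formallySmooth
  refine ⟨formallySmooth_of_retract (AddMonoidAlgebra.mapDomainAlgHom ℂ ℂ (imageHom φ κ))
    (AddMonoidAlgebra.mapDomainAlgHom ℂ ℂ s) ?_, Algebra.FinitePresentation.of_finiteType.1 inferInstance⟩
  refine AddMonoidAlgebra.algHom_ext (fun l => ?_) (AlgHom.ext fun c => ?_)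
  · simp [AddMonoidAlgebra.mapDomain_single, hs]
  · simp [AddMonoidAlgebra.mapDomain_single]

end Retraction

/-! ### Transversality in affine charts. -/

section StalkIdeal

variable {X : Scheme.{0}}

theorem stalkIdeal_eq (S : Set X) (x : X) (U : X.affineOpens) (hx : x ∈ U.1) :
    stalkIdeal S x =
      ((Scheme.IdealSheafData.vanishingIdeal ⟨closure S, isClosed_closure⟩).ideal U).map
        (X.presheaf.germ U.1 x hx).hom := by
  apply le_antisymm
  · refine iSup₂_le fun V hV => ?_
    obtain ⟨_, ⟨W, hW, rfl⟩, hxW, hWUV⟩ := X.isBasis_affineOpens.exists_subset_of_mem_open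
      (show x ∈ (U.1 ⊓ V.1 : X.Opens) from ⟨hx, hV⟩) (U.1 ⊓ V.1).2
    have key : ∀ (V : X.affineOpens) (hV : x ∈ V.1) (hWV : W ≤ V.1),
        ((Scheme.IdealSheafData.vanishingIdeal ⟨closure S, isClosed_closure⟩).ideal V).map
          (X.presheaf.germ V.1 x hV).hom =
        ((Scheme.IdealSheafData.vanishingIdeal ⟨closure S, isClosed_closure⟩).ideal ⟨W, hW⟩).map
          (X.presheaf.germ W x hxW).hom := by
      intro V hV hWV
      rw [← Scheme.IdealSheafData.map_ideal _ (U := ⟨W, hW⟩) (V := V) hWV, Ideal.map_map,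
        ← CommRingCat.hom_comp]
      exact congrArg (fun g => Ideal.map (CommRingCat.Hom.hom g) _)
        (X.presheaf.germ_res (homOfLE hWV) x hxW).symm
    rw [key V hV (hWUV.trans Set.inter_subset_right), key U hx (hWUV.trans Set.inter_subset_left)]
  · exact le_iSup₂_of_le U hx le_rfl

/-- Localization commutes with sums, powers and finite intersections of ideals. -/
theorem inf_le_sq_of_isLocalization {R T : Type} [CommRing R] [CommRing T] [IsLocalRing T]
    [Algebra R T] (p : Ideal R) [p.IsPrime] [IsLocalization.AtPrime T p] {I J : Ideal R}
    (h : (I ⊔ p ^ 2) ⊓ (J ⊔ p ^ 2) ≤ p ^ 2) :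
    (I.map (algebraMap R T) ⊔ IsLocalRing.maximalIdeal T ^ 2) ⊓
      (J.map (algebraMap R T) ⊔ IsLocalRing.maximalIdeal T ^ 2) ≤
        IsLocalRing.maximalIdeal T ^ 2 := by
  rw [← IsLocalization.AtPrime.map_eq_maximalIdeal p T, ← Ideal.map_pow, ← Ideal.map_sup,
    ← Ideal.map_sup, ← IsLocalization.map_inf p.primeCompl]
  exact Ideal.map_mono h

theorem inf_le_sq_of_ringEquiv {R A : Type} [CommRing R] [CommRing A] (e : R ≃+* A)
    {I J p : Ideal A} (h : (I ⊔ p ^ 2) ⊓ (J ⊔ p ^ 2) ≤ p ^ 2) :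
    (I.comap e ⊔ p.comap e ^ 2) ⊓ (J.comap e ⊔ p.comap e ^ 2) ≤ p.comap e ^ 2 := by
  have hc : ∀ K : Ideal A, K.comap e = K.map e.symm := fun K => (Ideal.map_symm e).symm
  rw [hc, hc, hc, ← Ideal.map_pow, ← Ideal.map_sup, ← Ideal.map_sup, ← hc, ← hc, ← hc,
    ← Ideal.comap_inf]
  exact Ideal.comap_mono h

/-- Transversality can be checked in an affine chart. -/
theorem inf_stalkIdeal_le {A : Type} [CommRing A] (u : Spec (CommRingCat.of A) ⟶ X)
    [IsOpenImmersion u] (y : PrimeSpectrum A) (S S' : Set X)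
    (h : (PrimeSpectrum.vanishingIdeal (u ⁻¹' closure S : Set (PrimeSpectrum A)) ⊔
        y.asIdeal ^ 2) ⊓
      (PrimeSpectrum.vanishingIdeal (u ⁻¹' closure S' : Set (PrimeSpectrum A)) ⊔
        y.asIdeal ^ 2) ≤ y.asIdeal ^ 2) (x : X) (hx : u y = x) :
    (stalkIdeal S x ⊔ IsLocalRing.maximalIdeal (X.presheaf.stalk x) ^ 2) ⊓
      (stalkIdeal S' x ⊔ IsLocalRing.maximalIdeal (X.presheaf.stalk x) ^ 2) ≤
        IsLocalRing.maximalIdeal (X.presheaf.stalk x) ^ 2 := by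
  have hU : IsAffineOpen u.opensRange := isAffineOpen_opensRange u
  let U : X.affineOpens := ⟨u.opensRange, hU⟩
  have hxU : x ∈ u.opensRange := ⟨y, hx⟩
  have hrange : Set.range u = Set.range hU.fromSpec := by
    rw [IsAffineOpen.range_fromSpec]
    rfl
  let w := IsOpenImmersion.isoOfRangeEq u hU.fromSpec hrange
  obtain ⟨e, he⟩ := Spec.map_surjective w.hom
  have hiso : IsIso (Spec.map e) := by
    rw [he]
    infer_instance
  have hiso₁ : IsIso (Scheme.Spec.map e.op) := hiso
  have hiso₂ : IsIso e.op := isIso_of_reflects_iso e.op Scheme.Spec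
  have hiso₃ : IsIso e := (isIso_op_iff e).1 hiso₂
  let E : Γ(X, u.opensRange) ≃+* A := (asIso e).commRingCatIsoToRingEquiv
  have hfac : ∀ q, hU.fromSpec (Spec.map e q) = u q := by
    intro q
    rw [← Scheme.Hom.comp_apply, he, IsOpenImmersion.isoOfRangeEq_hom_fac]
  have hprime : (hU.primeIdealOf ⟨x, hxU⟩).asIdeal = y.asIdeal.comap E := by
    have : hU.primeIdealOf ⟨x, hxU⟩ = Spec.map e y := by
      apply hU.fromSpec.isOpenEmbedding.injective
      exact (hU.fromSpec_primeIdealOf _).trans (hx.symm.trans (hfac y).symm)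
    rw [this]
    rfl
  have hvan : ∀ S : Set X, (Scheme.IdealSheafData.vanishingIdeal
      ⟨closure S, isClosed_closure⟩).ideal U =
      (PrimeSpectrum.vanishingIdeal (u ⁻¹' closure S : Set (PrimeSpectrum A))).comap E := by
    intro S
    rw [Scheme.IdealSheafData.vanishingIdeal_ideal]
    ext f
    rw [Ideal.mem_comap, PrimeSpectrum.mem_vanishingIdeal, PrimeSpectrum.mem_vanishingIdeal]
    constructor
    · intro hf q hq
      refine hf (Spec.map e q) ?_
      change hU.fromSpec (Spec.map e q) ∈ closure S
      exact (congrArg (· ∈ closure S) (hfac q)).mpr hq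
    · intro hf q hq
      obtain ⟨q', rfl⟩ := (Spec.map e).surjective q
      refine hf q' ?_
      change hU.fromSpec (Spec.map e q') ∈ closure S at hq
      exact (congrArg (· ∈ closure S) (hfac q')).mp hq
  let _ : Algebra Γ(X, u.opensRange) (X.presheaf.stalk x) :=
    (X.presheaf.germ u.opensRange x hxU).hom.toAlgebra
  have hloc : IsLocalization.AtPrime (X.presheaf.stalk x)
      (hU.primeIdealOf ⟨x, hxU⟩).asIdeal := hU.isLocalization_stalk ⟨x, hxU⟩
  rw [stalkIdeal_eq S x U hxU, stalkIdeal_eq S' x U hxU, hvan, hvan]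
  refine inf_le_sq_of_isLocalization (hU.primeIdealOf ⟨x, hxU⟩).asIdeal ?_
  rw [hprime]
  exact inf_le_sq_of_ringEquiv E h

end StalkIdeal

end Toric

namespace Toric

/-! ### Transversality of the strict transform to the orbits. -/

section Transversality

/-- Let p be the preimage of q. Modulo p², the endomorphism s ∘ pr kills the equations of the strict
transform and fixes those of the orbit, so an element in both classes lies in p². -/
theorem inf_le_sq_of_retraction {A B : Type} [CommRing A] [CommRing B] (pr : A →+* B)
    (s : B →+* A) (hs : ∀ b, pr (s b) = b) (q : Ideal B) (O : Ideal A)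
    (hO : ∀ j ∈ O, j - s (pr j) ∈ q.comap pr ^ 2) :
    (RingHom.ker pr ⊔ q.comap pr ^ 2) ⊓ (O ⊔ q.comap pr ^ 2) ≤ q.comap pr ^ 2 := by
  have hsp : ∀ a ∈ q.comap pr ^ 2, s (pr a) ∈ q.comap pr ^ 2 := by
    have hle : q.comap pr ^ 2 ≤ (q.comap pr ^ 2).comap (s.comp pr) := by
      refine le_trans (Ideal.pow_right_mono ?_ 2) (Ideal.le_comap_pow (s.comp pr) 2)
      intro a ha
      rw [Ideal.mem_comap, Ideal.mem_comap]
      simpa [hs] using ha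
    exact fun a ha => hle ha
  rintro x ⟨hx, hx'⟩
  obtain ⟨i, hi, a, ha, rfl⟩ := Submodule.mem_sup.1 hx
  obtain ⟨j, hj, b, hb, hjb⟩ := Submodule.mem_sup.1 hx'
  have h1 : j - s (pr j) ∈ q.comap pr ^ 2 := hO j hj
  have h2 : s (pr (i + a)) ∈ q.comap pr ^ 2 := by
    rw [map_add, (RingHom.mem_ker).1 hi, zero_add]
    exact hsp a ha
  have h3 : i + a = (j - s (pr j)) + (b - s (pr b)) + s (pr (i + a)) := by
    rw [← hjb, map_add, map_add]
    ring
  rw [h3]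
  exact add_mem (add_mem h1 (sub_mem hb (hsp b hb))) h2

theorem mapDomainRingHom_section {P Q : Type} [AddCommMonoid P] [AddCommMonoid Q] {f : P →+ Q}
    {s : Q →+ P} (hs : ∀ q, f (s q) = q) (b : AddMonoidAlgebra ℂ Q) :
    AddMonoidAlgebra.mapDomainRingHom ℂ f (AddMonoidAlgebra.mapDomainRingHom ℂ s b) = b := by
  induction b using AddMonoidAlgebra.induction_linear with
  | zero => simp
  | add f g hf hg => rw [map_add, map_add, hf, hg]
  | single l c => simp [AddMonoidAlgebra.mapDomain_single, hs]

variable {N L : Type} [AddCommGroup N] [Module.Free ℤ N] [Module.Finite ℤ N]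

/-- The ideal of the closed orbit of `Z_τ` is generated by monomials. -/
theorem vanishingIdeal_affineOrbit_le (τ : PointedCone ℝ (RealSpan N)) :
    PrimeSpectrum.vanishingIdeal (affineOrbit τ : Set (PrimeSpectrum _)) ≤
      Ideal.span {f : AddMonoidAlgebra ℂ (dualMonoid τ) | ∃ w : dualMonoid τ,
        (¬ ∀ x ∈ τ, pairing N (1 ⊗ₜ (w : DualLattice N)) x = 0) ∧
          f = AddMonoidAlgebra.single w (1 : ℂ)} := by
  classical
  have hadd : ∀ w w' : dualMonoid τ, ((w + w' : dualMonoid τ) : DualLattice N) ∈ perpLattice τ ↔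
      w.1 ∈ perpLattice τ ∧ w'.1 ∈ perpLattice τ := by
    intro w w'
    refine ⟨fun hw => ?_, fun hw => add_mem hw.1 hw.2⟩
    have key : ∀ x ∈ τ, pairing N (1 ⊗ₜ w.1) x = 0 ∧ pairing N (1 ⊗ₜ w'.1) x = 0 := by
      intro x hx
      have h1 := mem_perpLattice.1 hw x hx
      rw [AddSubmonoid.coe_add, TensorProduct.tmul_add, map_add, LinearMap.add_apply] at h1
      have h2 := mem_dualMonoid.1 w.2 x hx
      have h3 := mem_dualMonoid.1 w'.2 x hx
      constructor <;> linarith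
    exact ⟨fun x hx => (key x hx).1, fun x hx => (key x hx).2⟩
  -- Killing the monomials outside τ^⊥ is multiplicative, because a sum of elements of τ^∨ lies in
  -- τ^⊥ only if both terms do. The kernel of the resulting endomorphism ε is a point of the orbit;
  -- a function f vanishing on the orbit then has ε(f) = 0, and f = f - ε(f) lies in the span of the
  -- killed monomials.
  let μ : Multiplicative (dualMonoid τ) →* AddMonoidAlgebra ℂ (dualMonoid τ) :=
    { toFun := fun w => if (w.toAdd : DualLattice N) ∈ perpLattice τ then
        AddMonoidAlgebra.single w.toAdd (1 : ℂ) else 0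
      map_one' := by
        rw [if_pos]
        · rfl
        · exact zero_mem (perpLattice τ)
      map_mul' := by
        intro w w'
        rw [toAdd_mul]
        by_cases h1 : (w.toAdd : DualLattice N) ∈ perpLattice τ
        · by_cases h2 : (w'.toAdd : DualLattice N) ∈ perpLattice τ
          · rw [if_pos ((hadd _ _).2 ⟨h1, h2⟩), if_pos h1, if_pos h2,
              AddMonoidAlgebra.single_mul_single, one_mul]
          · rw [if_neg fun h => h2 ((hadd _ _).1 h).2, if_neg h2, mul_zero]
        · rw [if_neg fun h => h1 ((hadd _ _).1 h).1, if_neg h1, zero_mul] }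
  let ε := AddMonoidAlgebra.lift ℂ (AddMonoidAlgebra ℂ (dualMonoid τ)) (dualMonoid τ) μ
  have hε : ∀ (w : dualMonoid τ) (c : ℂ), ε (AddMonoidAlgebra.single w c) =
      c • if (w : DualLattice N) ∈ perpLattice τ then AddMonoidAlgebra.single w (1 : ℂ) else 0 :=
    fun w c => AddMonoidAlgebra.lift_single μ w c
  have hsub : ∀ f, f - ε f ∈ Ideal.span {f : AddMonoidAlgebra ℂ (dualMonoid τ) |
      ∃ w : dualMonoid τ, (¬ ∀ x ∈ τ, pairing N (1 ⊗ₜ (w : DualLattice N)) x = 0) ∧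
        f = AddMonoidAlgebra.single w (1 : ℂ)} := by
    intro f
    induction f using AddMonoidAlgebra.induction_linear with
    | zero => simp
    | add f g hf hg =>
      rw [map_add, add_sub_add_comm]
      exact add_mem hf hg
    | single w c =>
      rw [hε]
      have hc : AddMonoidAlgebra.single w c = c • AddMonoidAlgebra.single w (1 : ℂ) := by
        simp
      split_ifs with hw
      · rw [hc, sub_self]
        exact zero_mem _
      · rw [smul_zero, sub_zero, hc, Algebra.smul_def]
        exact Ideal.mul_mem_left _ _ (Ideal.subset_span ⟨w, hw, rfl⟩)
  intro f hf
  let y : PrimeSpectrum (AddMonoidAlgebra ℂ (dualMonoid τ)) :=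
    ⟨RingHom.ker ε, RingHom.ker_isPrime ε⟩
  have hy : y ∈ (affineOrbit τ : Set (PrimeSpectrum _)) := by
    rintro _ ⟨w, hw, rfl⟩
    change ε _ = 0
    rw [hε, if_neg (mt mem_perpLattice.1 hw), smul_zero]
  have h0 : ε f = 0 := (PrimeSpectrum.mem_vanishingIdeal _ _).1 hf y hy
  have := hsub f
  rwa [h0, sub_zero] at this

/-- For a monomial X^w of the orbit, put w' = s(φ(w)) and w = w' + u with φ(u) = 0. The difference
is X^{w'} (X^u - 1), where the first factor again vanishes on the orbit and the second one on the
strict transform. -/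
theorem sub_section_mem_sq {N L : Type} [AddCommGroup N] [AddCommGroup L]
    {φ : DualLattice N →ₗ[ℤ] L} {τ : PointedCone ℝ (RealSpan N)}
    (hle : τ ≤ PointedCone.ofSubmodule (kerOrthogonal φ))
    {s : imageMonoid φ τ →+ dualMonoid τ} (hs : ∀ l, imageHom φ τ (s l) = l)
    (q : Ideal (AddMonoidAlgebra ℂ (imageMonoid φ τ))) {O : Ideal (AddMonoidAlgebra ℂ (dualMonoid τ))}
    (hO : O = Ideal.span {f : AddMonoidAlgebra ℂ (dualMonoid τ) | ∃ w : dualMonoid τ,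
        (¬ ∀ x ∈ τ, pairing N (1 ⊗ₜ (w : DualLattice N)) x = 0) ∧
          f = AddMonoidAlgebra.single w (1 : ℂ)})
    (hOq : O ≤ q.comap (AddMonoidAlgebra.mapDomainRingHom ℂ (imageHom φ τ)))
    (j : AddMonoidAlgebra ℂ (dualMonoid τ)) (hj : j ∈ O) :
    j - AddMonoidAlgebra.mapDomainRingHom ℂ s
      (AddMonoidAlgebra.mapDomainRingHom ℂ (imageHom φ τ) j) ∈
      q.comap (AddMonoidAlgebra.mapDomainRingHom ℂ (imageHom φ τ)) ^ 2 := by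
  set pr := AddMonoidAlgebra.mapDomainRingHom ℂ (imageHom φ τ) with hpr
  set s' := AddMonoidAlgebra.mapDomainRingHom ℂ s with hs'
  have hprs : ∀ b, pr (s' b) = b := mapDomainRingHom_section hs
  have hker : ∀ a, a - s' (pr a) ∈ q.comap pr := by
    intro a
    rw [Ideal.mem_comap, map_sub, hprs, sub_self]
    exact zero_mem q
  have hsp : ∀ a ∈ q.comap pr, s' (pr a) ∈ q.comap pr := by
    intro a ha
    rw [Ideal.mem_comap, hprs]
    exact ha
  have hOq' := hOq
  rw [hO] at hj hOq'
  rw [sq]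
  induction hj using Submodule.span_induction with
  | zero => simp
  | add f g _ _ hf hg =>
    rw [map_add, map_add, add_sub_add_comm]
    exact add_mem hf hg
  | smul a f hf' hf =>
    have : a • f - s' (pr (a • f)) = a * (f - s' (pr f)) + (a - s' (pr a)) * s' (pr f) := by
      rw [smul_eq_mul, map_mul, map_mul]
      ring
    rw [this]
    exact add_mem (Ideal.mul_mem_left _ _ hf) (Ideal.mul_mem_mul (hker a) (hsp f (hOq' hf')))
  | mem f hf =>
    obtain ⟨w, hw, rfl⟩ := hf
    set w' := s (imageHom φ τ w) with hw'
    have hu : (w.1 - w'.1) ∈ perpLattice τ := by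
      refine mem_perpLattice_of_ker hle ?_
      have := congrArg Subtype.val (hs (imageHom φ τ w))
      rw [map_sub, sub_eq_zero]
      exact this.symm
    have hw'' : ¬ ∀ x ∈ τ, pairing N (1 ⊗ₜ (w' : DualLattice N)) x = 0 := by
      intro h'
      refine hw (mem_perpLattice.1 ?_)
      have := add_mem hu (mem_perpLattice.2 h')
      rwa [sub_add_cancel] at this
    let u : dualMonoid τ := ⟨w.1 - w'.1, perpLattice_le_dualMonoid hu⟩
    have hwu : w = w' + u := Subtype.ext (by simp [u])
    have h1 : AddMonoidAlgebra.single w (1 : ℂ) - s' (pr (AddMonoidAlgebra.single w 1)) =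
        AddMonoidAlgebra.single w' (1 : ℂ) * (AddMonoidAlgebra.single u 1 - 1) := by
      have h2 : s' (pr (AddMonoidAlgebra.single w 1)) = AddMonoidAlgebra.single w' (1 : ℂ) := by
        simp [hpr, hs', AddMonoidAlgebra.mapDomain_single, hw']
      rw [h2, mul_sub, mul_one, AddMonoidAlgebra.single_mul_single, mul_one, ← hwu]
    rw [h1]
    refine Ideal.mul_mem_mul (hOq' (Ideal.subset_span ⟨w', hw'', rfl⟩)) ?_
    have h3 : imageHom φ τ u = 0 := by
      refine Subtype.ext ?_
      have := congrArg Subtype.val (hs (imageHom φ τ w))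
      change φ (w.1 - w'.1) = 0
      rw [map_sub, sub_eq_zero]
      exact this.symm
    have h4 : pr (AddMonoidAlgebra.single u 1 - 1) = 0 := by
      rw [map_sub, map_one, AddMonoidAlgebra.one_def]
      simp [hpr, AddMonoidAlgebra.mapDomain_single, h3]
    rw [Ideal.mem_comap, h4]
    exact zero_mem q

variable [AddCommGroup L] [Module.Free ℤ L] [Module.Finite ℤ L] {φ : DualLattice N →ₗ[ℤ] L}
  {ρ : PointedCone ℝ (RealSpan N)} (hρ : IsRational ρ) (hρs : IsStrictlyConvex ρ)
  {Δ : Fan N} (h : Δ.Subdivides ρ)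

include hρ hρs in
/-- The strict transform is transversal to all torus orbits. -/
theorem isTransversal_orbit (hφ : Function.Surjective φ)
    (hface : ∀ σ ∈ Δ.cones, IsFace (σ ⊓ PointedCone.ofSubmodule (kerOrthogonal φ)) σ)
    (τ : Δ.cones) :
    IsTransversal
      (strictTransformSet (Fan.toCone h) (Set.range (imageι φ ρ)) : Set Δ.toricVariety)
      (Δ.orbit τ) := by
  rintro x ⟨hxW, y, hyO, rfl⟩
  have hpre : Δ.chart τ ⁻¹' closure
      (strictTransformSet (Fan.toCone h) (Set.range (imageι φ ρ)) : Set Δ.toricVariety) =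
      Set.range (imageι φ τ.1) := by
    rw [IsClosed.closure_eq (strictTransformSet _ _).isClosed,
      Fan.coe_strictTransformSet hρ hρs φ h τ, Fan.preimage_chart_closure]
  have hyW : y ∈ Set.range (imageι φ τ.1) := by
    rw [← hpre]
    exact subset_closure hxW
  obtain ⟨z, hz⟩ := hyW
  -- A common point forces τ ⊆ ℓ: the monomial of the form that cuts out τ ∩ ℓ is invertible on the
  -- strict transform, but would vanish on the orbit if the form were not zero on τ.
  have hle : τ.1 ≤ PointedCone.ofSubmodule (kerOrthogonal φ) := by
    obtain ⟨m, hm, hmτ⟩ := hface τ.1 τ.2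
    have hzm := map_mem_basicOpen.2
      (mem_basicOpen_of_inf_kerOrthogonal (Δ.isRational _ τ.2) hm hmτ z)
    have hym : ∀ v ∈ τ.1, pairing N (1 ⊗ₜ m) v = 0 := by
      by_contra hcon
      subst hz
      exact hzm (hyO ⟨⟨m, hm⟩, hcon, rfl⟩)
    exact fun v hv => ((hmτ v).2 ⟨hv, hym v hv⟩).2
  obtain ⟨s, hs⟩ := exists_section_imageHom hφ hle
  let z' : PrimeSpectrum (AddMonoidAlgebra ℂ (imageMonoid φ τ.1)) := z
  let y' : PrimeSpectrum (AddMonoidAlgebra ℂ (dualMonoid τ.1)) := y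
  have hy' : y'.asIdeal = z'.asIdeal.comap
      (AddMonoidAlgebra.mapDomainRingHom ℂ (imageHom φ τ.1)) := by
    subst hz
    rfl
  let u : Spec (CommRingCat.of (AddMonoidAlgebra ℂ (dualMonoid τ.1))) ⟶ Δ.toricVariety := Δ.chart τ
  have hu : IsOpenImmersion u := inferInstanceAs (IsOpenImmersion (Δ.chart τ))
  refine inf_stalkIdeal_le u y' _ _ ?_ _ rfl
  have hspan : Ideal.span {f : AddMonoidAlgebra ℂ (dualMonoid τ.1) | ∃ w : dualMonoid τ.1,
        (¬ ∀ x ∈ τ.1, pairing N (1 ⊗ₜ (w : DualLattice N)) x = 0) ∧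
          f = AddMonoidAlgebra.single w (1 : ℂ)} ≤
      z'.asIdeal.comap (AddMonoidAlgebra.mapDomainRingHom ℂ (imageHom φ τ.1)) := by
    rw [← hy']
    exact Ideal.span_le.2 hyO
  rw [hy']
  refine le_trans ?_ (inf_le_sq_of_retraction _ _ (mapDomainRingHom_section hs) z'.asIdeal _
    (sub_section_mem_sq hle hs z'.asIdeal rfl hspan))
  refine inf_le_inf (sup_le_sup_right ?_ _) (sup_le_sup_right ?_ _)
  · intro f hf
    have hf' : ∀ b ∈ Set.range (imageι φ τ.1), f ∈ PrimeSpectrum.asIdeal b := by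
      intro b hb
      exact (PrimeSpectrum.mem_vanishingIdeal _ _).1 hf b (hpre.symm ▸ hb)
    exact hf' _ ⟨genericPt _, rfl⟩
  · refine le_trans (PrimeSpectrum.vanishingIdeal_anti_mono ?_)
      (vanishingIdeal_affineOrbit_le τ.1)
    intro b hb
    exact subset_closure ⟨b, hb, rfl⟩

end Transversality

end Toric

namespace Toric

/-! ### From dual bases to regular cones. -/

section RegularFaces

/-- A monoid with independent generators modulo units is cut out by a part of a dual basis. -/
theorem exists_forms_of_independent {L : Type} [AddCommGroup L] {Q : AddSubmonoid L}
    {s : Finset L} (hsQ : (s : Set L) ⊆ Q)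
    (hs : Q = AddSubmonoid.closure (s : Set L) ⊔ (unitsOf Q).toAddSubmonoid)
    (hind : ∀ a : L → ℤ, ∑ u ∈ s, a u • u ∈ unitsOf Q → ∀ u ∈ s, a u = 0)
    (hgen : ∀ l : L, ∃ q ∈ Q, ∃ q' ∈ Q, l = q - q') :
    ∃ a : s → L →+ ℤ, (∀ u : s, a u u.1 = 1) ∧ (∀ u v : s, u ≠ v → a u v.1 = 0) ∧
      ∀ l, l ∈ Q ↔ ∀ u, 0 ≤ a u l := by
  classical
  -- Independence modulo units makes the coordinates unique; the wanted forms are these coordinates,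
  -- and uniqueness also makes them additive.
  have huniq : ∀ (l : L) (c c' : L → ℤ), l - ∑ u ∈ s, c u • u ∈ unitsOf Q →
      l - ∑ u ∈ s, c' u • u ∈ unitsOf Q → ∀ u ∈ s, c u = c' u := by
    intro l c c' hc hc' u hu
    have h1 := sub_mem hc' hc
    have h2 : l - ∑ u ∈ s, c' u • u - (l - ∑ u ∈ s, c u • u) =
        ∑ u ∈ s, (c u - c' u) • u := by
      simp only [sub_smul, Finset.sum_sub_distrib]
      abel
    rw [h2] at h1
    exact sub_eq_zero.1 (hind (fun u => c u - c' u) h1 u hu)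
  have hQ : ∀ q ∈ Q, ∃ c : L → ℕ, q - ∑ u ∈ s, (c u : ℤ) • u ∈ unitsOf Q := by
    intro q hq
    rw [hs] at hq
    obtain ⟨y, hy, z, hz, rfl⟩ := AddSubmonoid.mem_sup.1 hq
    obtain ⟨c, -, rfl⟩ := AddSubmonoid.mem_closure_finset.1 hy
    refine ⟨c, ?_⟩
    simp only [natCast_zsmul, add_sub_cancel_left]
    exact hz
  have hex : ∀ l : L, ∃ c : L → ℤ, l - ∑ u ∈ s, c u • u ∈ unitsOf Q := by
    intro l
    obtain ⟨q, hq, q', hq', rfl⟩ := hgen l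
    obtain ⟨c, hc⟩ := hQ q hq
    obtain ⟨c', hc'⟩ := hQ q' hq'
    refine ⟨fun u => c u - c' u, ?_⟩
    have h1 := sub_mem hc hc'
    have h2 : q - ∑ u ∈ s, (c u : ℤ) • u - (q' - ∑ u ∈ s, (c' u : ℤ) • u) =
        q - q' - ∑ u ∈ s, ((c u : ℤ) - c' u) • u := by
      simp only [sub_smul, Finset.sum_sub_distrib]
      abel
    rwa [h2] at h1
  choose c hc using hex
  have hcs : ∀ v ∈ s, ∀ u ∈ s, c v u = if u = v then 1 else 0 := by
    intro v hv u hu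
    refine huniq v _ (fun w => if w = v then 1 else 0) (hc _) ?_ u hu
    have : ∑ u ∈ s, (if u = v then (1 : ℤ) else 0) • u = v := by
      rw [Finset.sum_eq_single v (fun w _ hw => by rw [if_neg hw, zero_smul]) (absurd hv),
        if_pos rfl, one_smul]
    rw [this, sub_self]
    exact zero_mem _
  refine ⟨fun u => AddMonoidHom.mk' (fun l => c l u.1) fun l l' => ?_,
    fun u => (hcs u.1 u.2 u.1 u.2).trans (if_pos rfl),
    fun u v huv => (hcs v.1 v.2 u.1 u.2).trans (if_neg fun h => huv (Subtype.ext h)),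
    fun l => ?_⟩
  · refine huniq (l + l') _ (fun u => c l u + c l' u) (hc _) ?_ u.1 u.2
    have h1 := add_mem (hc l) (hc l')
    have h2 : l - ∑ u ∈ s, c l u • u + (l' - ∑ u ∈ s, c l' u • u) =
        l + l' - ∑ u ∈ s, (c l u + c l' u) • u := by
      simp only [add_smul, Finset.sum_add_distrib]
      abel
    rwa [h2] at h1
  · constructor
    · intro hl u
      obtain ⟨n, hn⟩ := hQ l hl
      have h1 := huniq l _ _ (hc l) hn u.1 u.2
      change 0 ≤ c l u.1
      rw [h1]
      positivity
    · intro hl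
      have h1 : ∑ u ∈ s, c l u • u ∈ Q := by
        refine sum_mem fun u hu => ?_
        obtain ⟨k, hk⟩ := Int.eq_ofNat_of_zero_le (hl ⟨u, hu⟩)
        have hk' : c l u = k := hk
        rw [hk', natCast_zsmul]
        exact nsmul_mem (hsQ hu) k
      have h2 := add_mem h1 (mem_unitsOf.1 (hc l)).1
      rwa [add_sub_cancel] at h2

variable {N : Type} [AddCommGroup N] [Module.Free ℤ N] [Module.Finite ℤ N]

theorem IsRational.le_of_dualMonoid_le {σ τ : PointedCone ℝ (RealSpan N)} (hσ : IsRational σ)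
    (hτ : IsRational τ) (h : dualMonoid τ ≤ dualMonoid σ) : σ ≤ τ := by
  obtain ⟨s, hsσ, hs, -⟩ := hσ.exists_finset
  rw [hs]
  refine Submodule.span_le.2 ?_
  rintro _ ⟨n, hn, rfl⟩
  exact hτ.tmul_mem fun m hm => nonneg_of_mem_dualMonoid (h hm) (hsσ n hn)

/-- Biorthogonality splits N into the span of the n_i and the common kernel of the e_i; a basis of
the kernel completes the n_i. -/
theorem isRegularCone_hull {ι : Type} [Finite ι] {n : ι → N} {e : ι → DualLattice N}
    (he : ∀ i, e i (n i) = 1) (he' : ∀ i j, i ≠ j → e i (n j) = 0) :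
    IsRegularCone (PointedCone.hull ℝ ((fun n : N => (1 : ℝ) ⊗ₜ[ℤ] n) '' Set.range n)) := by
  classical
  have := Fintype.ofFinite ι
  let p : N →ₗ[ℤ] (ι → ℤ) := LinearMap.pi e
  let j : (ι → ℤ) →ₗ[ℤ] N := Fintype.linearCombination ℤ n
  have hpj : ∀ x, p (j x) = x := by
    intro x
    funext i
    simp only [p, j, LinearMap.pi_apply, Fintype.linearCombination_apply, map_sum, map_smul]
    rw [Finset.sum_eq_single i (fun k _ hk => by rw [he' i k hk.symm, smul_zero]) (by simp), he]
    simp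
  let E : ((ι → ℤ) × LinearMap.ker p) ≃ₗ[ℤ] N := LinearEquiv.ofBijective
    (j.coprod (LinearMap.ker p).subtype) (by
      constructor
      · rw [injective_iff_map_eq_zero]
        rintro ⟨x, y⟩ hxy
        simp only [LinearMap.coprod_apply, Submodule.subtype_apply] at hxy
        have h1 := congrArg p hxy
        rw [map_add, hpj, y.2, add_zero, map_zero] at h1
        subst h1
        rw [map_zero, zero_add] at hxy
        exact Prod.ext rfl (Subtype.ext hxy)
      · intro z
        refine ⟨(p z, ⟨z - j (p z), ?_⟩), ?_⟩
        · rw [LinearMap.mem_ker, map_sub, hpj, sub_self]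
        · simp)
  let B := ((Pi.basisFun ℤ ι).prod (Module.finBasis ℤ (LinearMap.ker p))).map E
  let f := Fintype.equivFin (ι ⊕ Fin (Module.finrank ℤ (LinearMap.ker p)))
  refine ⟨_, B.reindex f, f '' Set.range Sum.inl, ?_⟩
  congr 1
  rw [← Set.range_comp, ← Set.range_comp, ← Set.range_comp]
  congr 1
  funext i
  have hE : E (Pi.single i 1, 0) = n i := by
    change j (Pi.single i 1) + 0 = n i
    simp [j]
  simp [B, hE]

end RegularFaces

end Toric

namespace Toric

/-! ### Smooth points of Z^Λ and regular faces of σ₀. -/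

section SmoothPoints

/-- The monomials which do not vanish at a point of `Spec ℂ[P]` divide the powers of one of them. -/
theorem exists_notMem_asIdeal {L : Type} [AddCommGroup L] {P : AddSubmonoid L} (hP : P.FG)
    (x : PrimeSpectrum (AddMonoidAlgebra ℂ P)) :
    ∃ f : P, AddMonoidAlgebra.single f (1 : ℂ) ∉ x.asIdeal ∧
      ∀ l : P, AddMonoidAlgebra.single l (1 : ℂ) ∉ x.asIdeal → ∃ k : ℕ, k • f.1 - l.1 ∈ P := by
  classical
  obtain ⟨t, ht⟩ := hP
  have htP : ∀ g ∈ t, g ∈ P := fun g hg => ht ▸ AddSubmonoid.subset_closure hg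
  let χ : L → Prop := fun l =>
    ∃ hl : l ∈ P, AddMonoidAlgebra.single (⟨l, hl⟩ : P) (1 : ℂ) ∉ x.asIdeal
  have hχ0 : χ 0 := ⟨zero_mem P, fun h0 => x.isPrime.ne_top ((Ideal.eq_top_iff_one _).2 h0)⟩
  have hχadd : ∀ l ∈ P, ∀ l' ∈ P, χ (l + l') ↔ χ l ∧ χ l' := by
    intro l hl l' hl'
    have hmul : AddMonoidAlgebra.single (⟨l + l', add_mem hl hl'⟩ : P) (1 : ℂ) =
        AddMonoidAlgebra.single ⟨l, hl⟩ 1 * AddMonoidAlgebra.single ⟨l', hl'⟩ 1 := by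
      rw [AddMonoidAlgebra.single_mul_single, one_mul]
      rfl
    constructor
    · rintro ⟨_, h1⟩
      rw [hmul] at h1
      exact ⟨⟨hl, fun h2 => h1 (Ideal.mul_mem_right _ _ h2)⟩,
        ⟨hl', fun h2 => h1 (Ideal.mul_mem_left _ _ h2)⟩⟩
    · rintro ⟨⟨_, h1⟩, _, h2⟩
      refine ⟨add_mem hl hl', fun h3 => ?_⟩
      rw [hmul] at h3
      exact (x.isPrime.mem_or_mem h3).elim h1 h2
  -- The sum of all generators whose monomials do not vanish at x; a monomial not vanishing at x
  -- involves only these generators.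
  let f₀ : L := ∑ g ∈ t.filter χ, g
  have hf₀ : χ f₀ := Finset.sum_induction _ χ (fun l l' hl hl' =>
    (hχadd l hl.1 l' hl'.1).2 ⟨hl, hl'⟩) hχ0 fun g hg => (Finset.mem_filter.1 hg).2
  refine ⟨⟨f₀, hf₀.1⟩, hf₀.2, ?_⟩
  have key : ∀ l ∈ AddSubmonoid.closure (t : Set L), χ l → ∃ k : ℕ, k • f₀ - l ∈ P := by
    intro l hl
    induction hl using AddSubmonoid.closure_induction with
    | mem g hg =>
      intro hχg
      refine ⟨1, ?_⟩
      have hg' : g ∈ t.filter χ := Finset.mem_filter.2 ⟨hg, hχg⟩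
      have : 1 • f₀ - g = ∑ g ∈ (t.filter χ).erase g, g := by
        rw [one_smul, sub_eq_iff_eq_add, Finset.sum_erase_add _ _ hg']
      rw [this]
      exact sum_mem fun g' hg' => htP g' (Finset.mem_filter.1 (Finset.mem_of_mem_erase hg')).1
    | zero => exact fun _ => ⟨0, by simp⟩
    | add l l' hl hl' ih ih' =>
      intro h1
      rw [hχadd l (ht ▸ hl) l' (ht ▸ hl')] at h1
      obtain ⟨k, hk⟩ := ih h1.1
      obtain ⟨k', hk'⟩ := ih' h1.2
      refine ⟨k + k', ?_⟩
      have h2 := add_mem hk hk'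
      rwa [sub_add_sub_comm, ← add_smul] at h2
  exact fun l hl => key l.1 (ht.symm ▸ l.2) ⟨l.2, hl⟩

/-- The monoid `P[-f]` obtained from `P` by inverting `f`. -/
def invertElement {L : Type} [AddCommGroup L] (P : AddSubmonoid L) (f : L) : AddSubmonoid L where
  carrier := {l | ∃ k : ℕ, l + k • f ∈ P}
  add_mem' := by
    rintro l l' ⟨k, hk⟩ ⟨k', hk'⟩
    refine ⟨k + k', ?_⟩
    have h2 := add_mem hk hk'
    rwa [add_add_add_comm, ← add_smul] at h2
  zero_mem' := ⟨0, by simp⟩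

theorem mem_invertElement {L : Type} [AddCommGroup L] {P : AddSubmonoid L} {f l : L} :
    l ∈ invertElement P f ↔ ∃ k : ℕ, l + k • f ∈ P := Iff.rfl

theorem le_invertElement {L : Type} [AddCommGroup L] (P : AddSubmonoid L) (f : L) :
    P ≤ invertElement P f := fun l hl => ⟨0, by simpa using hl⟩

theorem neg_mem_invertElement {L : Type} [AddCommGroup L] (P : AddSubmonoid L) (f : L) :
    -f ∈ invertElement P f := ⟨1, by simp⟩

theorem fg_invertElement {L : Type} [AddCommGroup L] {P : AddSubmonoid L} (hP : P.FG) (f : L) :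
    (invertElement P f).FG := by
  have : invertElement P f = P ⊔ AddSubmonoid.closure {-f} := by
    apply le_antisymm
    · rintro l ⟨k, hk⟩
      have h1 := add_mem (AddSubmonoid.mem_sup_left hk) (AddSubmonoid.mem_sup_right (S := P)
        (nsmul_mem (AddSubmonoid.subset_closure (Set.mem_singleton (-f))) k))
      rwa [smul_neg, add_neg_cancel_right] at h1
    · exact sup_le (le_invertElement P f) ((AddSubmonoid.closure_le).2
        (Set.singleton_subset_iff.2 (neg_mem_invertElement P f)))
  rw [this]
  exact hP.sup ⟨{-f}, by rw [Finset.coe_singleton]⟩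

/-- Near a smooth point, the spectrum of a semigroup algebra is the spectrum of the algebra of a
monoid which is cut out by a part of a dual basis. -/
theorem exists_forms_of_mem_smoothLocus {L : Type} [AddCommGroup L] [Module.Free ℤ L]
    [Module.Finite ℤ L] {P : AddSubmonoid L} (hP : P.FG)
    (hgen : ∀ l : L, ∃ q ∈ P, ∃ q' ∈ P, l = q - q')
    (x : PrimeSpectrum (AddMonoidAlgebra ℂ P))
    (hx : x ∈ Algebra.smoothLocus ℂ (AddMonoidAlgebra ℂ P)) :
    ∃ f : P, AddMonoidAlgebra.single f (1 : ℂ) ∉ x.asIdeal ∧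
      ∃ (s : Finset L) (a : s → L →+ ℤ), (∀ u : s, a u u.1 = 1) ∧
        (∀ u v : s, u ≠ v → a u v.1 = 0) ∧
        ∀ l, (∃ k : ℕ, l + k • (f : L) ∈ P) ↔ ∀ u, 0 ≤ a u l := by
  obtain ⟨f, hf, hsub⟩ := exists_notMem_asIdeal hP x
  have hPQ := le_invertElement P f.1
  let i := AddSubmonoid.inclusion hPQ
  let _ := (AddMonoidAlgebra.mapDomainRingHom ℂ i).toAlgebra
  have hmap : ∀ l : P, algebraMap (AddMonoidAlgebra ℂ P)
      (AddMonoidAlgebra ℂ (invertElement P f.1)) (AddMonoidAlgebra.single l 1) =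
        AddMonoidAlgebra.single (i l) 1 := by
    intro l
    change AddMonoidAlgebra.mapDomainRingHom ℂ i _ = _
    simp [AddMonoidAlgebra.mapDomain_single]
  have hloc : IsLocalization.Away (AddMonoidAlgebra.single f (1 : ℂ))
      (AddMonoidAlgebra ℂ (invertElement P f.1)) :=
    isLocalization_mapDomain i (AddSubmonoid.inclusion_injective hPQ)
      f (n := ⟨-f.1, neg_mem_invertElement P f.1⟩) (Subtype.ext (add_neg_cancel f.1)) (by
        rintro ⟨l, k, hk⟩
        exact ⟨k, ⟨_, hk⟩, Subtype.ext rfl⟩)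
  have htower : IsScalarTower ℂ (AddMonoidAlgebra ℂ P)
      (AddMonoidAlgebra ℂ (invertElement P f.1)) :=
    .of_algebraMap_eq fun c => by
      change _ = AddMonoidAlgebra.mapDomainRingHom ℂ i (AddMonoidAlgebra.single 0 c)
      simp
  have hxr : x ∈ Set.range (PrimeSpectrum.comap
      (algebraMap (AddMonoidAlgebra ℂ P) (AddMonoidAlgebra ℂ (invertElement P f.1)))) := by
    rw [PrimeSpectrum.localization_away_comap_range (AddMonoidAlgebra ℂ (invertElement P f.1))
      (AddMonoidAlgebra.single f (1 : ℂ))]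
    exact hf
  obtain ⟨x', hx'⟩ := hxr
  have hmem : ∀ g, g ∈ x.asIdeal ↔ algebraMap (AddMonoidAlgebra ℂ P)
      (AddMonoidAlgebra ℂ (invertElement P f.1)) g ∈ x'.asIdeal := by
    intro g
    rw [← hx']
    exact Iff.rfl
  have hsm : x' ∈ Algebra.smoothLocus ℂ (AddMonoidAlgebra ℂ (invertElement P f.1)) := by
    rw [← Algebra.smoothLocus_comap_of_isLocalization
      (A := AddMonoidAlgebra ℂ P) (AddMonoidAlgebra.single f (1 : ℂ)), Set.mem_preimage, hx']
    exact hx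
  have hsm' : Algebra.IsSmoothAt ℂ x'.asIdeal := hsm
  -- After inverting f every monomial that does not vanish at the point is a unit, so the point lies
  -- on the closed orbit and the derivation argument applies.
  obtain ⟨s, hsQ, hs, hind⟩ := exists_independent_generators (fg_invertElement hP f.1) x'.asIdeal (by
    rintro ⟨w, k, hk⟩ hw
    by_contra hcon
    apply hw
    have hχ : AddMonoidAlgebra.single (⟨w + k • f.1, hk⟩ : P) (1 : ℂ) ∉ x.asIdeal := by
      intro h1
      rw [hmem, hmap] at h1
      have h2 : AddMonoidAlgebra.single (i ⟨w + k • f.1, hk⟩) (1 : ℂ) =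
          AddMonoidAlgebra.single ⟨w, k, hk⟩ 1 *
            algebraMap _ _ (AddMonoidAlgebra.single f (1 : ℂ)) ^ k := by
        rw [hmap, AddMonoidAlgebra.single_pow, AddMonoidAlgebra.single_mul_single, one_pow, one_mul]
        rfl
      rw [h2] at h1
      rcases x'.isPrime.mem_or_mem h1 with h3 | h3
      · exact hcon h3
      · exact hf ((hmem _).2 (x'.isPrime.mem_of_pow_mem _ h3))
    obtain ⟨k', hk'⟩ := hsub _ hχ
    refine ⟨⟨k, hk⟩, k', ?_⟩
    have h4 := add_mem hk' (nsmul_mem f.2 k)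
    have h5 : -w + k' • f.1 = k' • f.1 - (w + k • f.1) + k • f.1 := by abel
    change -w + k' • f.1 ∈ P
    rwa [h5])
  obtain ⟨a, ha, ha', hlQ⟩ := exists_forms_of_independent hsQ hs hind fun l => by
    obtain ⟨q, hq, q', hq', hl⟩ := hgen l
    exact ⟨q, hPQ hq, q', hPQ hq', hl⟩
  exact ⟨f, hf, s, a, ha, ha', fun l => mem_invertElement.symm.trans (hlQ l)⟩

/-- Near a smooth point Λ becomes a monoid Λ[-φ(m)] cut out by forms a_u that are part of a dual
basis. Such a monoid is saturated, so it coincides with φ(τ^∨ ∩ M) for the face τ of σ₀ where m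
vanishes. Composed with φ, the a_u are vectors of N that generate τ, and lifts of the dual elements
u show that they are part of a basis. -/
theorem exists_regular_face {N L : Type} [AddCommGroup N] [Module.Free ℤ N] [Module.Finite ℤ N]
    [AddCommGroup L] [Module.Free ℤ L] [Module.Finite ℤ L] {ρ : PointedCone ℝ (RealSpan N)}
    (hρ : IsRational ρ) (hρs : IsStrictlyConvex ρ) {φ : DualLattice N →ₗ[ℤ] L}
    (hφ : Function.Surjective φ) (hσ₀ : IsRational (sigmaZero ρ φ))
    (hτ : ∀ τ, IsFace τ (sigmaZero ρ φ) → IsRational τ)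
    (x : PrimeSpectrum (AddMonoidAlgebra ℂ (imageMonoid φ ρ)))
    (hx : x ∈ Algebra.smoothLocus ℂ (AddMonoidAlgebra ℂ (imageMonoid φ ρ))) :
    ∃ (m : DualLattice N) (hm : m ∈ dualMonoid ρ),
      AddMonoidAlgebra.single (imageHom φ ρ ⟨m, hm⟩) (1 : ℂ) ∉ x.asIdeal ∧
      IsRegularCone (faceCone (sigmaZero ρ φ) m) ∧
      ∀ w ∈ dualMonoid (faceCone (sigmaZero ρ φ) m), ∃ k : ℕ, ∃ v ∈ dualMonoid ρ,
        φ w + k • φ m = φ v := by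
  obtain ⟨⟨_, m, hm, rfl⟩, hfx, s, a, ha, ha', hQ⟩ :=
    exists_forms_of_mem_smoothLocus (P := imageMonoid φ ρ) (hρ.fg_dualMonoid.map _) (by
      intro l
      obtain ⟨w, rfl⟩ := hφ l
      obtain ⟨m, hm, hmb⟩ := isFace_bot hρ hρs
      obtain ⟨k, hk⟩ := exists_add_nsmul_mem hρ hm hmb (w := w) (by
        intro v hv
        have hv' : v = 0 := hv
        rw [hv', map_zero, LinearMap.zero_apply])
      refine ⟨_, ⟨_, hk k le_rfl, rfl⟩, _, ⟨_, nsmul_mem hm k, rfl⟩, ?_⟩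
      simp) x hx
  have hQ' : ∀ l, (∃ k : ℕ, l + k • φ m ∈ imageMonoid φ ρ) ↔ ∀ u, 0 ≤ a u l := hQ
  have hm₀ : m ∈ dualMonoid (sigmaZero ρ φ) := dualMonoid_anti inf_le_left hm
  -- Some w + j m lies in σ₀^∨, and a positive multiple of its image lies in Λ. The forms a_u are
  -- then nonnegative on the image itself, which therefore lies in the localized monoid.
  have hsat : ∀ w ∈ dualMonoid (faceCone (sigmaZero ρ φ) m),
      ∃ k : ℕ, φ w + k • φ m ∈ imageMonoid φ ρ := by
    intro w hw
    obtain ⟨j, hj⟩ := exists_add_nsmul_mem hσ₀ hm₀ (fun _ => mem_faceCone) hw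
    obtain ⟨k, hk, m', hm', hkm⟩ := exists_nsmul_add_mem_of_mem_inf_kerOrthogonal hρ (hj j le_rfl)
    have h1 : ∀ u, 0 ≤ a u (φ (w + j • m)) := by
      intro u
      have h2 := (hQ' (k • φ (w + j • m))).1 ⟨0, by
        rw [zero_smul, add_zero]
        exact ⟨m', hm', hkm⟩⟩ u
      rw [map_nsmul, nsmul_eq_mul] at h2
      exact nonneg_of_mul_nonneg_right h2 (by exact_mod_cast hk)
    obtain ⟨k', hk'⟩ := (hQ' _).2 h1
    refine ⟨j + k', ?_⟩
    rwa [map_add, map_nsmul, add_assoc, ← add_smul] at hk'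
  refine ⟨m, hm, hfx, ?_, fun w hw => ?_⟩
  · have hdual : ∀ w, w ∈ dualMonoid (faceCone (sigmaZero ρ φ) m) ↔ ∀ u, 0 ≤ a u (φ w) := by
      intro w
      refine ⟨fun hw => (hQ' _).1 (hsat w hw), fun hw => ?_⟩
      obtain ⟨k, v, hv, hkv⟩ := (hQ' _).2 hw
      have hkv' : φ v = φ w + k • φ m := hkv
      intro y hy
      obtain ⟨⟨hyρ, hyℓ⟩, hym⟩ := mem_faceCone.1 hy
      have h1 := mem_kerOrthogonal.1 hyℓ (w + (k : ℤ) • m - v) (by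
        rw [map_sub, map_add, map_zsmul, natCast_zsmul, hkv', sub_self])
      rw [TensorProduct.tmul_sub, TensorProduct.tmul_add, map_sub, map_add, LinearMap.sub_apply,
        LinearMap.add_apply, pairing_zsmul, hym, mul_zero, add_zero, sub_eq_zero] at h1
      have h2 := mem_dualMonoid.1 hv y hyρ
      rwa [← h1] at h2
    -- The forms a_u ∘ φ on M are vectors of N by biduality of the lattice.
    let n : s → N := fun u => (Module.evalEquiv ℤ N).symm ((a u).toIntLinearMap ∘ₗ φ)
    have hn : ∀ (u : s) (w : DualLattice N), w (n u) = a u (φ w) := fun u w =>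
      Module.apply_evalEquiv_symm_apply ℤ N w ((a u).toIntLinearMap ∘ₗ φ)
    choose e he using fun u : s => hφ u.1
    have hreg := isRegularCone_hull (n := n) (e := e)
      (fun u => by rw [hn, he, ha])
      (fun u v huv => by rw [hn, he, ha' v u huv.symm])
    have hrat : IsRational (PointedCone.hull ℝ
        ((fun n : N => (1 : ℝ) ⊗ₜ[ℤ] n) '' Set.range n)) :=
      ⟨(Set.finite_range n).toFinset, by rw [Set.Finite.coe_toFinset]⟩
    have heq : dualMonoid (faceCone (sigmaZero ρ φ) m) = dualMonoid (PointedCone.hull ℝ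
        ((fun n : N => (1 : ℝ) ⊗ₜ[ℤ] n) '' Set.range n)) := by
      ext w
      rw [hdual, mem_dualMonoid_hull, Set.forall_mem_range]
      simp only [hn]
    have hτr := hτ _ (isFace_faceCone hm₀)
    rw [le_antisymm (hτr.le_of_dualMonoid_le hrat heq.ge) (hrat.le_of_dualMonoid_le hτr heq.le)]
    exact hreg
  · obtain ⟨k, v, hv, hkv⟩ := hsat w hw
    exact ⟨k, v, hv, hkv.symm⟩

end SmoothPoints

end Toric

namespace Toric

/-! ### Local criteria for isomorphisms and smoothness. -/

section SmoothSchemes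

theorem isIso_morphismRestrict_of_forall_mem {X Y : Scheme.{0}} (f : X ⟶ Y) (U : Y.Opens)
    (h : ∀ x ∈ U, ∃ V : Y.Opens, x ∈ V ∧ IsIso (f ∣_ V)) : IsIso (f ∣_ U) := by
  choose! V hV hiso using h
  have hinf : ∀ A B : Y.Opens, A.ι ''ᵁ (A.ι ⁻¹ᵁ B) = A ⊓ B := fun A B => by
    rw [Scheme.Hom.image_preimage_eq_opensRange_inf, Scheme.Opens.opensRange_ι]
  change MorphismProperty.isomorphisms Scheme.{0} (f ∣_ U)
  refine (IsZariskiLocalAtTarget.iff_of_iSup_eq_top (P := MorphismProperty.isomorphisms Scheme.{0})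
    (fun x : U => U.ι ⁻¹ᵁ (V x.1)) ?_).2 fun x => ?_
  · refine top_le_iff.1 fun x _ => ?_
    exact TopologicalSpace.Opens.mem_iSup.2 ⟨x, hV x.1 x.2⟩
  · have h1 : MorphismProperty.isomorphisms Scheme.{0} (f ∣_ V x.1) := hiso x.1 x.2
    have h2 := IsZariskiLocalAtTarget.restrict h1 ((V x.1).ι ⁻¹ᵁ U)
    have h3 := (MorphismProperty.arrow_mk_iso_iff (MorphismProperty.isomorphisms Scheme.{0})
      (morphismRestrictRestrict f (V x.1) ((V x.1).ι ⁻¹ᵁ U) ≪≫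
        morphismRestrictEq f ((hinf _ _).trans (inf_comm _ _)))).1 h2
    exact (MorphismProperty.arrow_mk_iso_iff (MorphismProperty.isomorphisms Scheme.{0})
      (morphismRestrictRestrict f U (U.ι ⁻¹ᵁ V x.1) ≪≫ morphismRestrictEq f (hinf _ _))).2 h3

theorem mem_smoothLocus_of_mem_nonsingularLocus {A : Type} [CommRing A] [Algebra ℂ A]
    [Algebra.FiniteType ℂ A] (x : Spec (CommRingCat.of A))
    (hx : x ∈ nonsingularLocus (Spec.map (CommRingCat.ofHom (algebraMap ℂ A)))) :
    (x : PrimeSpectrum A) ∈ Algebra.smoothLocus ℂ A := by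
  have hfp : Algebra.FinitePresentation ℂ A := Algebra.FinitePresentation.of_finiteType.1 inferInstance
  obtain ⟨(U : (Spec (CommRingCat.of A)).Opens), hU, hxU⟩ := TopologicalSpace.Opens.mem_sSup.1 hx
  have hU' : Smooth (U.ι ≫ Spec.map (CommRingCat.ofHom (algebraMap ℂ A))) := hU
  obtain ⟨_, ⟨_, ⟨f, rfl⟩, rfl⟩, hxf, hfU⟩ :=
    PrimeSpectrum.isBasis_basic_opens.exists_subset_of_mem_open hxU U.2
  refine Algebra.basicOpen_subset_smoothLocus_iff_smooth.2 ?_ hxf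
  let j : Spec (CommRingCat.of (Localization.Away f)) ⟶ Spec (CommRingCat.of A) :=
    Spec.map (CommRingCat.ofHom (algebraMap A (Localization.Away f)))
  have hj : IsOpenImmersion j := IsOpenImmersion.of_isLocalization f
  have hjr : Set.range j = (PrimeSpectrum.basicOpen f : Set (PrimeSpectrum A)) :=
    PrimeSpectrum.localization_away_comap_range (Localization.Away f) f
  let l := IsOpenImmersion.lift U.ι j (by
    rw [hjr, Scheme.Opens.range_ι]
    exact hfU)
  have hl : l ≫ U.ι = j := IsOpenImmersion.lift_fac _ _ _
  have hlo : IsOpenImmersion (l ≫ U.ι) := hl ▸ hj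
  have hlo' : IsOpenImmersion l := IsOpenImmersion.of_comp l U.ι
  have h1 : Smooth (l ≫ U.ι ≫ Spec.map (CommRingCat.ofHom (algebraMap ℂ A))) := inferInstance
  rw [← Category.assoc, hl, ← Spec.map_comp, ← CommRingCat.ofHom_comp,
    HasRingHomProperty.Spec_iff (P := @Smooth)] at h1
  rw [← RingHom.smooth_algebraMap, IsScalarTower.algebraMap_eq ℂ A]
  exact h1

theorem monoidScheme.smooth_structure {P : Type} [AddCommMonoid P]
    [h : Algebra.Smooth ℂ (AddMonoidAlgebra ℂ P)] : Smooth (monoidScheme.structure P) := by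
  refine (HasRingHomProperty.Spec_iff (P := @Smooth)).2 ?_
  exact RingHom.smooth_algebraMap.2 h

end SmoothSchemes

/-! ### The embedded resolution. -/

section Resolution

variable {N L : Type} [AddCommGroup N] [Module.Free ℤ N] [Module.Finite ℤ N]
  [AddCommGroup L] [Module.Free ℤ L] [Module.Finite ℤ L]
  {ρ : PointedCone ℝ (RealSpan N)} (hρ : IsRational ρ) (hρs : IsStrictlyConvex ρ)
  {φ : DualLattice N →ₗ[ℤ] L} {Δ : Fan N} (h : Δ.Subdivides ρ)

include hρ hρs in
-- The charts of cones contained in ℓ cover the strict transform, and for regular cones these charts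
-- are smooth.
theorem smooth_strictTransform (hφ : Function.Surjective φ)
    (hface : ∀ σ ∈ Δ.cones, IsFace (σ ⊓ PointedCone.ofSubmodule (kerOrthogonal φ)) σ)
    (hreg : Δ.IsRegular) :
    Smooth (strictTransform.ι (Fan.toCone h) (Set.range (imageι φ ρ)) ≫ Fan.toCone h ≫
      monoidScheme.structure (dualMonoid ρ)) := by
  choose σ y hσ hy using Fan.exists_strictChart_apply_of_le hρ hρs φ h hface
  let 𝒰 : (strictTransform (Fan.toCone h) (Set.range (imageι φ ρ))).OpenCover :=
    Scheme.Cover.mkOfCovers (strictTransform (Fan.toCone h) (Set.range (imageι φ ρ)))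
      (fun x => monoidScheme (imageMonoid φ (σ x).1))
      (fun x => Fan.strictChart hρ hρs φ h (σ x)) (fun x => ⟨x, y x, hy x⟩)
      (fun x => inferInstanceAs (IsOpenImmersion (Fan.strictChart hρ hρs φ h (σ x))))
  have : IsZariskiLocalAtSource @Smooth.{0} :=
    HasRingHomProperty.instIsZariskiLocalAtSource (P := @Smooth.{0})
  refine (IsZariskiLocalAtSource.iff_of_openCover (P := @Smooth.{0}) 𝒰).2 fun x => ?_
  have := smooth_imageMonoid hφ (Δ.isRational _ (σ x).2) (hσ x) (hreg _ (σ x).2)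
  have h1 := monoidScheme.smooth_structure (P := imageMonoid φ (σ x).1)
  rw [← strictChart_structure hρ hρs h (σ x)] at h1
  exact h1

omit [Module.Free ℤ N] [Module.Finite ℤ N] [Module.Free ℤ L] [Module.Finite ℤ L] in
-- The form that works for κ also works for σ. Thus the face condition passes to resolutions, where
-- σ₀ itself may have been subdivided.
theorem isFace_inf_kerOrthogonal_of_le {σ κ : PointedCone ℝ (RealSpan N)} (hle : σ ≤ κ)
    (hκ : IsFace (κ ⊓ PointedCone.ofSubmodule (kerOrthogonal φ)) κ) :
    IsFace (σ ⊓ PointedCone.ofSubmodule (kerOrthogonal φ)) σ := by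
  obtain ⟨m, hm, hmκ⟩ := hκ
  refine ⟨m, dualMonoid_anti hle hm, fun x => ⟨fun hx => ⟨hx.1, ?_⟩, fun hx => ⟨hx.1, ?_⟩⟩⟩
  · exact ((hmκ x).1 ⟨hle hx.1, hx.2⟩).2
  · exact ((hmκ x).2 ⟨hle hx.1, hx.2⟩).2

include hρ hρs in
/-- The restriction of the toric modification to the strict transform is an isomorphism over the
nonsingular locus, if the fan contains all regular faces of `σ₀`. -/
theorem isIso_restriction_nonsingularLocus (hφ : Function.Surjective φ)
    (hface : ∀ σ ∈ Δ.cones, IsFace (σ ⊓ PointedCone.ofSubmodule (kerOrthogonal φ)) σ)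
    (hσ₀ : IsRational (sigmaZero ρ φ))
    (hrat : ∀ τ, IsFace τ (sigmaZero ρ φ) → IsRational τ)
    (hreg : ∀ τ, IsFace τ (sigmaZero ρ φ) → IsRegularCone τ → τ ∈ Δ.cones)
    {r : strictTransform (Fan.toCone h) (Set.range (imageι φ ρ)) ⟶
      monoidScheme (imageMonoid φ ρ)}
    (hr : r ≫ imageι φ ρ =
      strictTransform.ι (Fan.toCone h) (Set.range (imageι φ ρ)) ≫ Fan.toCone h) :
    IsIso (r ∣_ nonsingularLocus (imageι φ ρ ≫ monoidScheme.structure (dualMonoid ρ))) := by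
  refine isIso_morphismRestrict_of_forall_mem _ _ fun x hx => ?_
  rw [imageι, monoidScheme.map_structure] at hx
  have : AddMonoid.FG (imageMonoid φ ρ) :=
    (AddMonoid.fg_iff_addSubmonoid_fg _).2 (hρ.fg_dualMonoid.map _)
  obtain ⟨m, hm, hxm, hmreg, hsat⟩ := exists_regular_face hρ hρs hφ hσ₀ hrat x
    (mem_smoothLocus_of_mem_nonsingularLocus x hx)
  -- The face of σ₀ attached to the smooth point is regular, hence is not subdivided.
  have hτ := hreg _ (isFace_faceCone (dualMonoid_anti inf_le_left hm)) hmreg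
  let V : (monoidScheme (imageMonoid φ ρ)).Opens :=
    PrimeSpectrum.basicOpen (AddMonoidAlgebra.single (imageHom φ ρ ⟨m, hm⟩) (1 : ℂ))
  exact ⟨V, hxm, (Fan.isIso_restriction_basicOpen hρ hρs hr hface hm hτ hsat V rfl).2⟩

include hρ hρs in
/-- The toric modification of a fan which contains `σ₀` is a partial embedded resolution. -/
theorem isPartialEmbeddedResolution_toCone (hφ : Function.Surjective φ)
    (hσ₀ : sigmaZero ρ φ ∈ Δ.cones) : IsPartialEmbeddedResolution Δ h (imageι φ ρ) := by
  intro Δ' h'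
  have h'' : Δ'.Subdivides ρ := h'.1.1.trans h
  rw [Fan.toFan_toCone h'.1 h h'']
  have hface : ∀ σ ∈ Δ'.cones, IsFace (σ ⊓ PointedCone.ofSubmodule (kerOrthogonal φ)) σ := by
    intro σ hσ
    obtain ⟨κ, hκ, hle⟩ := h'.1.2 σ hσ
    exact isFace_inf_kerOrthogonal_of_le hle (isFace_inf_kerOrthogonal h hσ₀ hκ)
  obtain ⟨r, hr⟩ := Fan.exists_restriction φ h''
  refine ⟨⟨h'.2.1, Fan.isModification_toCone hρ hρs h'',
    ⟨r, hr, Fan.isModification_restriction hρ hρs hr hface⟩,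
    smooth_strictTransform hρ hρs h'' hφ hface h'.2.1,
    fun τ _ => isTransversal_orbit hρ hρs h'' hφ hface τ⟩, r, hr, ?_⟩
  exact isIso_restriction_nonsingularLocus hρ hρs h'' hφ hface (Δ.isRational _ hσ₀)
    (fun τ hτ => Δ.isRational _ (Δ.face_mem _ hσ₀ τ hτ))
    (fun τ hτ hreg => h'.2.2 τ (Δ.face_mem _ hσ₀ τ hτ) hreg) hr

end Resolution

end Toric

/-! ### The proposition. -/

theorem mainTheorem4 {N L : Type}
    [AddCommGroup N] [Module.Free ℤ N] [Module.Finite ℤ N]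
    [AddCommGroup L] [Module.Free ℤ L] [Module.Finite ℤ L]
    (ρ : PointedCone ℝ (RealSpan N)) (hρ : IsRational ρ) (hρs : IsStrictlyConvex ρ)
    (hρd : IsStrictlyConvex (dualCone ρ))
    (Λ : AddSubmonoid L) (hΛfg : Λ.FG) (hΛ : AddSubgroup.closure (Λ : Set L) = ⊤)
    (ψ : dualMonoid ρ →+ Λ) (hψ : Function.Surjective ψ)
    (φ : DualLattice N →ₗ[ℤ] L) (hφ : ∀ m : dualMonoid ρ, φ m = ψ m)
    (Δ : Fan N) (hΔ : Δ.Subdivides ρ) (hσ₀ : sigmaZero ρ φ ∈ Δ.cones) :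
    (∃ r : strictTransform (Fan.toCone hΔ) (Set.range (monoidScheme.map ψ)) ⟶ monoidScheme Λ,
      r ≫ monoidScheme.map ψ =
          strictTransform.ι (Fan.toCone hΔ) (Set.range (monoidScheme.map ψ)) ≫ Fan.toCone hΔ ∧
        IsNormalization r) ∧
    (Module.finrank ℝ (Submodule.span ℝ (sigmaZero ρ φ : Set (RealSpan N))) =
        Module.finrank ℤ L →
      ∃ e : strictTransform (Fan.toCone hΔ) (Set.range (monoidScheme.map ψ)) ≅
          affineToric (coneInLattice (sigmaZero ρ φ)),
        e.hom ≫ monoidScheme.structure (dualMonoid (coneInLattice (sigmaZero ρ φ))) =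
          strictTransform.ι (Fan.toCone hΔ) (Set.range (monoidScheme.map ψ)) ≫
            Fan.toCone hΔ ≫ monoidScheme.structure (dualMonoid ρ)) ∧
    IsPartialEmbeddedResolution Δ hΔ (monoidScheme.map ψ) := by
  -- Both Λ and ψ are determined by φ, so the embedding may be taken to be that of the image monoid
  -- of ρ.
  obtain rfl : Λ = imageMonoid φ ρ := by
    ext l
    constructor
    · intro hl
      obtain ⟨m, hm⟩ := hψ ⟨l, hl⟩
      exact ⟨m, m.2, (hφ m).trans (congrArg Subtype.val hm)⟩
    · rintro ⟨m, hm, rfl⟩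
      change φ (⟨m, hm⟩ : dualMonoid ρ) ∈ Λ
      rw [hφ ⟨m, hm⟩]
      exact (ψ _).2
  obtain rfl : ψ = imageHom φ ρ := by
    ext m
    exact (hφ m).symm
  -- The image of φ is a group containing Λ, which generates the lattice.
  have hφs : Function.Surjective φ := by
    have : φ.toAddMonoidHom.range = ⊤ := by
      rw [← top_le_iff, ← hΛ, AddSubgroup.closure_le]
      rintro _ ⟨m, -, rfl⟩
      exact ⟨m, rfl⟩
    exact AddMonoidHom.range_eq_top.1 this
  obtain ⟨r, hr⟩ := Fan.exists_restriction φ hΔ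
  exact ⟨⟨r, hr, isNormalization_restriction hρ hρs hΔ hφs hσ₀ hr⟩,
    fun hrank => exists_iso_coneInLattice hρ hρs hΔ hφs hσ₀ hrank,
    isPartialEmbeddedResolution_toCone hρ hρs hΔ hφs hσ₀⟩
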